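/- Let $\Lambda>0$ and $m>0$ with $3m\sqrt{\Lambda}<1$, put $F(r)=\tfrac{\Lambda r^2}{3}+\tfrac{2m}{r}-1$, and let $r_c$ be the largest root of $F$. Consider the expanding region $\mathcal R^+=\{r>r_c\}$ of the Schwarzschild–de Sitter spacetime together with its cosmological horizon $\mathcal C^+=\{r=r_c\}$ (without the bifurcation sphere), in coordinates $(\tau,r,\omega)\in\mathbb R\times[r_c,\infty)\times\mathbb S^2$ in which $$g=F\,d\tau^2-2\,d\tau\,dr+r^2\gamma ,$$ where $\gamma$ is the standard metric of $\mathbb S^2$. Thus $T=\partial_\tau$ is the Killing field that is null on $\mathcal C^+$, $T\tau=1$, and the level sets of $\tau$ are the outgoing null hypersurfaces. Let $\mathcal C^+_\tau$ be the part of $\mathcal C^+$ with parameter at least $\tau$. Let $\Sigma^+=\{r=\infty\}$ be the future boundary, identified with the cylinder $\mathbb R\times\mathbb S^2$ with metric $\mathring g=dt^2+\gamma$, where $t=\tau$ on $\Sigma^+$, and let $\Sigma^+_\tau=[\tau,\infty)\times\mathbb S^2$ be its part in the causal future of $\mathcal C_\tau^+$ and of the outgoing null hypersurface from the sphere with parameter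 $\tau$. On $\mathcal C^+$ let $N=T+Y$, where $Y=2\partial_r$ is the null vector field orthogonal to the spheres of symmetry with $g(T,Y)=-2$, and let ${}^*J^N[\psi]$ be the dual of the energy current $J^N_\mu=T_{\mu\nu}[\psi]N^\nu$, $T_{\mu\nu}[\psi]=\partial_\mu\psi\,\partial_\nu\psi-\tfrac12 g_{\mu\nu}\,\partial^\alpha\psi\,\partial_\alpha\psi$. A finite energy solution of $\Box_g\psi=0$ is a limit of smooth solutions on $\mathcal R^+\cup\mathcal C^+$, locally in the first order energies (with the $L^2$ norm of the function included) on $\mathcal C^+$, on the outgoing null hypersurfaces and on the hypersurfaces $\Sigma_r$ of constant $r>r_c$. There is a constant $b>0$ that depends only on $\Lambda$ and $m$ such that the following holds for every $\tau_0>0$ and every finite energy solution $\psi$ of $\Box_g\psi=0$. As $r\to\infty$, the functions $\psi|_{\Sigma_r}$ have a limit on $\Sigma^+$, again denoted by $\psi$, locally in $H^1(\mathbb R\times\mathbb S^2)$, and, with $\mathring\nabla$ the gradient of the cylinder: 1. If, for some $k\in\mathbb N$ and $C_k>0$, $$\int_{\mathcal C^+_\tau}{}^*J^N[\psi]\le\frac{C_k}{\tau^k}\qquad(\tau>\tau_0),$$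 then there is a constant $C$ with $C_k\le C<\infty$ such that $$\int_{\Sigma^+_\tau}|\mathring\nabla\psi|^2\,d\mu_{\mathring g}\le\frac{C}{\tau^k}\qquad(\tau>\tau_0).$$ 2. If, for some $\beta>0$ with $\beta\ne b$ and some $C_\beta>0$, $$\int_{\mathcal C^+_\tau}{}^*J^N[\psi]\le C_\beta\,e^{-\beta\tau}\qquad(\tau>\tau_0),$$ then there is a constant $C$ with $C_\beta<C<\infty$ such that $$\int_{\Sigma^+_\tau}|\mathring\nabla\psi|^2\,d\mu_{\mathring g}\le C\,e^{-\min\{b,\beta\}\,\tau}\qquad(\tau>\tau_0).$$ -/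

import Mathlib

open Set Filter Topology MeasureTheory
open scoped ENNReal ContDiff RealInnerProductSpace

namespace SdS

/-!
Schwarzschild–de Sitter spacetime near an expanding region.

We use horizon-regular (outgoing null) coordinates `(τ, y) ∈ ℝ × (ℝ³ \ {0})`, where `r = ‖y‖` is the
area radius, `y / ‖y‖` the point on the sphere of symmetry, and `τ = κ⁻¹ log u` up to an additive
constant, `(u, v)` being the double null coordinates in which the cosmological horizons are `u = 0`
and `v = 0` and `κ` the surface gravity. The metric `-Ω² du dv + r² γ` becomes
`F dτ² - 2 dτ dr + r² γ` with `F = Λ r² / 3 + 2 m / r - 1`. On `r > r_c`, putting `dt = dτ - dr / F`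
gives the form `-F⁻¹ dr² + F dt² + r² γ`.

* The expanding region `𝓡⁺` is `{‖y‖ > r_c}`, and its boundary `{‖y‖ = r_c}` is the cosmological
  horizon `𝓒⁺` without the bifurcation sphere.
* The Killing field `T` is `∂_τ`, so that the coordinate `τ` restricts on `𝓒⁺` to a function that is
  constant on the spheres of symmetry with `T τ = 1`. Such a function is unique up to an additive
  constant, which is absorbed by translating the coordinate `τ` (an isometry).
* The outgoing null hypersurface `C_τ` is a level set of the coordinate `τ`; time is oriented so that
  `∂_τ` and `∂_r` are future directed on `𝓒⁺`.
-/

/-- Euclidean three-space. -/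
abbrev E3 : Type := EuclideanSpace ℝ (Fin 3)

/-- The unit sphere. -/
abbrev S2 : Type := Metric.sphere (0 : E3) 1

/-- The coordinate space `(τ, y)`. -/
abbrev Pt : Type := ℝ × E3

/-- Components of tangent vectors and of covectors: `(a, w)` is the vector `a ∂_τ + w · ∂_y`, and
`(α, η)` is the covector `α dτ + η · dy`. -/
abbrev Vec : Type := ℝ × E3

/-- `F = Λ r² / 3 + 2 m / r - 1`, the inverse square of the lapse of the foliation by area radius. -/
noncomputable def F (Λ m r : ℝ) : ℝ := Λ * r ^ 2 / 3 + 2 * m / r - 1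

/-- The area radius `r_c` of the cosmological horizon: the largest positive root of `F`. -/
noncomputable def rc (Λ m : ℝ) : ℝ := sSup {r : ℝ | 0 < r ∧ F Λ m r = 0}

/-- The expanding region together with its past boundary `𝓒⁺`. -/
def region (Λ m : ℝ) : Set Pt := {p | rc Λ m ≤ ‖p.2‖}

/-- The outward radial unit vector of `ℝ³`. -/
noncomputable def rad (y : E3) : E3 := ‖y‖⁻¹ • y

/-- The component of `w` tangent to the sphere through `y`. -/
noncomputable def tang (y w : E3) : E3 := w - ⟪w, rad y⟫ • rad y

/-- The metric `F dτ² - 2 dτ dr + r² γ`. -/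
noncomputable def metric (Λ m : ℝ) (p : Pt) (X Z : Vec) : ℝ :=
  F Λ m ‖p.2‖ * X.1 * Z.1 - (X.1 * ⟪Z.2, rad p.2⟫ + Z.1 * ⟪X.2, rad p.2⟫)
    + ⟪tang p.2 X.2, tang p.2 Z.2⟫

/-- The pairing of a covector with a vector. -/
noncomputable def pair (ξ X : Vec) : ℝ := ξ.1 * X.1 + ⟪ξ.2, X.2⟫

/-- Raising the index of a covector with the metric (see `metric_sharp`). -/
noncomputable def sharp (Λ m : ℝ) (p : Pt) (ξ : Vec) : Vec :=
  (-⟪ξ.2, rad p.2⟫,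
    tang p.2 ξ.2 + (-ξ.1 - F Λ m ‖p.2‖ * ⟪ξ.2, rad p.2⟫) • rad p.2)

/-- The differential of a function. -/
noncomputable def diff (ψ : Pt → ℝ) (p : Pt) : Vec :=
  (fderiv ℝ ψ p (1, 0),
    (InnerProductSpace.toDual ℝ E3).symm ((fderiv ℝ ψ p).comp (ContinuousLinearMap.inr ℝ ℝ E3)))

/-- The wave operator `□ψ = |det g|^{-1/2} ∂_μ (|det g|^{1/2} g^{μν} ∂_ν ψ)`. In the coordinates
`(τ, y)` one has `det g = -1`, so this is the coordinate divergence of the gradient of `ψ`. -/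
noncomputable def box (Λ m : ℝ) (ψ : Pt → ℝ) (p : Pt) : ℝ :=
  LinearMap.trace ℝ Vec
    (fderiv ℝ (fun q : Pt => sharp Λ m q (diff ψ q)) p : Vec →L[ℝ] Vec).toLinearMap

/-- Smooth solutions of `□ψ = 0` on the expanding region, up to and including `𝓒⁺`. -/
def IsSmoothSolution (Λ m : ℝ) (ψ : Pt → ℝ) : Prop :=
  ∀ p ∈ region Λ m, ContDiffAt ℝ ∞ ψ p ∧ box Λ m ψ p = 0

/-- The vector metrically dual to the energy current `J^X`, where
`J^X(Z) = ξ(X) ξ(Z) - (1/2) g(X, Z) g⁻¹(ξ, ξ)` is the energy momentum tensor of a function with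
differential `ξ`. -/
noncomputable def current (Λ m : ℝ) (p : Pt) (ξ X : Vec) : Vec :=
  pair ξ X • sharp Λ m p ξ - (1 / 2 * pair ξ (sharp Λ m p ξ)) • X

/-- The redshift vector field `N = T + Y` on `𝓒⁺`: here `T = ∂_τ`, and `Y = 2 ∂_r` is the null vector
orthogonal to the spheres of symmetry with `g(T, Y) = -2`. -/
noncomputable def redshiftN (y : E3) : Vec := (1, (2 : ℝ) • rad y)

/-- The density of `*J^N` on `𝓒⁺` with respect to `dτ dγ`. As the volume form of the spacetime is
`r² dτ dr dγ`, the dual of a 1-form restricts on a level set of `r` to `r²` times the radial component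
of the corresponding vector; the sign is that of the orientation for which the flux is nonnegative
(see `horizonDensity_eq`). -/
noncomputable def horizonDensity (Λ m : ℝ) (p : Pt) (ξ : Vec) : ℝ :=
  -(‖p.2‖ ^ 2 * ⟪(current Λ m p ξ (redshiftN p.2)).2, rad p.2⟫)

/-- The standard surface measure of the unit sphere. -/
noncomputable def sphereMeasure : Measure S2 := (volume : Measure E3).toSphere

/-- The measure `dt dγ` of the standard cylinder `ℝ × 𝕊²`. -/
noncomputable def cylMeasure : Measure (ℝ × S2) := (volume : Measure ℝ).prod sphereMeasure

/-- The point with coordinate `τ` on the sphere of area radius `r` in direction `x`. -/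
noncomputable def pt (τ r : ℝ) (x : S2) : Pt := (τ, r • (x : E3))

/-- The nondegenerate energy flux `∫_{𝓒⁺_τ} *J^N` through the segment `𝓒⁺_τ` of the cosmological
horizon to the future of the sphere with parameter `τ`, of a function with differential `dψ`. -/
noncomputable def horizonFlux (Λ m : ℝ) (dψ : Pt → Vec) (τ : ℝ) : ℝ≥0∞ :=
  ∫⁻ z in Ici τ ×ˢ (univ : Set S2),
    ENNReal.ofReal (horizonDensity Λ m (pt z.1 (rc Λ m) z.2) (dψ (pt z.1 (rc Λ m) z.2))) ∂cylMeasure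

/-- Finite energy solutions `ψ` of `□ψ = 0`, with differential `dψ`: the closure of the smooth
solutions in the energies of first order through compact pieces of the horizon `𝓒⁺` (where only
derivatives tangent to `𝓒⁺` enter), of the outgoing null hypersurfaces `τ = s` (again tangential
derivatives only), and of the level sets `Σ_r`, `r > r_c`. Here `ψ` and `dψ` are representatives which
are defined up to null sets on each of these hypersurfaces. -/
def IsFiniteEnergySolution (Λ m : ℝ) (ψ : Pt → ℝ) (dψ : Pt → Vec) : Prop :=
  Measurable ((region Λ m).domRestrict ψ) ∧ Measurable ((region Λ m).domRestrict dψ) ∧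
  ∃ φ : ℕ → Pt → ℝ, (∀ n, IsSmoothSolution Λ m (φ n)) ∧
    (∀ a b : ℝ, Tendsto (fun n => ∫⁻ z in Icc a b ×ˢ (univ : Set S2),
        (let p := pt z.1 (rc Λ m) z.2
         let ξ := diff (φ n) p - dψ p
         ENNReal.ofReal ((φ n p - ψ p) ^ 2 + ξ.1 ^ 2 + ‖tang p.2 ξ.2‖ ^ 2)) ∂cylMeasure)
      atTop (𝓝 0)) ∧
    (∀ s R : ℝ, Tendsto (fun n => ∫⁻ z in Icc (rc Λ m) R ×ˢ (univ : Set S2),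
        (let p := pt s z.1 z.2
         let ξ := diff (φ n) p - dψ p
         ENNReal.ofReal ((φ n p - ψ p) ^ 2 + ‖ξ.2‖ ^ 2)) ∂cylMeasure)
      atTop (𝓝 0)) ∧
    (∀ r a b : ℝ, rc Λ m < r → Tendsto (fun n => ∫⁻ z in Icc a b ×ˢ (univ : Set S2),
        (let p := pt z.1 r z.2
         let ξ := diff (φ n) p - dψ p
         ENNReal.ofReal ((φ n p - ψ p) ^ 2 + ξ.1 ^ 2 + ‖ξ.2‖ ^ 2)) ∂cylMeasure)
      atTop (𝓝 0))

/-- The gradient on the standard cylinder of `(τ, ω) ↦ ψ(τ, r ω)`: the `τ`-derivative and the gradient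
along the unit sphere, which is `r` times the induced angular gradient. -/
noncomputable def cylGrad (dψ : Pt → Vec) (r : ℝ) (z : ℝ × S2) : ℝ × E3 :=
  ((dψ (pt z.1 r z.2)).1, r • tang (z.2 : E3) (dψ (pt z.1 r z.2)).2)

/-- The limit of `ψ` on the future boundary `Σ⁺ = {r = ∞}`, as a function `f` on the cylinder `ℝ × 𝕊²`
with gradient `G`: as `r → ∞` the functions `(τ, ω) ↦ ψ(τ, r ω)` converge to `f` and their gradients
converge to `G`, both in `L²` over compact sets. (So `f` is locally in `H¹` and `G` is its
distributional gradient.) On `Σ_r` the coordinates `t` and `τ` differ by a constant, which converges as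
`r → ∞`; we normalise it so that `t = τ` on `Σ⁺`. -/
def IsFutureBoundaryLimit (ψ : Pt → ℝ) (dψ : Pt → Vec) (f : ℝ × S2 → ℝ) (G : ℝ × S2 → ℝ × E3) :
    Prop :=
  Measurable f ∧ Measurable G ∧
  ∀ a b : ℝ, Tendsto (fun r : ℝ => ∫⁻ z in Icc a b ×ˢ (univ : Set S2),
      ENNReal.ofReal ((ψ (pt z.1 r z.2) - f z) ^ 2 + ((cylGrad dψ r z).1 - (G z).1) ^ 2
        + ‖(cylGrad dψ r z).2 - (G z).2‖ ^ 2) ∂cylMeasure)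
    atTop (𝓝 0)

/-- The rescaled energy `∫_{Σ⁺_τ} |∇ψ|²` with respect to the metric `dt² + γ` of the cylinder. Since
`τ` is nondecreasing along future directed causal curves, the causal future of `𝓒⁺_τ ∪ C_τ` is the
set where the coordinate `τ` is at least the given value, and `Σ⁺_τ` is `[τ, ∞) × 𝕊²`. -/
noncomputable def boundaryEnergy (G : ℝ × S2 → ℝ × E3) (τ : ℝ) : ℝ≥0∞ :=
  ∫⁻ z in Ici τ ×ˢ (univ : Set S2), ENNReal.ofReal ((G z).1 ^ 2 + ‖(G z).2‖ ^ 2) ∂cylMeasure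

lemma inner_rad_self {y : E3} (hy : y ≠ 0) : ⟪rad y, rad y⟫ = 1 := by
  have h : ‖y‖ ≠ 0 := norm_ne_zero_iff.mpr hy
  rw [rad, real_inner_smul_left, real_inner_smul_right, real_inner_self_eq_norm_sq]
  field_simp

lemma inner_tang_rad {y : E3} (hy : y ≠ 0) (w : E3) : ⟪tang y w, rad y⟫ = 0 := by
  rw [tang, inner_sub_left, real_inner_smul_left, inner_rad_self hy, mul_one, sub_self]

/-- `sharp` is the musical isomorphism of `metric`. -/
lemma metric_sharp (Λ m : ℝ) (p : Pt) (hp : p.2 ≠ 0) (ξ X : Vec) :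
    metric Λ m p (sharp Λ m p ξ) X = pair ξ X := by
  have h1 := inner_rad_self hp
  have h2 := inner_tang_rad hp ξ.2
  have h3 : ⟪rad p.2, X.2⟫ = ⟪X.2, rad p.2⟫ := real_inner_comm _ _
  have h4 : ⟪rad p.2, ξ.2⟫ = ⟪ξ.2, rad p.2⟫ := real_inner_comm _ _
  simp only [metric, sharp, pair, inner_add_left, real_inner_smul_left, h1, h2]
  simp only [tang, inner_sub_left, inner_sub_right, inner_add_left, real_inner_smul_left,
    real_inner_smul_right, h1, h3]
  ring

/-- On the horizon, `*J^N = r_c² ((T ψ)² + |∇̸ψ|²) dτ dγ`. -/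
lemma horizonDensity_eq (Λ m : ℝ) (p : Pt) (hp : p.2 ≠ 0) (hF : F Λ m ‖p.2‖ = 0) (ξ : Vec) :
    horizonDensity Λ m p ξ = ‖p.2‖ ^ 2 * (ξ.1 ^ 2 + ‖tang p.2 ξ.2‖ ^ 2) := by
  have h1 := inner_rad_self hp
  have h2 := inner_tang_rad hp ξ.2
  have h4 : ⟪rad p.2, ξ.2⟫ = ⟪ξ.2, rad p.2⟫ := real_inner_comm _ _
  rw [← real_inner_self_eq_norm_sq (tang p.2 ξ.2)]
  simp only [horizonDensity, current, redshiftN, sharp, pair, hF, Prod.snd_sub, Prod.smul_snd,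
    inner_add_left, inner_sub_left, inner_add_right, real_inner_smul_left, real_inner_smul_right,
    h1, h2]
  simp only [tang, inner_sub_left, inner_sub_right, real_inner_smul_left, real_inner_smul_right,
    h1, h4]
  ring

/-- Smooth solutions are finite energy solutions. -/
lemma IsSmoothSolution.isFiniteEnergySolution {Λ m : ℝ} {ψ : Pt → ℝ}
    (h : IsSmoothSolution Λ m ψ) : IsFiniteEnergySolution Λ m ψ (diff ψ) := by
  have hc : ContinuousOn ψ (region Λ m) := fun p hp => (h p hp).1.continuousAt.continuousWithinAt
  have hd : ContinuousOn (fderiv ℝ ψ) (region Λ m) := fun p hp =>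
    ((h p hp).1.continuousAt_fderiv (by simp)).continuousWithinAt
  have hD : ContinuousOn (diff ψ) (region Λ m) := by
    refine (hd.clm_apply continuousOn_const).prodMk ?_
    exact (InnerProductSpace.toDual ℝ E3).symm.continuous.comp_continuousOn
      (hd.clm_comp continuousOn_const)
  exact ⟨hc.domRestrict.measurable, hD.domRestrict.measurable, fun _ => ψ, fun _ => h,
    by simp [tang], by simp, by simp⟩

end SdS

namespace SdS

/-! ### The function `F` and the radius of the cosmological horizon -/

/-! The proof is the multiplier method on coordinate slabs `[a, b] × [r₁, r₂] × 𝕊²`. For a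
multiplier `α ∂_τ + β ∂_r` the fluxes through `r = r₂` and `τ = b` are bounded by those through `r =
r₁` and `τ = a` as soon as the weighted bulk term has a sign (`weighted_energy_le`). Two multipliers
suffice.

In a thin collar `ρ ≤ r ≤ r₁` of the horizon, positivity of `F'` (the redshift) lets the bulk term
dominate a multiple of the energy flux through `τ = const`. A weight `exp (k (τ - t))` then shows
that the null energy at `t` is at most a constant times the horizon flux on `[s, t]` plus `exp (-b₀
(t - s))` times the null energy at `s`. With `k = 0` the same inequality bounds the energy on `r =
r₁` (`IsHorizonRadius.exists_near_bound`).

Beyond `r₁`, the multiplier `F⁻¹ ∂_τ + ∂_r`, normal to the level sets of `r`, has a bulk term of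
good sign because `r² F' - 2 r F = 2 r - 6 m > 0` outside the photon sphere. As `1 / F` decays like
`r⁻²`, a cutoff in `τ` has to move only a finite distance, so the energy at any large `r` over `[a,
b]` is controlled by that on `r = r₁` over an interval longer by a fixed lag (`far_energy_le`). The
same bound makes `∂_r ψ` of size `r⁻²` in `L²`, so `ψ` converges as `r → ∞`; applied to the
derivatives along `∂_τ` and the rotations it gives convergence of the cylinder gradient. All this is
done for smooth solutions and passes to finite energy solutions by approximation.

Together these estimates bound the energy on the boundary after `τ` by the horizon flux and the null
energy at `τ - ℓ`. Iterating the collar inequality with a long step shows that the null energy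
inherits any profile which varies slowly compared with `exp (-b₀ τ)` (`exists_le_mul_profile`,
`exists_boundary_decay`); inverse powers and exponentials of rate at most `b₀ / 2` are such
profiles. -/

lemma hasDerivAt_F (Λ m : ℝ) {r : ℝ} (hr : r ≠ 0) :
    HasDerivAt (F Λ m) (2 * Λ * r / 3 - 2 * m / r ^ 2) r := by
  have h1 : HasDerivAt (fun r : ℝ => Λ * r ^ 2 / 3) (Λ * (2 * r) / 3) r := by
    simpa using ((hasDerivAt_pow 2 r).const_mul Λ).div_const 3
  have h2 : HasDerivAt (fun r : ℝ => 2 * m / r) (2 * m * (-(r ^ 2)⁻¹)) r := by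
    simpa [div_eq_mul_inv] using (hasDerivAt_inv hr).const_mul (2 * m)
  have h3 := (h1.add h2).sub_const 1
  refine (h3.congr_deriv ?_)
  field_simp
  ring

lemma contDiffAt_F (Λ m : ℝ) {r : ℝ} (hr : r ≠ 0) {n : WithTop ℕ∞} : ContDiffAt ℝ n (F Λ m) r := by
  unfold F
  fun_prop (disch := assumption)

lemma continuousAt_F (Λ m : ℝ) {r : ℝ} (hr : r ≠ 0) : ContinuousAt (F Λ m) r :=
  (hasDerivAt_F Λ m hr).continuousAt

/-- `F / r²` is increasing to the right of the photon sphere. -/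
lemma F_div_sq_lt {Λ m r s : ℝ} (hm : 0 < m) (hr : 3 * m ≤ r) (hrs : r < s) :
    F Λ m r / r ^ 2 < F Λ m s / s ^ 2 := by
  have hr0 : 0 < r := by linarith
  have hs0 : 0 < s := by linarith
  -- The `Λ` terms cancel, leaving a difference of values of `2 m / r ^ 3 - 1 / r ^ 2`. With `3 m ≤
  -- r` the bracket is at least `r (s - r) (s + 2 r) / 3`.
  have key : F Λ m s / s ^ 2 - F Λ m r / r ^ 2 =
      (s - r) * (r * s * (s + r) - 2 * m * (s ^ 2 + s * r + r ^ 2)) / (s ^ 3 * r ^ 3) := by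
    unfold F
    field_simp
    ring
  have h1 : 0 < r * s * (s + r) - 2 * m * (s ^ 2 + s * r + r ^ 2) := by
    nlinarith [mul_pos hr0 hs0, mul_pos (sub_pos.2 hrs) hs0, mul_pos (sub_pos.2 hrs) hr0,
      mul_nonneg (sub_nonneg.2 hr) (sq_nonneg s), mul_nonneg (sub_nonneg.2 hr) (sq_nonneg r),
      mul_nonneg (sub_nonneg.2 hr) (mul_pos hr0 hs0).le, sq_nonneg (s - r),
      mul_pos (mul_pos (sub_pos.2 hrs) hs0) hr0, mul_pos (mul_pos (sub_pos.2 hrs) hs0) hs0,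
      mul_pos (mul_pos (sub_pos.2 hrs) hr0) hr0]
  have : 0 < F Λ m s / s ^ 2 - F Λ m r / r ^ 2 := by
    rw [key]
    have := sub_pos.2 hrs
    positivity
  linarith

/-- The subextremality condition is the same as `9 m² Λ < 1`, and `F` at the photon sphere equals
`(9 m² Λ - 1) / 3`. -/
lemma F_three_mul_neg {Λ m : ℝ} (hΛ : 0 < Λ) (hm : 0 < m) (hsub : 3 * m * Real.sqrt Λ < 1) :
    F Λ m (3 * m) < 0 := by
  have h : (3 * m * Real.sqrt Λ) ^ 2 < 1 := by
    have : 0 ≤ 3 * m * Real.sqrt Λ := by positivity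
    nlinarith
  rw [mul_pow, Real.sq_sqrt hΛ.le] at h
  have : F Λ m (3 * m) = ((3 * m) ^ 2 * Λ - 1) / 3 := by
    unfold F
    field_simp
    ring
  rw [this]
  linarith

lemma exists_root {Λ m : ℝ} (hΛ : 0 < Λ) (hm : 0 < m) (hsub : 3 * m * Real.sqrt Λ < 1) :
    ∃ r, 3 * m < r ∧ F Λ m r = 0 := by
  -- Beyond `√(3 / Λ)` the term `Λ r² / 3` alone outweighs `-1`, so `F` is positive at this radius.
  set R := 3 * m + Real.sqrt (3 / Λ) with hR
  have hs : 0 < Real.sqrt (3 / Λ) := Real.sqrt_pos.2 (by positivity)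
  have hR0 : 0 < R := by positivity
  have hFR : 0 < F Λ m R := by
    have h1 : 3 / Λ ≤ R ^ 2 := by
      have := Real.sq_sqrt (show 0 ≤ 3 / Λ by positivity)
      nlinarith
    have h2 : 1 ≤ Λ * R ^ 2 / 3 := by
      rw [div_le_iff₀ hΛ] at h1
      linarith
    have h3 : 0 < 2 * m / R := by positivity
    unfold F
    linarith
  have hcont : ContinuousOn (F Λ m) (Icc (3 * m) R) := fun x hx =>
    (continuousAt_F Λ m (by have := hx.1; intro h; linarith)).continuousWithinAt
  obtain ⟨r, hr, hr0⟩ := intermediate_value_Icc (by linarith) hcont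
    (show (0 : ℝ) ∈ Icc _ _ from ⟨(F_three_mul_neg hΛ hm hsub).le, hFR.le⟩)
  refine ⟨r, lt_of_le_of_ne hr.1 ?_, hr0⟩
  rintro rfl
  exact (F_three_mul_neg hΛ hm hsub).ne hr0

lemma F_pos_of_root {Λ m r s : ℝ} (hm : 0 < m) (hr : 3 * m < r) (h0 : F Λ m r = 0) (hrs : r < s) :
    0 < F Λ m s := by
  have h := F_div_sq_lt (Λ := Λ) hm hr.le hrs
  rw [h0, zero_div] at h
  have hs : 0 < s := by linarith
  exact (div_pos_iff_of_pos_right (by positivity)).1 h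

/-- A root beyond `3 m` exists by the intermediate value theorem, and monotonicity of `F / r²`
excludes any larger one, so the supremum is attained there. -/
lemma rc_spec {Λ m : ℝ} (hΛ : 0 < Λ) (hm : 0 < m) (hsub : 3 * m * Real.sqrt Λ < 1) :
    3 * m < rc Λ m ∧ F Λ m (rc Λ m) = 0 := by
  obtain ⟨r, hr, h0⟩ := exists_root hΛ hm hsub
  have : IsGreatest {r : ℝ | 0 < r ∧ F Λ m r = 0} r := by
    refine ⟨⟨by linarith, h0⟩, fun s hs => ?_⟩
    by_contra! hlt
    exact (F_pos_of_root hm hr h0 hlt).ne' hs.2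
  rw [rc, this.csSup_eq]
  exact ⟨hr, h0⟩

/-- The properties of the horizon radius that the energy estimates use. -/
structure IsHorizonRadius (Λ m ρ : ℝ) : Prop where
  mass_pos : 0 < m
  lambda_pos : 0 < Λ
  photon_lt : 3 * m < ρ
  root : F Λ m ρ = 0

namespace IsHorizonRadius

variable {Λ m ρ : ℝ}

lemma pos (h : IsHorizonRadius Λ m ρ) : 0 < ρ := by linarith [h.mass_pos, h.photon_lt]

lemma F_pos (h : IsHorizonRadius Λ m ρ) {r : ℝ} (hr : ρ < r) : 0 < F Λ m r :=
  F_pos_of_root h.mass_pos h.photon_lt h.root hr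

lemma F_nonneg (h : IsHorizonRadius Λ m ρ) {r : ℝ} (hr : ρ ≤ r) : 0 ≤ F Λ m r := by
  rcases hr.eq_or_lt with rfl | hr
  · exact h.root.ge
  · exact (h.F_pos hr).le

lemma F_le (h : IsHorizonRadius Λ m ρ) {r : ℝ} (hr : ρ ≤ r) : F Λ m r ≤ Λ / 3 * r ^ 2 := by
  have hr0 : 0 < r := h.pos.trans_le hr
  have : 2 * m / r ≤ 1 := by
    rw [div_le_one hr0]
    linarith [h.mass_pos, h.photon_lt]
  unfold F
  linarith

/-- Monotonicity of `F / r²` in the form of quadratic growth. It makes `1 / F` integrable at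
infinity, which is why the lag in the far estimate is finite. -/
lemma le_F (h : IsHorizonRadius Λ m ρ) {r s : ℝ} (hr : ρ ≤ r) (hrs : r ≤ s) :
    F Λ m r / r ^ 2 * s ^ 2 ≤ F Λ m s := by
  rcases hrs.eq_or_lt with rfl | hrs
  · have := h.pos.trans_le hr
    field_simp
    exact le_rfl
  · have hs : 0 < s := (h.pos.trans_le hr).trans hrs
    have := F_div_sq_lt (Λ := Λ) h.mass_pos (h.photon_lt.le.trans hr) hrs
    rw [lt_div_iff₀ (by positivity)] at this
    exact this.le

/-- `r² dF/dr - 2 r F = 2 r - 6 m`. -/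
lemma sq_mul_deriv {r : ℝ} (hr : r ≠ 0) :
    r ^ 2 * (2 * Λ * r / 3 - 2 * m / r ^ 2) = 2 * r * F Λ m r + 2 * r - 6 * m := by
  unfold F
  field_simp
  ring

/-- In `r² F' = 2 r F + 2 (r - 3 m)` the first term is nonnegative and the second positive. At the
horizon this is positivity of the surface gravity, the source of the redshift. -/
lemma deriv_pos (h : IsHorizonRadius Λ m ρ) {r : ℝ} (hr : ρ ≤ r) :
    0 < 2 * Λ * r / 3 - 2 * m / r ^ 2 := by
  have hr0 : 0 < r := h.pos.trans_le hr
  have h1 := sq_mul_deriv (Λ := Λ) (m := m) hr0.ne'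
  have h2 := mul_nonneg hr0.le (h.F_nonneg hr)
  have h3 := h.photon_lt
  have : 0 < r ^ 2 * (2 * Λ * r / 3 - 2 * m / r ^ 2) := by rw [h1]; linarith
  exact (pos_iff_pos_of_mul_pos this).1 (by positivity)

end IsHorizonRadius

lemma isHorizonRadius_rc {Λ m : ℝ} (hΛ : 0 < Λ) (hm : 0 < m) (hsub : 3 * m * Real.sqrt Λ < 1) :
    IsHorizonRadius Λ m (rc Λ m) :=
  ⟨hm, hΛ, (rc_spec hΛ hm hsub).1, (rc_spec hΛ hm hsub).2⟩

/-! ### The divergence theorem on spherical shells -/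

/-- The divergence of a vector field on a normed space. -/
noncomputable def divergence {E : Type*} [NormedAddCommGroup E] [NormedSpace ℝ E] (V : E → E)
    (y : E) : ℝ :=
  LinearMap.trace ℝ E (fderiv ℝ V y : E →L[ℝ] E).toLinearMap

section Divergence

variable {E : Type*} [NormedAddCommGroup E] [NormedSpace ℝ E]

lemma divergence_smul [FiniteDimensional ℝ E] {c : E → ℝ} {V : E → E} {y : E}
    (hc : DifferentiableAt ℝ c y) (hV : DifferentiableAt ℝ V y) :
    divergence (fun z => c z • V z) y = c y * divergence V y + fderiv ℝ c y (V y) := by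
  have h := (hc.hasFDerivAt.smul hV.hasFDerivAt).fderiv
  have h' : fderiv ℝ (fun z => c z • V z) y = c y • fderiv ℝ V y + (fderiv ℝ c y).smulRight (V y) := h
  rw [divergence, h', ContinuousLinearMap.toLinearMap_add, map_add,
    ContinuousLinearMap.toLinearMap_smul, map_smul, smul_eq_mul]
  congr 1
  exact LinearMap.trace_smulRight (fderiv ℝ c y).toLinearMap (V y)

lemma divergence_sub {V W : E → E} {y : E} (hV : DifferentiableAt ℝ V y)
    (hW : DifferentiableAt ℝ W y) :
    divergence (fun z => V z - W z) y = divergence V y - divergence W y := by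
  rw [divergence, fderiv_fun_sub hV hW, ContinuousLinearMap.toLinearMap_sub, map_sub]
  rfl

lemma divergence_congr {V W : E → E} {y : E} (h : V =ᶠ[𝓝 y] W) :
    divergence V y = divergence W y := by
  rw [divergence, divergence, h.fderiv_eq]

/-- The trace as a continuous functional. -/
noncomputable def traceCLM (E : Type*) [NormedAddCommGroup E] [NormedSpace ℝ E]
    [FiniteDimensional ℝ E] : (E →L[ℝ] E) →L[ℝ] ℝ :=
  LinearMap.toContinuousLinearMap
    ((LinearMap.trace ℝ E).comp (ContinuousLinearMap.coeLM ℝ : (E →L[ℝ] E) →ₗ[ℝ] E →ₗ[ℝ] E))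

lemma divergence_eq [FiniteDimensional ℝ E] (V : E → E) (y : E) :
    divergence V y = traceCLM E (fderiv ℝ V y) := rfl

lemma continuousAt_divergence [FiniteDimensional ℝ E] {V : E → E} {y : E}
    (hV : ContDiffAt ℝ 1 V y) : ContinuousAt (divergence V) y :=
  (traceCLM E).continuous.continuousAt.comp (hV.continuousAt_fderiv one_ne_zero)

end Divergence

instance : IsFiniteMeasure sphereMeasure := by unfold sphereMeasure; infer_instance

/-- In an orthonormal basis the divergence is a sum of partial derivatives of compactly supported
functions; each integrates to zero, by integration by parts against the constant `1`. -/
lemma integral_divergence_eq_zero {V : E3 → E3} (hV : ContDiff ℝ 1 V) (hc : HasCompactSupport V) :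
    ∫ y, divergence V y = 0 := by
  let b := EuclideanSpace.basisFun (Fin 3) ℝ
  have hsum : ∀ y, divergence V y = ∑ i, fderiv ℝ (fun z => ⟪b i, V z⟫) y (b i) := by
    intro y
    rw [divergence, LinearMap.trace_eq_sum_inner _ b]
    refine Finset.sum_congr rfl fun i _ => ?_
    have hd := (hV.differentiable one_ne_zero) y
    have := ((innerSL ℝ (b i)).hasFDerivAt.comp y hd.hasFDerivAt).fderiv
    have h2 : fderiv ℝ (fun z => ⟪b i, V z⟫) y = (innerSL ℝ (b i)).comp (fderiv ℝ V y) := this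
    rw [h2]
    rfl
  have hci : ∀ i, ContDiff ℝ 1 (fun z => ⟪b i, V z⟫) := fun i => contDiff_const.inner ℝ hV
  have hsi : ∀ i, HasCompactSupport (fun z => ⟪b i, V z⟫) := fun i =>
    hc.comp_left (g := fun w => ⟪b i, w⟫) (inner_zero_right _)
  have hInt : ∀ i, Integrable (fun y => fderiv ℝ (fun z => ⟪b i, V z⟫) y (b i)) := fun i =>
    (((hci i).continuous_fderiv one_ne_zero).clm_apply continuous_const).integrable_of_hasCompactSupport
      ((hsi i).fderiv_apply (𝕜 := ℝ) (b i))
  simp_rw [hsum]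
  rw [integral_finsetSum _ fun i _ => hInt i]
  refine Finset.sum_eq_zero fun i _ => ?_
  have := integral_mul_fderiv_eq_neg_fderiv_mul_of_integrable (μ := (volume : Measure E3))
    (f := fun _ => (1 : ℝ)) (g := fun z => ⟪b i, V z⟫) (v := b i) (by simp)
    (by simpa using hInt i)
    (by simpa using (hci i).continuous.integrable_of_hasCompactSupport (hsi i))
    (fun x _ => by simp) (fun x _ => ((hci i).differentiable one_ne_zero) x)
  simpa using this

/-- Integration in polar coordinates. -/
lemma integral_polar {g : E3 → ℝ} (hg : Integrable g) :
    ∫ y, g y = ∫ r in Ioi (0 : ℝ), r ^ 2 * ∫ x : S2, g (r • (x : E3)) ∂sphereMeasure := by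
  have hdim : Module.finrank ℝ E3 - 1 = 2 := by simp
  have hmp := (volume : Measure E3).measurePreserving_homeomorphUnitSphereProd
  rw [hdim] at hmp
  have hcoe : ∀ y : ({0}ᶜ : Set E3), ((homeomorphUnitSphereProd E3 y).2 : ℝ) •
      ((homeomorphUnitSphereProd E3 y).1 : E3) = y := fun y => by
    rw [← homeomorphUnitSphereProd_symm_apply_coe, Homeomorph.symm_apply_apply]
  set h : S2 × Ioi (0 : ℝ) → ℝ := fun z => g ((z.2 : ℝ) • (z.1 : E3)) with hh
  have hcomp : h ∘ homeomorphUnitSphereProd E3 = fun y : ({0}ᶜ : Set E3) => g y := by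
    funext y
    simp only [hh, Function.comp]
    rw [hcoe]
  have hInt : Integrable h (sphereMeasure.prod (Measure.volumeIoiPow 2)) := by
    refine (hmp.integrable_comp_emb (Homeomorph.measurableEmbedding _)).1 ?_
    rw [hcomp]
    exact (integrableOn_iff_comap_subtypeVal (measurableSet_singleton _).compl).1 hg.integrableOn
  calc ∫ y, g y = ∫ y : ({0}ᶜ : Set E3), g y ∂(Measure.comap Subtype.val volume) := by
        rw [integral_subtype_comap (measurableSet_singleton _).compl fun y => g y,
          restrict_compl_singleton]
    _ = ∫ z, h z ∂(sphereMeasure.prod (Measure.volumeIoiPow 2)) := by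
        rw [← hcomp]
        exact hmp.integral_comp (Homeomorph.measurableEmbedding _) h
    _ = ∫ r : Ioi (0 : ℝ), ∫ x : S2, g ((r : ℝ) • (x : E3)) ∂sphereMeasure
          ∂(Measure.volumeIoiPow 2) := integral_prod_symm _ hInt
    _ = _ := by
        simp only [Measure.volumeIoiPow, ENNReal.ofReal]
        rw [integral_withDensity_eq_integral_smul,
          integral_subtype_comap measurableSet_Ioi fun a : ℝ => Real.toNNReal (a ^ 2) •
            ∫ x : S2, g (a • (x : E3)) ∂sphereMeasure,
          setIntegral_congr_fun measurableSet_Ioi fun x hx => ?_]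
        · simp only [NNReal.smul_def, Real.coe_toNNReal _ (sq_nonneg x), smul_eq_mul]
        · exact (measurable_subtype_coe.pow_const _).real_toNNReal

lemma S2.norm_coe (x : S2) : ‖(x : E3)‖ = 1 := by simp

lemma norm_smul_sphere {r : ℝ} (hr : 0 ≤ r) (x : S2) : ‖r • (x : E3)‖ = r := by
  rw [norm_smul, S2.norm_coe, mul_one, Real.norm_of_nonneg hr]

lemma rad_smul_sphere {r : ℝ} (hr : 0 < r) (x : S2) : rad (r • (x : E3)) = x := by
  rw [rad, norm_smul_sphere hr.le, smul_smul, inv_mul_cancel₀ hr.ne', one_smul]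

/-- Integrals over the sphere depend continuously on parameters. -/
lemma continuousOn_integral_sphere {X : Type*} [TopologicalSpace X] [FirstCountableTopology X]
    {s : Set X} [LocallyCompactSpace s] {g : X → S2 → ℝ}
    (hg : ContinuousOn (Function.uncurry g) (s ×ˢ univ)) :
    ContinuousOn (fun p => ∫ x, g p x ∂sphereMeasure) s := by
  rw [continuousOn_iff_continuous_domRestrict]
  have hc : Continuous (Function.uncurry fun (p : s) (x : S2) => g p x) :=
    hg.comp_continuous (f := fun z : s × S2 => ((z.1 : X), z.2)) (by fun_prop)
      (fun z => ⟨z.1.2, mem_univ _⟩)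
  have := continuous_parametric_integral_of_continuous (μ := sphereMeasure) hc
    (isCompact_univ : IsCompact (univ : Set S2))
  simp only [Measure.restrict_univ] at this
  exact this

/-- The derivative of the flux of a vector field through the sphere of radius `r`. -/
lemma hasDerivAt_sphere_inner {V : E3 → E3} {r₁ r₂ : ℝ} (h₁ : 0 ≤ r₁)
    (hV : ∀ y : E3, r₁ < ‖y‖ → ‖y‖ < r₂ → ContDiffAt ℝ 1 V y) {r : ℝ} (hr : r ∈ Ioo r₁ r₂) :
    HasDerivAt (fun r => ∫ x : S2, ⟪V (r • (x : E3)), x⟫ ∂sphereMeasure)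
      (∫ x : S2, ⟪fderiv ℝ V (r • (x : E3)) x, x⟫ ∂sphereMeasure) r := by
  -- A compact shell strictly inside the open one gives a uniform bound for the derivative, hence a
  -- constant dominating function.
  obtain ⟨a, ha₁, har⟩ := exists_between hr.1
  obtain ⟨b, hrb, hb₂⟩ := exists_between hr.2
  have hmem : ∀ s ∈ Icc a b, ∀ x : S2, ContDiffAt ℝ 1 V (s • (x : E3)) := fun s hs x => by
    have h0 : 0 ≤ s := h₁.trans (ha₁.le.trans hs.1)
    refine hV _ ?_ ?_ <;> rw [norm_smul_sphere h0]
    · exact ha₁.trans_le hs.1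
    · exact hs.2.trans_lt hb₂
  have hcd : ContinuousOn (fun z : ℝ × S2 => ⟪fderiv ℝ V (z.1 • (z.2 : E3)) z.2, (z.2 : E3)⟫)
      (Icc a b ×ˢ univ) := by
    intro z hz
    have h1 : ContinuousAt (fun z : ℝ × S2 => z.1 • (z.2 : E3)) z := by fun_prop
    have h2 : ContinuousAt (fun z : ℝ × S2 => fderiv ℝ V (z.1 • (z.2 : E3))) z :=
      ContinuousAt.comp' ((hmem z.1 hz.1 z.2).continuousAt_fderiv one_ne_zero) h1
    have h3 : ContinuousAt (fun z : ℝ × S2 => (z.2 : E3)) z := by fun_prop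
    exact ((h2.clm_apply h3).inner h3).continuousWithinAt
  have hc : ∀ s ∈ Icc a b, Continuous (fun x : S2 => ⟪V (s • (x : E3)), (x : E3)⟫) := fun s hs => by
    refine Continuous.inner ?_ continuous_subtype_val
    rw [continuous_iff_continuousAt]
    intro x
    exact ContinuousAt.comp' (f := fun x : S2 => s • (x : E3)) (hmem s hs x).continuousAt
      (by fun_prop)
  obtain ⟨C, hC⟩ := (isCompact_Icc.prod isCompact_univ).exists_bound_of_continuousOn hcd
  have hInt : ∀ g : S2 → ℝ, Continuous g → Integrable g sphereMeasure := fun g hg =>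
    hg.integrable_of_hasCompactSupport (HasCompactSupport.of_compactSpace g)
  refine (hasDerivAt_integral_of_dominated_loc_of_deriv_le (bound := fun _ => C)
    (F' := fun s (x : S2) => ⟪fderiv ℝ V (s • (x : E3)) x, (x : E3)⟫)
    (Icc_mem_nhds har hrb) ?_ (hInt _ (hc r ⟨har.le, hrb.le⟩)) ?_ ?_ (integrable_const _) ?_).2
  · filter_upwards [Icc_mem_nhds har hrb] with s hs using (hc s hs).aestronglyMeasurable
  · refine (Continuous.aestronglyMeasurable ?_)
    exact hcd.comp_continuous (f := fun x : S2 => (r, x)) (by fun_prop)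
      fun x => ⟨⟨har.le, hrb.le⟩, mem_univ _⟩
  · exact ae_of_all _ fun x s hs => hC (s, x) ⟨hs, mem_univ _⟩
  · refine ae_of_all _ fun x s hs => ?_
    have h1 : HasDerivAt (fun s : ℝ => s • (x : E3)) (x : E3) s := by
      simpa using (hasDerivAt_id s).smul_const (x : E3)
    have h2 := (((hmem s hs x).differentiableAt one_ne_zero).hasFDerivAt.comp_hasDerivAt s h1)
    simpa using h2.inner ℝ (hasDerivAt_const s (x : E3))

/-- Obtained by differentiating `‖y‖ ^ 2` in two ways and dividing by `2 ‖y‖`. -/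
lemma hasFDerivAt_norm_E3 {y : E3} (hy : y ≠ 0) :
    HasFDerivAt (fun y : E3 => ‖y‖) (innerSL ℝ (rad y)) y := by
  have hn : ‖y‖ ≠ 0 := norm_ne_zero_iff.2 hy
  have h1 := ((contDiffAt_norm ℝ (n := 1) hy).differentiableAt one_ne_zero).hasFDerivAt
  have h2 : HasFDerivAt (fun y : E3 => ‖y‖ ^ 2) ((2 : ℕ) • innerSL ℝ y) y :=
    (hasStrictFDerivAt_norm_sq y).hasFDerivAt
  have h3 := h2.unique (h1.pow 2)
  refine h1.congr_fderiv ?_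
  ext w
  have h4 := congrArg (fun A : E3 →L[ℝ] ℝ => A w) h3
  simp at h4
  simp only [innerSL_apply_apply, rad, real_inner_smul_left]
  field_simp
  linarith

/-- The divergence theorem for thin shells: the flux `r² ∫ ⟨V, ω⟩` through the sphere of radius `r` has
derivative `r² ∫ div V`. -/
lemma hasDerivAt_sphere_flux {V : E3 → E3} {r₁ r₂ : ℝ} (h₁ : 0 ≤ r₁)
    (hV : ∀ y : E3, r₁ < ‖y‖ → ‖y‖ < r₂ → ContDiffAt ℝ 1 V y) {r : ℝ} (hr : r ∈ Ioo r₁ r₂) :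
    HasDerivAt (fun r => r ^ 2 * ∫ x : S2, ⟪V (r • (x : E3)), x⟫ ∂sphereMeasure)
      (r ^ 2 * ∫ x : S2, divergence V (r • (x : E3)) ∂sphereMeasure) r := by
  set A : ℝ → ℝ := fun r => ∫ x : S2, ⟪V (r • (x : E3)), x⟫ ∂sphereMeasure with hA
  set A' : ℝ → ℝ := fun r => ∫ x : S2, ⟪fderiv ℝ V (r • (x : E3)) x, x⟫ ∂sphereMeasure with hA'
  set D : ℝ → ℝ := fun r => ∫ x : S2, divergence V (r • (x : E3)) ∂sphereMeasure with hD
  have hder : ∀ r ∈ Ioo r₁ r₂, HasDerivAt (fun r => r ^ 2 * A r) (2 * r * A r + r ^ 2 * A' r) r := by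
    intro r hr
    exact ((hasDerivAt_pow 2 r).mul (hasDerivAt_sphere_inner h₁ hV hr)).congr_deriv (by simp [hA, hA'])
  -- The Leibniz rule gives the derivative `2 r A + r² A'`. Its equality with `r² D` is proved
  -- weakly, by testing against radial bump functions, and continuity makes it pointwise.
  suffices h : ∀ r ∈ Ioo r₁ r₂, r ^ 2 * D r - (2 * r * A r + r ^ 2 * A' r) = 0 by
    exact (hder r hr).congr_deriv (by linarith [h r hr])
  have hmem : ∀ s ∈ Ioo r₁ r₂, ∀ x : S2, ContDiffAt ℝ 1 V (s • (x : E3)) := fun s hs x => by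
    have h0 : 0 ≤ s := h₁.trans hs.1.le
    refine hV _ ?_ ?_ <;> rw [norm_smul_sphere h0]
    · exact hs.1
    · exact hs.2
  have hsm : ∀ z : ℝ × S2, ContinuousAt (fun z : ℝ × S2 => z.1 • (z.2 : E3)) z := fun z => by
    fun_prop
  have : LocallyCompactSpace (Ioo r₁ r₂) := isOpen_Ioo.locallyCompactSpace
  have hDc : ContinuousOn D (Ioo r₁ r₂) := by
    refine continuousOn_integral_sphere fun z hz => ?_
    exact (ContinuousAt.comp' (f := fun z : ℝ × S2 => z.1 • (z.2 : E3))
      (continuousAt_divergence (hmem z.1 hz.1 z.2)) (hsm z)).continuousWithinAt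
  have hA'c : ContinuousOn A' (Ioo r₁ r₂) := by
    refine continuousOn_integral_sphere fun z hz => ?_
    have h2 : ContinuousAt (fun z : ℝ × S2 => fderiv ℝ V (z.1 • (z.2 : E3))) z :=
      ContinuousAt.comp' ((hmem z.1 hz.1 z.2).continuousAt_fderiv one_ne_zero) (hsm z)
    have h3 : ContinuousAt (fun z : ℝ × S2 => (z.2 : E3)) z := by fun_prop
    exact ((h2.clm_apply h3).inner h3).continuousWithinAt
  have hAc : ContinuousOn A (Ioo r₁ r₂) := fun r hr =>
    (hasDerivAt_sphere_inner h₁ hV hr).continuousAt.continuousWithinAt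
  have hcont : ContinuousOn (fun r => r ^ 2 * D r - (2 * r * A r + r ^ 2 * A' r)) (Ioo r₁ r₂) := by
    fun_prop
  have hae := isOpen_Ioo.ae_eq_zero_of_integral_contDiff_smul_eq_zero (μ := (volume : Measure ℝ))
    (hcont.locallyIntegrableOn measurableSet_Ioo) (fun χ hχ hχc hχs => ?_)
  · have h0 := Measure.eqOn_of_ae_eq (μ := (volume : Measure ℝ)) (s := Ioo r₁ r₂) (g := fun _ => 0)
      ((ae_restrict_iff' measurableSet_Ioo).2 hae) hcont continuousOn_const
      (by rw [isOpen_Ioo.interior_eq]; exact subset_closure)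
    exact fun r hr => h0 hr
  have hV1 : ∀ y : E3, ‖y‖ ∈ tsupport χ → ContDiffAt ℝ 1 V y := fun y hy =>
    hV y (hχs hy).1 (hχs hy).2
  have hne : ∀ y : E3, ‖y‖ ∈ tsupport χ → y ≠ 0 := fun y hy h => by
    have := (hχs hy).1
    rw [h, norm_zero] at this
    linarith
  have hχ1 : ContDiff ℝ 1 χ := hχ.of_le (by exact_mod_cast le_top)
  have hχd : ∀ s, HasDerivAt χ (deriv χ s) s := fun s =>
    ((hχ1.differentiable one_ne_zero) s).hasDerivAt
  have hzero : ∀ y : E3, ‖y‖ ∉ tsupport χ →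
      (fun y : E3 => χ ‖y‖ • V y) =ᶠ[𝓝 y] fun _ => 0 := fun y hy => by
    have h1 := (continuous_norm (E := E3)).continuousAt.eventually
      ((isClosed_tsupport χ).isOpen_compl.mem_nhds (show ‖y‖ ∈ (tsupport χ)ᶜ from hy))
    filter_upwards [h1] with z hz
    rw [image_eq_zero_of_notMem_tsupport hz, zero_smul]
  -- The cutoff lives in the open shell, so `χ ‖y‖ • V y` extends by zero to a compactly supported
  -- field on the whole space, including the origin where the norm is not differentiable.
  have hW : ContDiff ℝ 1 (fun y : E3 => χ ‖y‖ • V y) := by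
    rw [contDiff_iff_contDiffAt]
    intro y
    by_cases hy : ‖y‖ ∈ tsupport χ
    · exact (hχ1.contDiffAt.comp y (contDiffAt_norm ℝ (hne y hy))).smul (hV1 y hy)
    · exact contDiffAt_const.congr_of_eventuallyEq (hzero y hy)
  have hWc : HasCompactSupport (fun y : E3 => χ ‖y‖ • V y) := by
    obtain ⟨R, hR⟩ := hχc.isCompact.isBounded.subset_closedBall 0
    refine HasCompactSupport.intro (isCompact_closedBall (0 : E3) R) fun y hy => ?_
    have : ‖y‖ ∉ tsupport χ := fun h => hy (by simpa using hR h)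
    rw [image_eq_zero_of_notMem_tsupport this, zero_smul]
  have hdiv : ∀ y : E3, divergence (fun y : E3 => χ ‖y‖ • V y) y
      = χ ‖y‖ * divergence V y + deriv χ ‖y‖ * ⟪V y, rad y⟫ := by
    intro y
    by_cases hy : ‖y‖ ∈ tsupport χ
    · have h1 := (hχd ‖y‖).comp_hasFDerivAt y (hasFDerivAt_norm_E3 (hne y hy))
      rw [divergence_smul (c := fun y : E3 => χ ‖y‖) h1.differentiableAt
        ((hV1 y hy).differentiableAt one_ne_zero)]
      have h2 : fderiv ℝ (fun y : E3 => χ ‖y‖) y = _ := h1.fderiv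
      rw [h2]
      simp [real_inner_comm]
    · have h3 : deriv χ ‖y‖ = 0 :=
        image_eq_zero_of_notMem_tsupport fun h => hy (tsupport_deriv_subset h)
      rw [divergence_congr (hzero y hy), image_eq_zero_of_notMem_tsupport hy, h3, divergence]
      simp
  have hpol := integral_polar (g := divergence (fun y : E3 => χ ‖y‖ • V y))
    ((continuous_iff_continuousAt.2 fun y => continuousAt_divergence
      hW.contDiffAt).integrable_of_hasCompactSupport
      (HasCompactSupport.intro hWc.isCompact fun y hy => by
        have : fderiv ℝ (fun y : E3 => χ ‖y‖ • V y) y = 0 :=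
          image_eq_zero_of_notMem_tsupport fun h => hy (tsupport_fderiv_subset ℝ h)
        simp [divergence, this]))
  -- The divergence of the cut-off field has integral zero; in polar coordinates this reads `∫ χ r²
  -- D + ∫ χ' r² A = 0`.
  rw [integral_divergence_eq_zero hW hWc] at hpol
  have hinner : ∀ r : ℝ, r ^ 2 * (∫ x : S2, divergence (fun y : E3 => χ ‖y‖ • V y) (r • (x : E3))
      ∂sphereMeasure) = χ r * (r ^ 2 * D r) + deriv χ r * (r ^ 2 * A r) ∨ r ≤ 0 := by
    intro r
    rcases le_or_gt r 0 with h0 | h0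
    · exact Or.inr h0
    left
    simp only [hdiv, norm_smul_sphere h0.le, rad_smul_sphere h0]
    by_cases hrs : r ∈ tsupport χ
    · have hi : ∀ g : S2 → ℝ, Continuous g → Integrable g sphereMeasure := fun g hg =>
        hg.integrable_of_hasCompactSupport (HasCompactSupport.of_compactSpace g)
      have hx : ∀ x : S2, ContinuousAt (fun x : S2 => r • (x : E3)) x := fun x => by fun_prop
      rw [integral_add ((hi _ ?_).const_mul _) ((hi _ ?_).const_mul _), integral_const_mul,
        integral_const_mul]
      · simp only [hA, hD]
        ring
      · exact continuous_iff_continuousAt.2 fun x => ContinuousAt.comp'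
          (f := fun x : S2 => r • (x : E3)) (continuousAt_divergence (hmem r (hχs hrs) x)) (hx x)
      · refine Continuous.inner ?_ continuous_subtype_val
        exact continuous_iff_continuousAt.2 fun x => ContinuousAt.comp'
          (f := fun x : S2 => r • (x : E3)) (hmem r (hχs hrs) x).continuousAt (hx x)
    · have h3 : deriv χ r = 0 :=
        image_eq_zero_of_notMem_tsupport fun h => hrs (tsupport_deriv_subset h)
      simp [h3, image_eq_zero_of_notMem_tsupport hrs]
  have hsuppI : ∀ g : ℝ → ℝ, ContinuousOn g (Ioo r₁ r₂) → ∀ η : ℝ → ℝ, Continuous η →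
      tsupport η ⊆ tsupport χ → Integrable (fun r => η r * g r) := by
    intro g hg η hη hs
    have hηc : IsCompact (tsupport η) := hχc.isCompact.of_isClosed_subset (isClosed_tsupport η) hs
    refine Continuous.integrable_of_hasCompactSupport ?_
      (HasCompactSupport.intro hηc fun r hr => by
        rw [image_eq_zero_of_notMem_tsupport hr, zero_mul])
    rw [continuous_iff_continuousAt]
    intro r
    by_cases hr : r ∈ tsupport η
    · exact hη.continuousAt.mul (hg.continuousAt (isOpen_Ioo.mem_nhds (hχs (hs hr))))
    · refine ContinuousAt.congr (f := fun _ => (0 : ℝ)) continuousAt_const ?_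
      filter_upwards [(isClosed_tsupport η).isOpen_compl.mem_nhds hr] with s hs
      rw [image_eq_zero_of_notMem_tsupport hs, zero_mul]
  have hdc : Continuous (deriv χ) := hχ1.continuous_deriv le_rfl
  have i1 := hsuppI (fun r => r ^ 2 * D r) (by fun_prop) χ hχ1.continuous le_rfl
  have i2 := hsuppI (fun r => r ^ 2 * A r) (by fun_prop) (deriv χ) hdc tsupport_deriv_subset
  have i3 := hsuppI (fun r => 2 * r * A r + r ^ 2 * A' r) (by fun_prop) χ hχ1.continuous le_rfl
  have i4 := hsuppI (fun r => r ^ 2 * A r) (by fun_prop) χ hχ1.continuous le_rfl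
  have hIoi : ∀ g : ℝ → ℝ, (∀ r ≤ 0, g r = 0) → ∫ r in Ioi 0, g r = ∫ r, g r := fun g hg =>
    setIntegral_eq_integral_of_forall_compl_eq_zero fun r hr => hg r (not_lt.1 hr)
  have hneg : ∀ r ≤ (0 : ℝ), χ r = 0 ∧ deriv χ r = 0 := fun r hr => by
    have : r ∉ tsupport χ := fun h => by linarith [(hχs h).1]
    exact ⟨image_eq_zero_of_notMem_tsupport this,
      image_eq_zero_of_notMem_tsupport fun h => this (tsupport_deriv_subset h)⟩
  rw [setIntegral_congr_fun measurableSet_Ioi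
    (fun r hr => (hinner r).resolve_right (not_le.2 hr)),
    hIoi _ (fun r hr => by simp [(hneg r hr).1, (hneg r hr).2]), integral_add i1 i2] at hpol
  -- One integration by parts in `r` moves the derivative from `χ` to `r² A`.
  have hparts := integral_mul_deriv_eq_deriv_mul_of_integrable (u := χ) (u' := deriv χ)
    (v := fun r => r ^ 2 * A r) (v' := fun r => 2 * r * A r + r ^ 2 * A' r)
    (fun x _ => hχd x) (fun x hx => hder x (hχs hx)) i3 i2 i4
  simp only [smul_eq_mul, mul_sub]
  rw [integral_sub i1 i3]
  linarith

/-! ### The divergence theorem on slabs of the spacetime -/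

instance : IsFiniteMeasureOnCompacts cylMeasure := by unfold cylMeasure; infer_instance

/-- The operator is a rank one map through the `τ` direction plus a map factoring through `E3`;
cyclicity of the trace evaluates the second summand on `E3`. -/
lemma trace_prod_eq (A : Vec →L[ℝ] Vec) :
    LinearMap.trace ℝ Vec A.toLinearMap = (A (1, 0)).1 + LinearMap.trace ℝ E3
      ((ContinuousLinearMap.snd ℝ ℝ E3).comp
        (A.comp (ContinuousLinearMap.inr ℝ ℝ E3))).toLinearMap := by
  have h1 : A.toLinearMap = (LinearMap.fst ℝ ℝ E3).smulRight (A (1, 0)) +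
      (A.toLinearMap ∘ₗ LinearMap.inr ℝ ℝ E3) ∘ₗ LinearMap.snd ℝ ℝ E3 := by
    refine LinearMap.ext fun z => ?_
    have : z = z.1 • ((1 : ℝ), (0 : E3)) + (0, z.2) := by ext <;> simp
    conv_lhs => rw [this]
    simp only [map_add, map_smul]
    rfl
  rw [h1, map_add, LinearMap.trace_smulRight, LinearMap.trace_comp_comm']
  rfl

lemma divergence_prod_eq {W : Pt → Vec} {p : Pt} (hW : DifferentiableAt ℝ W p) :
    divergence W p = (fderiv ℝ W p (1, 0)).1 + divergence (fun y => (W (p.1, y)).2) p.2 := by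
  rw [divergence, trace_prod_eq]
  congr 1
  have h1 : HasFDerivAt (fun y : E3 => ((p.1, y) : Pt)) (ContinuousLinearMap.inr ℝ ℝ E3) p.2 :=
    hasFDerivAt_prodMk_right p.1 p.2
  have h2 : HasFDerivAt (fun y => W (p.1, y))
      ((fderiv ℝ W p).comp (ContinuousLinearMap.inr ℝ ℝ E3)) p.2 :=
    HasFDerivAt.comp p.2 (f := fun y : E3 => ((p.1, y) : Pt)) hW.hasFDerivAt h1
  have h3 := ((ContinuousLinearMap.snd ℝ ℝ E3).hasFDerivAt.comp p.2 h2).fderiv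
  rw [divergence]
  exact congrArg (fun A : E3 →L[ℝ] E3 => LinearMap.trace ℝ E3 A.toLinearMap) h3.symm

lemma continuous_pt : Continuous fun z : (ℝ × ℝ) × S2 => pt z.1.1 z.1.2 z.2 := by
  unfold pt
  fun_prop

lemma setIntegral_cyl {g : ℝ × S2 → ℝ} {a b : ℝ} (hab : a ≤ b)
    (hg : ContinuousOn g (Icc a b ×ˢ univ)) :
    ∫ z in Icc a b ×ˢ univ, g z ∂cylMeasure = ∫ τ in a..b, ∫ x, g (τ, x) ∂sphereMeasure := by
  rw [cylMeasure, setIntegral_prod, intervalIntegral.integral_of_le hab, integral_Icc_eq_integral_Ioc]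
  · simp
  · exact hg.integrableOn_compact (μ := cylMeasure) (isCompact_Icc.prod isCompact_univ)

/-- The divergence theorem on `[a, b] × [r₁, r₂] × 𝕊²`, for fields of nonpositive divergence. -/
theorem flux_le_of_divergence_nonpos {W : Pt → Vec} {a b r₁ r₂ : ℝ} (hab : a ≤ b) (h₁ : 0 < r₁)
    (h₁₂ : r₁ ≤ r₂)
    (hW : ∀ p : Pt, p.1 ∈ Icc a b → ‖p.2‖ ∈ Icc r₁ r₂ → ContDiffAt ℝ 1 W p)
    (hdiv : ∀ p : Pt, p.1 ∈ Icc a b → ‖p.2‖ ∈ Icc r₁ r₂ → divergence W p ≤ 0) :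
    (∫ z in Icc a b ×ˢ univ, r₂ ^ 2 * ⟪(W (pt z.1 r₂ z.2)).2, (z.2 : E3)⟫ ∂cylMeasure) +
      (∫ z in Icc r₁ r₂ ×ˢ univ, z.1 ^ 2 * (W (pt b z.1 z.2)).1 ∂cylMeasure) ≤
    (∫ z in Icc a b ×ˢ univ, r₁ ^ 2 * ⟪(W (pt z.1 r₁ z.2)).2, (z.2 : E3)⟫ ∂cylMeasure) +
      ∫ z in Icc r₁ r₂ ×ˢ univ, z.1 ^ 2 * (W (pt a z.1 z.2)).1 ∂cylMeasure := by
  set S : Set (ℝ × ℝ) := Icc a b ×ˢ Icc r₁ r₂ with hS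
  have hScomp : IsCompact S := isCompact_Icc.prod isCompact_Icc
  have : LocallyCompactSpace S := hScomp.isClosed.locallyCompactSpace
  have hp : ∀ z : (ℝ × ℝ) × S2, z.1 ∈ S → ContDiffAt ℝ 1 W (pt z.1.1 z.1.2 z.2) := fun z hz => by
    refine hW _ hz.1 ?_
    rw [pt, norm_smul_sphere (h₁.le.trans hz.2.1)]
    exact hz.2
  have hpc : ∀ z : (ℝ × ℝ) × S2, ContinuousAt (fun z : (ℝ × ℝ) × S2 => pt z.1.1 z.1.2 z.2) z :=
    fun z => continuous_pt.continuousAt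
  have cW : ∀ z : (ℝ × ℝ) × S2, z.1 ∈ S →
      ContinuousAt (fun z : (ℝ × ℝ) × S2 => W (pt z.1.1 z.1.2 z.2)) z := fun z hz =>
    ContinuousAt.comp' (hp z hz).continuousAt (hpc z)
  have cdW : ∀ z : (ℝ × ℝ) × S2, z.1 ∈ S →
      ContinuousAt (fun z : (ℝ × ℝ) × S2 => fderiv ℝ W (pt z.1.1 z.1.2 z.2)) z := fun z hz =>
    ContinuousAt.comp' ((hp z hz).continuousAt_fderiv one_ne_zero) (hpc z)
  have cdiv : ∀ z : (ℝ × ℝ) × S2, z.1 ∈ S →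
      ContinuousAt (fun z : (ℝ × ℝ) × S2 => divergence W (pt z.1.1 z.1.2 z.2)) z := fun z hz =>
    ContinuousAt.comp' (continuousAt_divergence (hp z hz)) (hpc z)
  have cx : ∀ z : (ℝ × ℝ) × S2, ContinuousAt (fun z : (ℝ × ℝ) × S2 => (z.2 : E3)) z := fun z => by
    fun_prop
  -- the four integrands
  set gA : ℝ × ℝ → S2 → ℝ := fun q x => q.2 ^ 2 * ⟪(W (pt q.1 q.2 x)).2, (x : E3)⟫ with hgA
  set gB : ℝ × ℝ → S2 → ℝ := fun q x => q.2 ^ 2 * (W (pt q.1 q.2 x)).1 with hgB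
  set gB' : ℝ × ℝ → S2 → ℝ := fun q x => q.2 ^ 2 * (fderiv ℝ W (pt q.1 q.2 x) (1, 0)).1 with hgB'
  set gD : ℝ × ℝ → S2 → ℝ := fun q x => q.2 ^ 2 * divergence W (pt q.1 q.2 x) with hgD
  have cA : ContinuousOn (Function.uncurry gA) (S ×ˢ univ) := fun z hz =>
    (ContinuousAt.mul (by fun_prop) ((cW z hz.1).snd.inner (cx z))).continuousWithinAt
  have cB : ContinuousOn (Function.uncurry gB) (S ×ˢ univ) := fun z hz =>
    (ContinuousAt.mul (by fun_prop) (cW z hz.1).fst).continuousWithinAt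
  have cB' : ContinuousOn (Function.uncurry gB') (S ×ˢ univ) := fun z hz =>
    (ContinuousAt.mul (by fun_prop)
      ((cdW z hz.1).clm_apply continuousAt_const).fst).continuousWithinAt
  have cD : ContinuousOn (Function.uncurry gD) (S ×ˢ univ) := fun z hz =>
    (ContinuousAt.mul (by fun_prop) (cdiv z hz.1)).continuousWithinAt
  set A : ℝ × ℝ → ℝ := fun q => ∫ x, gA q x ∂sphereMeasure with hA
  set B : ℝ × ℝ → ℝ := fun q => ∫ x, gB q x ∂sphereMeasure with hB
  set B' : ℝ × ℝ → ℝ := fun q => ∫ x, gB' q x ∂sphereMeasure with hB'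
  set D : ℝ × ℝ → ℝ := fun q => ∫ x, gD q x ∂sphereMeasure with hD
  have kA : ContinuousOn A S := continuousOn_integral_sphere cA
  have kB : ContinuousOn B S := continuousOn_integral_sphere cB
  have kB' : ContinuousOn B' S := continuousOn_integral_sphere cB'
  have kD : ContinuousOn D S := continuousOn_integral_sphere cD
  have sliceτ : ∀ {g : ℝ × ℝ → ℝ}, ContinuousOn g S → ∀ r ∈ Icc r₁ r₂,
      ContinuousOn (fun τ => g (τ, r)) (Icc a b) := fun hg r hr =>
    hg.comp (f := fun τ : ℝ => (τ, r)) (by fun_prop) fun τ hτ => ⟨hτ, hr⟩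
  have slicer : ∀ {g : ℝ × ℝ → ℝ}, ContinuousOn g S → ∀ τ ∈ Icc a b,
      ContinuousOn (fun r => g (τ, r)) (Icc r₁ r₂) := fun hg τ hτ =>
    hg.comp (f := fun r : ℝ => (τ, r)) (by fun_prop) fun r hr => ⟨hτ, hr⟩
  have hr₁ : r₁ ∈ Icc r₁ r₂ := ⟨le_rfl, h₁₂⟩
  have hr₂ : r₂ ∈ Icc r₁ r₂ := ⟨h₁₂, le_rfl⟩
  have ha : a ∈ Icc a b := ⟨le_rfl, hab⟩
  have hb : b ∈ Icc a b := ⟨hab, le_rfl⟩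
  -- the divergence theorem on each shell
  have radial : ∀ τ ∈ Icc a b, ∫ r in r₁..r₂, (D (τ, r) - B' (τ, r)) = A (τ, r₂) - A (τ, r₁) := by
    intro τ hτ
    refine intervalIntegral.integral_eq_sub_of_hasDerivAt_of_le h₁₂ (f := fun r => A (τ, r))
      (slicer kA τ hτ) (fun r hr => ?_)
      (((slicer kD τ hτ).sub (slicer kB' τ hτ)).intervalIntegrable_of_Icc h₁₂)
    have hrI : r ∈ Icc r₁ r₂ := ⟨hr.1.le, hr.2.le⟩
    have h := hasDerivAt_sphere_flux (V := fun y => (W (τ, y)).2) (r₁ := r₁) (r₂ := r₂) h₁.le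
      (fun y hy1 hy2 => ContDiffAt.snd (ContDiffAt.comp y (f := fun y : E3 => ((τ, y) : Pt))
        (hW (τ, y) hτ ⟨hy1.le, hy2.le⟩) (by fun_prop))) hr
    have e1 : (fun r => A (τ, r)) = fun r => r ^ 2 * ∫ x : S2, ⟪(W (τ, r • (x : E3))).2, (x : E3)⟫
        ∂sphereMeasure := by
      funext s
      simp only [hA, hgA, pt]
      rw [integral_const_mul]
    rw [e1]
    refine h.congr_deriv ?_
    have e2 : ∀ x : S2, gD (τ, r) x - gB' (τ, r) x
        = r ^ 2 * divergence (fun y => (W (τ, y)).2) (r • (x : E3)) := fun x => by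
      simp only [hgD, hgB']
      rw [divergence_prod_eq ((hp ((τ, r), x) ⟨hτ, hrI⟩).differentiableAt one_ne_zero)]
      simp only [pt]
      ring
    have hi : ∀ {g : ℝ × ℝ → S2 → ℝ}, ContinuousOn (Function.uncurry g) (S ×ˢ univ) →
        Integrable (g (τ, r)) sphereMeasure := fun {g} hg => by
      have : Continuous (g (τ, r)) := hg.comp_continuous (f := fun x : S2 => ((τ, r), x))
        (by fun_prop) fun x => ⟨⟨hτ, hrI⟩, mem_univ _⟩
      exact this.integrable_of_hasCompactSupport (HasCompactSupport.of_compactSpace _)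
    simp only [hD, hB']
    rw [← integral_sub (hi cD) (hi cB'), ← integral_const_mul]
    exact integral_congr_ae (ae_of_all _ fun x => (e2 x).symm)
  -- At fixed `r` this is the fundamental theorem of calculus in `τ`, after exchanging the `τ`
  -- integral with the one over the sphere.
  have temporal : ∀ r ∈ Icc r₁ r₂, ∫ τ in a..b, B' (τ, r) = B (b, r) - B (a, r) := by
    intro r hr
    have hc : ∀ {g : ℝ × ℝ → S2 → ℝ}, ContinuousOn (Function.uncurry g) (S ×ˢ univ) →
        ContinuousOn (fun z : ℝ × S2 => g (z.1, r) z.2) (Icc a b ×ˢ univ) := fun {g} hg =>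
      hg.comp (f := fun z : ℝ × S2 => ((z.1, r), z.2)) (by fun_prop) fun z hz =>
        ⟨⟨hz.1, hr⟩, mem_univ _⟩
    have hcx : ∀ {g : ℝ × ℝ → S2 → ℝ}, ContinuousOn (Function.uncurry g) (S ×ˢ univ) → ∀ x : S2,
        ContinuousOn (fun τ => g (τ, r) x) (Icc a b) := fun {g} hg x =>
      (hc hg).comp (f := fun τ : ℝ => (τ, x)) (by fun_prop) fun τ hτ => ⟨hτ, mem_univ _⟩
    have hsw : ∫ τ in a..b, B' (τ, r) = ∫ x, (∫ τ in a..b, gB' (τ, r) x) ∂sphereMeasure := by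
      refine intervalIntegral_integral_swap ?_
      have h1 := ((hc cB').integrableOn_compact (μ := (volume : Measure ℝ).prod sphereMeasure)
        (isCompact_Icc.prod isCompact_univ)).mono_set (prod_mono Ioc_subset_Icc_self Subset.rfl)
      rw [IntegrableOn, ← Measure.prod_restrict, Measure.restrict_univ] at h1
      rw [uIoc_of_le hab]
      exact h1
    have hin : ∀ x : S2, ∫ τ in a..b, gB' (τ, r) x = gB (b, r) x - gB (a, r) x := by
      intro x
      refine intervalIntegral.integral_eq_sub_of_hasDerivAt (f := fun τ => gB (τ, r) x)
        (fun τ hτ => ?_) ((hcx cB' x).intervalIntegrable_of_Icc hab)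
      rw [uIcc_of_le hab] at hτ
      have h1 : HasDerivAt (fun τ : ℝ => pt τ r x) ((1, 0) : Vec) τ :=
        (hasDerivAt_id τ).prodMk (hasDerivAt_const τ (r • (x : E3)))
      have h2 := (((hp ((τ, r), x) ⟨hτ, hr⟩).differentiableAt one_ne_zero).hasFDerivAt
        ).comp_hasDerivAt τ h1
      have h3 := (ContinuousLinearMap.fst ℝ ℝ E3).hasFDerivAt.comp_hasDerivAt τ h2
      exact h3.const_mul (r ^ 2)
    rw [hsw]
    simp_rw [hin]
    have hi : ∀ τ ∈ Icc a b, Integrable (gB (τ, r)) sphereMeasure := fun τ hτ => by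
      have : Continuous (gB (τ, r)) := cB.comp_continuous (f := fun x : S2 => ((τ, r), x))
        (by fun_prop) fun x => ⟨⟨hτ, hr⟩, mem_univ _⟩
      exact this.integrable_of_hasCompactSupport (HasCompactSupport.of_compactSpace _)
    exact integral_sub (hi b hb) (hi a ha)
  -- the boundary terms as iterated integrals
  have bdA : ∀ r ∈ Icc r₁ r₂, ∫ z in Icc a b ×ˢ univ,
      r ^ 2 * ⟪(W (pt z.1 r z.2)).2, (z.2 : E3)⟫ ∂cylMeasure = ∫ τ in a..b, A (τ, r) := fun r hr =>
    setIntegral_cyl (g := fun z : ℝ × S2 => r ^ 2 * ⟪(W (pt z.1 r z.2)).2, (z.2 : E3)⟫) hab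
      (cA.comp (f := fun z : ℝ × S2 => ((z.1, r), z.2)) (by fun_prop) fun z hz =>
        ⟨⟨hz.1, hr⟩, mem_univ _⟩)
  have bdB : ∀ τ ∈ Icc a b, ∫ z in Icc r₁ r₂ ×ˢ univ,
      z.1 ^ 2 * (W (pt τ z.1 z.2)).1 ∂cylMeasure = ∫ r in r₁..r₂, B (τ, r) := fun τ hτ =>
    setIntegral_cyl (g := fun z : ℝ × S2 => z.1 ^ 2 * (W (pt τ z.1 z.2)).1) h₁₂
      (cB.comp (f := fun z : ℝ × S2 => ((τ, z.1), z.2)) (by fun_prop) fun z hz =>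
        ⟨⟨hτ, hz.1⟩, mem_univ _⟩)
  rw [bdA r₂ hr₂, bdA r₁ hr₁, bdB b hb, bdB a ha]
  have iA : ∀ r ∈ Icc r₁ r₂, IntervalIntegrable (fun τ => A (τ, r)) volume a b := fun r hr =>
    (sliceτ kA r hr).intervalIntegrable_of_Icc hab
  have iB : ∀ τ ∈ Icc a b, IntervalIntegrable (fun r => B (τ, r)) volume r₁ r₂ := fun τ hτ =>
    (slicer kB τ hτ).intervalIntegrable_of_Icc h₁₂
  have swapB : ∫ τ in a..b, ∫ r in r₁..r₂, B' (τ, r) = ∫ r in r₁..r₂, ∫ τ in a..b, B' (τ, r) := by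
    refine intervalIntegral_intervalIntegral_swap (F := fun τ r => B' (τ, r)) ?_
    have h1 := kB'.integrableOn_compact (μ := (volume : Measure ℝ).prod volume) hScomp
    rw [uIoc_of_le hab, uIoc_of_le h₁₂]
    exact h1.mono_set (prod_mono Ioc_subset_Icc_self Ioc_subset_Icc_self)
  have e1 : (∫ r in r₁..r₂, ∫ τ in a..b, B' (τ, r))
      = (∫ r in r₁..r₂, B (b, r)) - ∫ r in r₁..r₂, B (a, r) := by
    rw [← intervalIntegral.integral_sub (iB b hb) (iB a ha)]
    refine intervalIntegral.integral_congr fun r hr => ?_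
    rw [uIcc_of_le h₁₂] at hr
    exact temporal r hr
  have iBB : IntervalIntegrable (fun τ => ∫ r in r₁..r₂, B' (τ, r)) volume a b := by
    have h1 := kB'.integrableOn_compact (μ := (volume : Measure ℝ).prod volume) hScomp
    have h2 := h1.mono_set (prod_mono (Subset.rfl : Icc a b ⊆ Icc a b) Ioc_subset_Icc_self)
    rw [IntegrableOn, ← Measure.prod_restrict] at h2
    have h3 := h2.integral_prod_left
    rw [intervalIntegrable_iff_integrableOn_Icc_of_le hab]
    simp only [intervalIntegral.integral_of_le h₁₂]
    exact h3
  -- The sphere integral `D` of the divergence is nonpositive. Dropping it from the radial identity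
  -- leaves only the `τ` derivative, which is then integrated in `τ`.
  have hle : (∫ τ in a..b, (A (τ, r₂) - A (τ, r₁))) ≤
      ∫ τ in a..b, -∫ r in r₁..r₂, B' (τ, r) := by
    refine intervalIntegral.integral_mono_on hab ((iA r₂ hr₂).sub (iA r₁ hr₁)) iBB.neg
      fun τ hτ => ?_
    rw [← radial τ hτ, ← intervalIntegral.integral_neg]
    refine intervalIntegral.integral_mono_on h₁₂
      (((slicer kD τ hτ).sub (slicer kB' τ hτ)).intervalIntegrable_of_Icc h₁₂)
      ((slicer kB' τ hτ).neg.intervalIntegrable_of_Icc h₁₂) fun r hr => ?_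
    have hDle : D (τ, r) ≤ 0 := integral_nonpos fun x => by
      refine mul_nonpos_of_nonneg_of_nonpos (sq_nonneg r) (hdiv _ hτ ?_)
      rw [pt, norm_smul_sphere (h₁.le.trans hr.1)]
      exact hr
    linarith
  rw [intervalIntegral.integral_sub (iA r₂ hr₂) (iA r₁ hr₁), intervalIntegral.integral_neg, swapB,
    e1] at hle
  linarith

/-! ### Divergence of the energy current -/

/-- The identification of linear functionals with covectors. -/
noncomputable def covector : (Pt →L[ℝ] ℝ) →L[ℝ] Vec :=
  (ContinuousLinearMap.apply ℝ ℝ ((1, 0) : Pt)).prod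
    ((InnerProductSpace.toDual ℝ E3).symm.toContinuousLinearEquiv.toContinuousLinearMap.comp
      ((ContinuousLinearMap.compL ℝ E3 Pt ℝ).flip (ContinuousLinearMap.inr ℝ ℝ E3)))

lemma diff_eq_covector (ψ : Pt → ℝ) (p : Pt) : diff ψ p = covector (fderiv ℝ ψ p) := rfl

lemma pair_covector (A : Pt →L[ℝ] ℝ) (X : Vec) : pair (covector A) X = A X := by
  have h : ⟪(covector A).2, X.2⟫ = A (0, X.2) := by
    change ⟪(InnerProductSpace.toDual ℝ E3).symm (A.comp (ContinuousLinearMap.inr ℝ ℝ E3)), X.2⟫ = _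
    rw [InnerProductSpace.toDual_symm_apply]
    rfl
  have h1 : X = X.1 • ((1 : ℝ), (0 : E3)) + (0, X.2) := by ext <;> simp
  rw [pair, h]
  conv_rhs => rw [h1, map_add, map_smul]
  change A (1, 0) * X.1 + _ = _
  rw [smul_eq_mul, mul_comm]

lemma pair_diff (ψ : Pt → ℝ) (p : Pt) (X : Vec) : pair (diff ψ p) X = fderiv ℝ ψ p X :=
  pair_covector _ X

lemma contDiffAt_diff {ψ : Pt → ℝ} {p : Pt} {n k : WithTop ℕ∞} (h : ContDiffAt ℝ n ψ p)
    (hk : k + 1 ≤ n) : ContDiffAt ℝ k (diff ψ) p :=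
  covector.contDiff.contDiffAt.comp p (h.fderiv_right hk)

lemma hasFDerivAt_diff {ψ : Pt → ℝ} {p : Pt} (h : ContDiffAt ℝ 2 ψ p) :
    HasFDerivAt (diff ψ) (covector.comp (fderiv ℝ (fderiv ℝ ψ) p)) p :=
  covector.hasFDerivAt.comp p
    (((h.fderiv_right (m := 1) (by norm_num)).differentiableAt one_ne_zero).hasFDerivAt)

lemma hessian_symm {ψ : Pt → ℝ} {p : Pt} (h : ContDiffAt ℝ 2 ψ p) (u w : Pt) :
    fderiv ℝ (fderiv ℝ ψ) p u w = fderiv ℝ (fderiv ℝ ψ) p w u :=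
  (h.isSymmSndFDerivAt (by simp)).eq u w

lemma hasFDerivAt_rad {y : E3} (hy : y ≠ 0) :
    HasFDerivAt rad (‖y‖⁻¹ • (ContinuousLinearMap.id ℝ E3 - (innerSL ℝ (rad y)).smulRight (rad y)))
      y := by
  have hn : ‖y‖ ≠ 0 := norm_ne_zero_iff.2 hy
  have h1 := (hasDerivAt_inv hn).comp_hasFDerivAt y (hasFDerivAt_norm_E3 hy)
  have h2 := h1.smul (hasFDerivAt_id y)
  refine HasFDerivAt.congr_fderiv h2 ?_
  ext1 w
  simp only [_root_.add_apply, _root_.smul_apply,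
    ContinuousLinearMap.id_apply, ContinuousLinearMap.smulRight_apply,
    _root_.sub_apply, innerSL_apply_apply, Function.comp, smul_eq_mul, smul_sub, smul_smul, id]
  rw [sub_eq_add_neg, ← neg_smul]
  congr 1
  generalize ⟪rad y, w⟫ = c
  rw [rad, smul_smul]
  congr 1
  field_simp

lemma contDiffAt_rad {y : E3} (hy : y ≠ 0) {n : WithTop ℕ∞} : ContDiffAt ℝ n rad y := by
  unfold rad
  exact ((contDiffAt_norm ℝ hy).inv (norm_ne_zero_iff.2 hy)).smul contDiffAt_id

/-- The vector field `α ∂_τ + β ∂_r`. -/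
noncomputable def multiplier (α β : ℝ → ℝ) (q : Pt) : Vec := (α ‖q.2‖, β ‖q.2‖ • rad q.2)

lemma hasFDerivAt_radius {p : Pt} (hp : p.2 ≠ 0) :
    HasFDerivAt (fun q : Pt => ‖q.2‖)
      ((innerSL ℝ (rad p.2)).comp (ContinuousLinearMap.snd ℝ ℝ E3)) p :=
  HasFDerivAt.comp p (g := fun y : E3 => ‖y‖) (hasFDerivAt_norm_E3 hp)
    (ContinuousLinearMap.snd ℝ ℝ E3).hasFDerivAt

/-- The unit radial vector turns at rate `1 / r` in directions tangent to the sphere, which is the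
origin of the `β / r` term. The derivative is given by its action on vectors, so that it can be
traced and contracted without unfolding it. -/
lemma hasFDerivAt_multiplier {α β : ℝ → ℝ} {α' β' : ℝ} {p : Pt} (hp : p.2 ≠ 0)
    (hα : HasDerivAt α α' ‖p.2‖) (hβ : HasDerivAt β β' ‖p.2‖) :
    ∃ A : Vec →L[ℝ] Vec, HasFDerivAt (multiplier α β) A p ∧ ∀ u : Vec, A u =
      (α' * ⟪u.2, rad p.2⟫,
        (β' * ⟪u.2, rad p.2⟫) • rad p.2 + (β ‖p.2‖ * ‖p.2‖⁻¹) • tang p.2 u.2) := by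
  have h1 := hα.comp_hasFDerivAt p (hasFDerivAt_radius hp)
  have h2 := hβ.comp_hasFDerivAt p (hasFDerivAt_radius hp)
  have h3 := HasFDerivAt.comp p (hasFDerivAt_rad hp) (ContinuousLinearMap.snd ℝ ℝ E3).hasFDerivAt
  refine ⟨_, h1.prodMk (h2.smul h3), fun u => ?_⟩
  ext1
  · simp [real_inner_comm]
  · simp only [tang, ContinuousLinearMap.prod_apply, _root_.add_apply,
      _root_.smul_apply, ContinuousLinearMap.comp_apply,
      ContinuousLinearMap.smulRight_apply, _root_.sub_apply, innerSL_apply_apply,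
      ContinuousLinearMap.coe_snd', ContinuousLinearMap.id_apply, Function.comp, smul_eq_mul,
      real_inner_comm (rad p.2) u.2, smul_smul]
    rw [add_comm]

/-- The spatial block of the derivative is `β / r` times the identity plus a multiple of the radial
projection; its trace is `3 β / r + (β' - β / r)`. -/
lemma divergence_multiplier {α β : ℝ → ℝ} {α' β' : ℝ} {p : Pt} (hp : p.2 ≠ 0)
    (hα : HasDerivAt α α' ‖p.2‖) (hβ : HasDerivAt β β' ‖p.2‖) :
    divergence (multiplier α β) p = β' + 2 * β ‖p.2‖ / ‖p.2‖ := by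
  obtain ⟨A, hA, hAu⟩ := hasFDerivAt_multiplier hp hα hβ
  rw [divergence, hA.fderiv, trace_prod_eq]
  have h0 : (A (1, 0)).1 = 0 := by rw [hAu]; simp
  have h1 : ((ContinuousLinearMap.snd ℝ ℝ E3).comp
        (A.comp (ContinuousLinearMap.inr ℝ ℝ E3))).toLinearMap =
      (β' - β ‖p.2‖ * ‖p.2‖⁻¹) • (innerSL ℝ (rad p.2)).toLinearMap.smulRight (rad p.2)
        + (β ‖p.2‖ * ‖p.2‖⁻¹) • LinearMap.id := by
    refine LinearMap.ext fun w => ?_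
    change (A (0, w)).2 = (β' - β ‖p.2‖ * ‖p.2‖⁻¹) • (⟪rad p.2, w⟫ • rad p.2)
      + (β ‖p.2‖ * ‖p.2‖⁻¹) • w
    rw [hAu, tang, real_inner_comm w]
    module
  rw [h0, h1, map_add, map_smul, map_smul, LinearMap.trace_smulRight, LinearMap.trace_id]
  have h2 : (innerSL ℝ (rad p.2)).toLinearMap (rad p.2) = 1 := inner_rad_self hp
  rw [h2]
  simp
  field_simp
  ring

lemma norm_tang_sq {y : E3} (hy : y ≠ 0) (w : E3) :
    ‖tang y w‖ ^ 2 = ‖w‖ ^ 2 - ⟪w, rad y⟫ ^ 2 := by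
  have h1 := inner_rad_self hy
  rw [← real_inner_self_eq_norm_sq, ← real_inner_self_eq_norm_sq]
  simp only [tang, inner_sub_left, inner_sub_right, real_inner_smul_left, real_inner_smul_right, h1,
    real_inner_comm w (rad y)]
  ring

lemma inner_sharp_rad {Λ m : ℝ} {p : Pt} (hp : p.2 ≠ 0) (ξ : Vec) :
    ⟪(sharp Λ m p ξ).2, rad p.2⟫ = -ξ.1 - F Λ m ‖p.2‖ * ⟪ξ.2, rad p.2⟫ := by
  simp only [sharp, inner_add_left, real_inner_smul_left, inner_tang_rad hp, inner_rad_self hp]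
  ring

/-- The inverse metric on `ξ`, written with the full norm of `ξ.2`, which is easier to differentiate
than its tangential part. The `1` in `F + 1` removes the radial square contained in that norm. -/
lemma pair_sharp_self {Λ m : ℝ} (p : Pt) (ξ : Vec) :
    pair ξ (sharp Λ m p ξ) = -2 * ξ.1 * ⟪ξ.2, rad p.2⟫
      - (F Λ m ‖p.2‖ + 1) * ⟪ξ.2, rad p.2⟫ ^ 2 + ‖ξ.2‖ ^ 2 := by
  simp only [pair, sharp, inner_add_right, real_inner_smul_right, tang, inner_sub_right,
    real_inner_self_eq_norm_sq]
  ring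

/-- The energy current (with the sign for which the fluxes are nonnegative) of the multiplier
`α ∂_τ + β ∂_r`. -/
noncomputable def energyField (Λ m : ℝ) (α β : ℝ → ℝ) (ψ : Pt → ℝ) (q : Pt) : Vec :=
  -current Λ m q (diff ψ q) (multiplier α β q)

/-- The energy density on the level sets of `r`. -/
noncomputable def spaceDensity (Λ m α β : ℝ) (p : Pt) (ξ : Vec) : ℝ :=
  α * ξ.1 ^ 2 + α * F Λ m ‖p.2‖ * ⟪ξ.2, rad p.2⟫ * ξ.1
    + β * F Λ m ‖p.2‖ / 2 * ⟪ξ.2, rad p.2⟫ ^ 2 + β / 2 * ‖tang p.2 ξ.2‖ ^ 2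

/-- The energy density on the level sets of `τ`. -/
noncomputable def nullDensity (Λ m α β : ℝ) (p : Pt) (ξ : Vec) : ℝ :=
  (β - α * F Λ m ‖p.2‖ / 2) * ⟪ξ.2, rad p.2⟫ ^ 2 + α / 2 * ‖tang p.2 ξ.2‖ ^ 2

/-- The density of the bulk term. -/
noncomputable def bulkDensity (Λ m α' β β' : ℝ) (p : Pt) (ξ : Vec) : ℝ :=
  α' * ξ.1 ^ 2 + (α' * F Λ m ‖p.2‖ - 2 * β / ‖p.2‖) * ⟪ξ.2, rad p.2⟫ * ξ.1
    + (β' * F Λ m ‖p.2‖ / 2 - β / 2 * (2 * Λ * ‖p.2‖ / 3 - 2 * m / ‖p.2‖ ^ 2)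
      - β * F Λ m ‖p.2‖ / ‖p.2‖) * ⟪ξ.2, rad p.2⟫ ^ 2 + β' / 2 * ‖tang p.2 ξ.2‖ ^ 2

lemma pair_multiplier (α β : ℝ → ℝ) (p : Pt) (ξ : Vec) :
    pair ξ (multiplier α β p) = α ‖p.2‖ * ξ.1 + β ‖p.2‖ * ⟪ξ.2, rad p.2⟫ := by
  simp only [pair, multiplier, real_inner_smul_right]
  ring

/-- The level sets of `τ` are null, and their conormal raises to a radial vector, so the `τ`
derivative of `ψ` drops out of the flux. -/
lemma energyField_fst {Λ m : ℝ} {α β : ℝ → ℝ} {ψ : Pt → ℝ} {p : Pt} (hp : p.2 ≠ 0) :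
    (energyField Λ m α β ψ p).1 = nullDensity Λ m (α ‖p.2‖) (β ‖p.2‖) p (diff ψ p) := by
  simp only [energyField, current, Prod.fst_neg, Prod.fst_sub, Prod.smul_fst, pair_multiplier,
    pair_sharp_self, smul_eq_mul, nullDensity, norm_tang_sq hp]
  simp only [sharp, multiplier]
  ring

lemma inner_energyField_rad {Λ m : ℝ} {α β : ℝ → ℝ} {ψ : Pt → ℝ} {p : Pt} (hp : p.2 ≠ 0) :
    ⟪(energyField Λ m α β ψ p).2, rad p.2⟫
      = spaceDensity Λ m (α ‖p.2‖) (β ‖p.2‖) p (diff ψ p) := by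
  simp only [energyField, current, Prod.snd_neg, Prod.snd_sub, Prod.smul_snd, pair_multiplier,
    pair_sharp_self, spaceDensity, norm_tang_sq hp, inner_neg_left, inner_sub_left,
    real_inner_smul_left, inner_sharp_rad hp]
  simp only [multiplier, real_inner_smul_left, inner_rad_self hp]
  ring

lemma contDiffAt_snd_rad {p : Pt} (hp : p.2 ≠ 0) {n : WithTop ℕ∞} :
    ContDiffAt ℝ n (fun q : Pt => rad q.2) p :=
  ContDiffAt.comp p (f := fun q : Pt => q.2) (contDiffAt_rad hp) contDiffAt_snd

lemma contDiffAt_snd_norm {p : Pt} (hp : p.2 ≠ 0) {n : WithTop ℕ∞} :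
    ContDiffAt ℝ n (fun q : Pt => ‖q.2‖) p :=
  ContDiffAt.comp p (f := fun q : Pt => q.2) (contDiffAt_norm ℝ hp) contDiffAt_snd

lemma contDiffAt_sharp {Λ m : ℝ} {ξ : Pt → Vec} {p : Pt} (hp : p.2 ≠ 0) {n : WithTop ℕ∞}
    (hξ : ContDiffAt ℝ n ξ p) : ContDiffAt ℝ n (fun q => sharp Λ m q (ξ q)) p := by
  have hr := contDiffAt_snd_rad (n := n) hp
  have hn := contDiffAt_snd_norm (n := n) hp
  have hF : ContDiffAt ℝ n (fun q : Pt => F Λ m ‖q.2‖) p :=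
    ContDiffAt.comp p (f := fun q : Pt => ‖q.2‖) (contDiffAt_F Λ m (norm_ne_zero_iff.2 hp)) hn
  have hi : ContDiffAt ℝ n (fun q : Pt => ⟪(ξ q).2, rad q.2⟫) p := hξ.snd.inner ℝ hr
  unfold sharp tang
  exact hi.neg.prodMk ((hξ.snd.sub (hi.smul hr)).add ((hξ.fst.neg.sub (hF.mul hi)).smul hr))

lemma contDiffAt_multiplier {α β : ℝ → ℝ} {p : Pt} (hp : p.2 ≠ 0) {n : WithTop ℕ∞}
    (hα : ContDiffAt ℝ n α ‖p.2‖) (hβ : ContDiffAt ℝ n β ‖p.2‖) :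
    ContDiffAt ℝ n (multiplier α β) p := by
  have hn := contDiffAt_snd_norm (n := n) hp
  exact (ContDiffAt.comp p (f := fun q : Pt => ‖q.2‖) hα hn).prodMk
    ((ContDiffAt.comp p (f := fun q : Pt => ‖q.2‖) hβ hn).smul (contDiffAt_snd_rad hp))

lemma contDiffAt_pair {ξ X : Pt → Vec} {p : Pt} {n : WithTop ℕ∞} (hξ : ContDiffAt ℝ n ξ p)
    (hX : ContDiffAt ℝ n X p) : ContDiffAt ℝ n (fun q => pair (ξ q) (X q)) p := by
  unfold pair
  exact (hξ.fst.mul hX.fst).add (hξ.snd.inner ℝ hX.snd)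

lemma contDiffAt_energyField {Λ m : ℝ} {α β : ℝ → ℝ} {ψ : Pt → ℝ} {p : Pt} (hp : p.2 ≠ 0)
    (hψ : ContDiffAt ℝ 2 ψ p) (hα : ContDiffAt ℝ 1 α ‖p.2‖) (hβ : ContDiffAt ℝ 1 β ‖p.2‖) :
    ContDiffAt ℝ 1 (energyField Λ m α β ψ) p := by
  have hξ : ContDiffAt ℝ 1 (diff ψ) p := contDiffAt_diff hψ (by norm_num)
  have hS := contDiffAt_sharp (Λ := Λ) (m := m) hp hξ
  have hX := contDiffAt_multiplier hp hα hβ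
  unfold energyField current
  exact (((contDiffAt_pair hξ hX).smul hS).sub
    ((contDiffAt_const.mul (contDiffAt_pair hξ hS)).smul hX)).neg

lemma pair_add_left (ξ η X : Vec) : pair (ξ + η) X = pair ξ X + pair η X := by
  simp only [pair, Prod.fst_add, Prod.snd_add, inner_add_left]
  ring

/-- The derivative of the squared gradient along the multiplier. -/
lemma fderiv_pair_sharp_self {Λ m : ℝ} {α β : ℝ → ℝ} {ξ : Pt → Vec} {H : Vec →L[ℝ] Vec} {p : Pt}
    (hp : p.2 ≠ 0) (hξ : HasFDerivAt ξ H p) :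
    fderiv ℝ (fun q => pair (ξ q) (sharp Λ m q (ξ q))) p (multiplier α β p)
      = 2 * pair (H (multiplier α β p)) (sharp Λ m p (ξ p))
        - (2 * Λ * ‖p.2‖ / 3 - 2 * m / ‖p.2‖ ^ 2) * β ‖p.2‖ * ⟪(ξ p).2, rad p.2⟫ ^ 2 := by
  have hrad : HasFDerivAt (fun q : Pt => rad q.2) _ p :=
    HasFDerivAt.comp p (g := rad) (hasFDerivAt_rad hp) (ContinuousLinearMap.snd ℝ ℝ E3).hasFDerivAt
  have hF0 := (hasDerivAt_F Λ m (norm_ne_zero_iff.2 hp)).comp_hasFDerivAt p (hasFDerivAt_radius hp)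
  have hF : HasFDerivAt (fun q : Pt => F Λ m ‖q.2‖) _ p := hF0
  have h1 : HasFDerivAt (fun q => (ξ q).1) _ p :=
    (ContinuousLinearMap.fst ℝ ℝ E3).hasFDerivAt.comp p hξ
  have h2 : HasFDerivAt (fun q => (ξ q).2) _ p :=
    (ContinuousLinearMap.snd ℝ ℝ E3).hasFDerivAt.comp p hξ
  have hρ := h2.inner ℝ hrad
  have hQ := (((h1.const_mul (-2)).mul hρ).sub ((hF.add_const 1).mul (hρ.mul hρ))).add
    (h2.inner ℝ h2)
  have hfun : (fun q => pair (ξ q) (sharp Λ m q (ξ q))) = fun q => -2 * (ξ q).1 * ⟪(ξ q).2, rad q.2⟫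
      - (F Λ m ‖q.2‖ + 1) * (⟪(ξ q).2, rad q.2⟫ * ⟪(ξ q).2, rad q.2⟫) + ⟪(ξ q).2, (ξ q).2⟫ := by
    funext q
    rw [pair_sharp_self, real_inner_self_eq_norm_sq]
    ring
  rw [hfun]
  have hfd := hQ.fderiv
  refine (congrArg (fun A : Pt →L[ℝ] ℝ => A (multiplier α β p)) hfd).trans ?_
  have hr1 := inner_rad_self hp
  simp only [_root_.add_apply, _root_.sub_apply, _root_.smul_apply, ContinuousLinearMap.comp_apply,
    fderivInnerCLM_apply, ContinuousLinearMap.prod_apply, ContinuousLinearMap.coe_fst',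
    ContinuousLinearMap.coe_snd', innerSL_apply_apply, ContinuousLinearMap.smulRight_apply,
    ContinuousLinearMap.id_apply, smul_eq_mul, Pi.mul_apply]
  generalize H (multiplier α β p) = h
  -- Moving along the multiplier does not turn the radial direction, so besides the Hessian only the
  -- derivative of `F` contributes.
  simp only [multiplier, real_inner_smul_right, hr1, inner_sub_right, inner_add_right,
    pair, sharp, tang, real_inner_comm h.2 (ξ p).2]
  ring

/-- With `X` the multiplier and `S` the gradient, the field is `(1/2) |dψ|² X - X(ψ) S`. Its
divergence has no `div S` term because of the wave equation, and the two Hessian terms cancel by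
symmetry; what remains is quadratic in `dψ`, with coefficients from the derivative of `X` and from
`F'`. -/
lemma divergence_energyField {Λ m : ℝ} {α β : ℝ → ℝ} {α' β' : ℝ} {ψ : Pt → ℝ} {p : Pt}
    (hp : p.2 ≠ 0) (hψ : ContDiffAt ℝ 2 ψ p) (hbox : box Λ m ψ p = 0)
    (hα : HasDerivAt α α' ‖p.2‖) (hβ : HasDerivAt β β' ‖p.2‖) :
    divergence (energyField Λ m α β ψ) p
      = bulkDensity Λ m α' (β ‖p.2‖) β' p (diff ψ p) := by
  have hξ1 : ContDiffAt ℝ 1 (diff ψ) p := contDiffAt_diff hψ (by norm_num)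
  have hξ := hasFDerivAt_diff hψ
  set H := covector.comp (fderiv ℝ (fderiv ℝ ψ) p) with hH
  have hS1 := contDiffAt_sharp (Λ := Λ) (m := m) hp hξ1
  have hS := hS1.differentiableAt one_ne_zero
  obtain ⟨A, hA, hAu⟩ := hasFDerivAt_multiplier hp hα hβ
  have hQ : DifferentiableAt ℝ (fun q => pair (diff ψ q) (sharp Λ m q (diff ψ q))) p :=
    (contDiffAt_pair hξ1 hS1).differentiableAt one_ne_zero
  have hpX : HasFDerivAt (fun q => pair (diff ψ q) (multiplier α β q)) _ p :=
    (((ContinuousLinearMap.fst ℝ ℝ E3).hasFDerivAt.comp p hξ).mul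
      ((ContinuousLinearMap.fst ℝ ℝ E3).hasFDerivAt.comp p hA)).add
    (((ContinuousLinearMap.snd ℝ ℝ E3).hasFDerivAt.comp p hξ).inner ℝ
      ((ContinuousLinearMap.snd ℝ ℝ E3).hasFDerivAt.comp p hA))
  have hpXu : ∀ u, fderiv ℝ (fun q => pair (diff ψ q) (multiplier α β q)) p u
      = pair (H u) (multiplier α β p) + pair (diff ψ p) (A u) := fun u => by
    rw [hpX.fderiv]
    simp only [_root_.add_apply, _root_.smul_apply, ContinuousLinearMap.comp_apply,
      fderivInnerCLM_apply, ContinuousLinearMap.prod_apply, ContinuousLinearMap.coe_fst',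
      ContinuousLinearMap.coe_snd', smul_eq_mul, Function.comp, pair]
    ring
  have hfield : energyField Λ m α β ψ = fun q =>
      (1 / 2 * pair (diff ψ q) (sharp Λ m q (diff ψ q))) • multiplier α β q
        - pair (diff ψ q) (multiplier α β q) • sharp Λ m q (diff ψ q) := by
    funext q
    simp only [energyField, current, neg_sub]
  have hQ2 : DifferentiableAt ℝ (fun q => 1 / 2 * pair (diff ψ q) (sharp Λ m q (diff ψ q))) p :=
    hQ.const_mul _
  -- Symmetry of second derivatives, paired once with the multiplier and once with the gradient.
  have hsym : pair (H (sharp Λ m p (diff ψ p))) (multiplier α β p)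
      = pair (H (multiplier α β p)) (sharp Λ m p (diff ψ p)) := by
    simp only [hH, ContinuousLinearMap.comp_apply, pair_covector]
    exact hessian_symm hψ _ _
  rw [hfield, divergence_sub (hQ2.fun_smul hA.differentiableAt) (hpX.differentiableAt.fun_smul hS),
    divergence_smul hQ2 hA.differentiableAt, divergence_smul hpX.differentiableAt hS, hpXu,
    fderiv_const_mul hQ, _root_.smul_apply, fderiv_pair_sharp_self hp hξ,
    divergence_multiplier hp hα hβ]
  have hbox' : divergence (fun q => sharp Λ m q (diff ψ q)) p = 0 := hbox
  have hn : ‖p.2‖ ≠ 0 := norm_ne_zero_iff.2 hp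
  have hsr := inner_sharp_rad (Λ := Λ) (m := m) hp (diff ψ p)
  have htan : ⟪(diff ψ p).2, tang p.2 (sharp Λ m p (diff ψ p)).2⟫ = ‖tang p.2 (diff ψ p).2‖ ^ 2 := by
    rw [norm_tang_sq hp, tang, hsr]
    simp only [sharp, tang, inner_sub_right, inner_add_right, real_inner_smul_right,
      real_inner_self_eq_norm_sq]
    ring
  have hpA : pair (diff ψ p) (A (sharp Λ m p (diff ψ p)))
      = (-(diff ψ p).1 - F Λ m ‖p.2‖ * ⟪(diff ψ p).2, rad p.2⟫)
          * (α' * (diff ψ p).1 + β' * ⟪(diff ψ p).2, rad p.2⟫)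
        + β ‖p.2‖ * ‖p.2‖⁻¹ * ‖tang p.2 (diff ψ p).2‖ ^ 2 := by
    rw [hAu, hsr]
    simp only [pair, inner_add_right, real_inner_smul_right, htan]
    ring
  rw [hbox', hsym, hpA, pair_sharp_self, bulkDensity, norm_tang_sq hp]
  simp only [smul_eq_mul]
  field_simp
  ring

/-! ### Weighted energy inequalities -/

lemma pt_snd_ne_zero {τ r : ℝ} (hr : 0 < r) (x : S2) : (pt τ r x).2 ≠ 0 := by
  rw [← norm_ne_zero_iff, pt, norm_smul_sphere hr.le]
  exact hr.ne'

lemma norm_pt_snd {τ r : ℝ} (hr : 0 ≤ r) (x : S2) : ‖(pt τ r x).2‖ = r := norm_smul_sphere hr x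

lemma rad_pt_snd {τ r : ℝ} (hr : 0 < r) (x : S2) : rad (pt τ r x).2 = x := rad_smul_sphere hr x

lemma lintegral_cyl_eq_ofReal {g : ℝ × S2 → ℝ} {a b : ℝ} (hg : ContinuousOn g (Icc a b ×ˢ univ))
    (h0 : ∀ z ∈ Icc a b ×ˢ (univ : Set S2), 0 ≤ g z) :
    ∫⁻ z in Icc a b ×ˢ univ, ENNReal.ofReal (g z) ∂cylMeasure
      = ENNReal.ofReal (∫ z in Icc a b ×ˢ univ, g z ∂cylMeasure) := by
  have hm : MeasurableSet (Icc a b ×ˢ (univ : Set S2)) := measurableSet_Icc.prod MeasurableSet.univ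
  rw [ofReal_integral_eq_lintegral_ofReal
    (hg.integrableOn_compact (isCompact_Icc.prod isCompact_univ))
    ((ae_restrict_iff' hm).2 (ae_of_all _ h0))]

/-- The divergence theorem for fields with nonpositive divergence and nonnegative fluxes. -/
theorem flux_lintegral_le {W : Pt → Vec} {a b r₁ r₂ : ℝ} (hab : a ≤ b) (h₁ : 0 < r₁)
    (h₁₂ : r₁ ≤ r₂)
    (hW : ∀ p : Pt, p.1 ∈ Icc a b → ‖p.2‖ ∈ Icc r₁ r₂ → ContDiffAt ℝ 1 W p)
    (hdiv : ∀ p : Pt, p.1 ∈ Icc a b → ‖p.2‖ ∈ Icc r₁ r₂ → divergence W p ≤ 0)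
    (hspace : ∀ p : Pt, p.1 ∈ Icc a b → ‖p.2‖ ∈ Icc r₁ r₂ → 0 ≤ ⟪(W p).2, rad p.2⟫)
    (hnull : ∀ p : Pt, p.1 ∈ Icc a b → ‖p.2‖ ∈ Icc r₁ r₂ → 0 ≤ (W p).1) :
    (∫⁻ z in Icc a b ×ˢ univ, ENNReal.ofReal
        (r₂ ^ 2 * ⟪(W (pt z.1 r₂ z.2)).2, rad (pt z.1 r₂ z.2).2⟫) ∂cylMeasure) +
      (∫⁻ z in Icc r₁ r₂ ×ˢ univ, ENNReal.ofReal (z.1 ^ 2 * (W (pt b z.1 z.2)).1) ∂cylMeasure) ≤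
    (∫⁻ z in Icc a b ×ˢ univ, ENNReal.ofReal
        (r₁ ^ 2 * ⟪(W (pt z.1 r₁ z.2)).2, rad (pt z.1 r₁ z.2).2⟫) ∂cylMeasure) +
      ∫⁻ z in Icc r₁ r₂ ×ˢ univ, ENNReal.ofReal (z.1 ^ 2 * (W (pt a z.1 z.2)).1) ∂cylMeasure := by
  have hmain := flux_le_of_divergence_nonpos hab h₁ h₁₂ hW hdiv
  have hmem : ∀ {r : ℝ} (x : S2) {τ : ℝ}, r ∈ Icc r₁ r₂ → ‖(pt τ r x).2‖ ∈ Icc r₁ r₂ :=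
    fun x τ hr => by rwa [norm_pt_snd (h₁.le.trans hr.1)]
  have cW : ∀ z : (ℝ × ℝ) × S2, z.1.1 ∈ Icc a b → z.1.2 ∈ Icc r₁ r₂ →
      ContinuousAt (fun z : (ℝ × ℝ) × S2 => W (pt z.1.1 z.1.2 z.2)) z := fun z h1 h2 =>
    ContinuousAt.comp' (hW _ h1 (hmem z.2 h2)).continuousAt continuous_pt.continuousAt
  have hA : ∀ r ∈ Icc r₁ r₂, ∫⁻ z in Icc a b ×ˢ univ, ENNReal.ofReal
      (r ^ 2 * ⟪(W (pt z.1 r z.2)).2, rad (pt z.1 r z.2).2⟫) ∂cylMeasure = ENNReal.ofReal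
      (∫ z in Icc a b ×ˢ univ, r ^ 2 * ⟪(W (pt z.1 r z.2)).2, (z.2 : E3)⟫ ∂cylMeasure) := by
    intro r hr
    have hr0 : 0 < r := h₁.trans_le hr.1
    simp_rw [rad_pt_snd hr0]
    refine lintegral_cyl_eq_ofReal (fun z hz => ?_) fun z hz => ?_
    · have h1 : ContinuousAt (fun z : ℝ × S2 => W (pt z.1 r z.2)) z :=
        ContinuousAt.comp' (f := fun z : ℝ × S2 => ((z.1, r), z.2)) (cW ((z.1, r), z.2) hz.1 hr)
          (by fun_prop)
      have h2 : ContinuousAt (fun z : ℝ × S2 => (z.2 : E3)) z := by fun_prop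
      exact (continuousAt_const.mul (h1.snd.inner h2)).continuousWithinAt
    · have := hspace (pt z.1 r z.2) hz.1 (hmem z.2 hr)
      rw [rad_pt_snd hr0] at this
      positivity
  have hB : ∀ τ ∈ Icc a b, ∫⁻ z in Icc r₁ r₂ ×ˢ univ, ENNReal.ofReal
      (z.1 ^ 2 * (W (pt τ z.1 z.2)).1) ∂cylMeasure = ENNReal.ofReal
      (∫ z in Icc r₁ r₂ ×ˢ univ, z.1 ^ 2 * (W (pt τ z.1 z.2)).1 ∂cylMeasure) := by
    intro τ hτ
    refine lintegral_cyl_eq_ofReal (fun z hz => ?_) fun z hz => ?_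
    · have h1 : ContinuousAt (fun z : ℝ × S2 => W (pt τ z.1 z.2)) z :=
        ContinuousAt.comp' (f := fun z : ℝ × S2 => ((τ, z.1), z.2)) (cW ((τ, z.1), z.2) hτ hz.1)
          (by fun_prop)
      exact (ContinuousAt.mul (by fun_prop) h1.fst).continuousWithinAt
    · have := hnull (pt τ z.1 z.2) hτ (hmem z.2 hz.1)
      positivity
  have hnnA : ∀ r ∈ Icc r₁ r₂,
      0 ≤ ∫ z in Icc a b ×ˢ univ, r ^ 2 * ⟪(W (pt z.1 r z.2)).2, (z.2 : E3)⟫ ∂cylMeasure :=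
    fun r hr => setIntegral_nonneg (measurableSet_Icc.prod MeasurableSet.univ) fun z hz => by
      have := hspace (pt z.1 r z.2) hz.1 (hmem z.2 hr)
      rw [rad_pt_snd (h₁.trans_le hr.1)] at this
      positivity
  have hnnB : ∀ τ ∈ Icc a b,
      0 ≤ ∫ z in Icc r₁ r₂ ×ˢ univ, z.1 ^ 2 * (W (pt τ z.1 z.2)).1 ∂cylMeasure :=
    fun τ hτ => setIntegral_nonneg (measurableSet_Icc.prod MeasurableSet.univ) fun z hz => by
      have := hnull (pt τ z.1 z.2) hτ (hmem z.2 hz.1)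
      positivity
  have hr₁ : r₁ ∈ Icc r₁ r₂ := ⟨le_rfl, h₁₂⟩
  have hr₂ : r₂ ∈ Icc r₁ r₂ := ⟨h₁₂, le_rfl⟩
  have ha : a ∈ Icc a b := ⟨le_rfl, hab⟩
  have hb : b ∈ Icc a b := ⟨hab, le_rfl⟩
  rw [hA r₁ hr₁, hA r₂ hr₂, hB a ha, hB b hb, ← ENNReal.ofReal_add (hnnA r₁ hr₁) (hnnB a ha),
    ← ENNReal.ofReal_add (hnnA r₂ hr₂) (hnnB b hb)]
  exact ENNReal.ofReal_le_ofReal hmain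

/-- The weighted energy inequality for solutions of the wave equation. -/
theorem weighted_energy_le {Λ m : ℝ} {α β α' β' : ℝ → ℝ} {ψ w : Pt → ℝ} {a b r₁ r₂ : ℝ}
    (hab : a ≤ b) (h₁ : 0 < r₁) (h₁₂ : r₁ ≤ r₂)
    (hψ : ∀ p : Pt, ‖p.2‖ ∈ Icc r₁ r₂ → ContDiffAt ℝ ∞ ψ p ∧ box Λ m ψ p = 0)
    (hα : ∀ r ∈ Icc r₁ r₂, ContDiffAt ℝ 1 α r ∧ HasDerivAt α (α' r) r)
    (hβ : ∀ r ∈ Icc r₁ r₂, ContDiffAt ℝ 1 β r ∧ HasDerivAt β (β' r) r)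
    (hw : ∀ p : Pt, p.1 ∈ Icc a b → ‖p.2‖ ∈ Icc r₁ r₂ → ContDiffAt ℝ 1 w p)
    (hw0 : ∀ p, 0 ≤ w p)
    (hspace : ∀ p : Pt, ‖p.2‖ ∈ Icc r₁ r₂ → ∀ ξ, 0 ≤ spaceDensity Λ m (α ‖p.2‖) (β ‖p.2‖) p ξ)
    (hnull : ∀ p : Pt, ‖p.2‖ ∈ Icc r₁ r₂ → ∀ ξ, 0 ≤ nullDensity Λ m (α ‖p.2‖) (β ‖p.2‖) p ξ)
    (hK : ∀ p : Pt, p.1 ∈ Icc a b → ‖p.2‖ ∈ Icc r₁ r₂ →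
      w p * bulkDensity Λ m (α' ‖p.2‖) (β ‖p.2‖) (β' ‖p.2‖) p (diff ψ p)
        + fderiv ℝ w p (energyField Λ m α β ψ p) ≤ 0) :
    (∫⁻ z in Icc a b ×ˢ univ, (let p := pt z.1 r₂ z.2
        ENNReal.ofReal (r₂ ^ 2 * (w p * spaceDensity Λ m (α r₂) (β r₂) p (diff ψ p)))) ∂cylMeasure) +
      (∫⁻ z in Icc r₁ r₂ ×ˢ univ, (let p := pt b z.1 z.2
        ENNReal.ofReal (z.1 ^ 2 * (w p * nullDensity Λ m (α z.1) (β z.1) p (diff ψ p))))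
          ∂cylMeasure) ≤
    (∫⁻ z in Icc a b ×ˢ univ, (let p := pt z.1 r₁ z.2
        ENNReal.ofReal (r₁ ^ 2 * (w p * spaceDensity Λ m (α r₁) (β r₁) p (diff ψ p)))) ∂cylMeasure) +
      ∫⁻ z in Icc r₁ r₂ ×ˢ univ, (let p := pt a z.1 z.2
        ENNReal.ofReal (z.1 ^ 2 * (w p * nullDensity Λ m (α z.1) (β z.1) p (diff ψ p))))
          ∂cylMeasure := by
  have hne : ∀ p : Pt, ‖p.2‖ ∈ Icc r₁ r₂ → p.2 ≠ 0 := fun p hp =>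
    norm_ne_zero_iff.1 (h₁.trans_le hp.1).ne'
  have h2 : ∀ p : Pt, ‖p.2‖ ∈ Icc r₁ r₂ → ContDiffAt ℝ 2 ψ p := fun p hp =>
    (hψ p hp).1.of_le (WithTop.coe_le_coe.2 le_top)
  have hE : ∀ p : Pt, ‖p.2‖ ∈ Icc r₁ r₂ → ContDiffAt ℝ 1 (energyField Λ m α β ψ) p := fun p hp =>
    contDiffAt_energyField (hne p hp) (h2 p hp) (hα _ hp).1 (hβ _ hp).1
  have hsp : ∀ p : Pt, ‖p.2‖ ∈ Icc r₁ r₂ → ⟪(w p • energyField Λ m α β ψ p).2, rad p.2⟫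
      = w p * spaceDensity Λ m (α ‖p.2‖) (β ‖p.2‖) p (diff ψ p) := fun p hp => by
    rw [Prod.smul_snd, real_inner_smul_left, inner_energyField_rad (hne p hp)]
  have hnl : ∀ p : Pt, ‖p.2‖ ∈ Icc r₁ r₂ → (w p • energyField Λ m α β ψ p).1
      = w p * nullDensity Λ m (α ‖p.2‖) (β ‖p.2‖) p (diff ψ p) := fun p hp => by
    rw [Prod.smul_fst, smul_eq_mul, energyField_fst (hne p hp)]
  -- Here `div (w J) = w div J + dw (J)`, which is the expression assumed nonpositive in `hK`.
  have hmain := flux_lintegral_le (W := fun p => w p • energyField Λ m α β ψ p) hab h₁ h₁₂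
    (fun p h h' => (hw p h h').smul (hE p h'))
    (fun p h h' => by
      rw [divergence_smul ((hw p h h').differentiableAt one_ne_zero)
        ((hE p h').differentiableAt one_ne_zero),
        divergence_energyField (hne p h') (h2 p h') (hψ p h').2 (hα _ h').2 (hβ _ h').2]
      exact hK p h h')
    (fun p h h' => by rw [hsp p h']; exact mul_nonneg (hw0 p) (hspace p h' _))
    (fun p h h' => by rw [hnl p h']; exact mul_nonneg (hw0 p) (hnull p h' _))
  have cA : ∀ r ∈ Icc r₁ r₂, ∫⁻ z in Icc a b ×ˢ univ, ENNReal.ofReal (r ^ 2 *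
      ⟪(w (pt z.1 r z.2) • energyField Λ m α β ψ (pt z.1 r z.2)).2, rad (pt z.1 r z.2).2⟫)
        ∂cylMeasure = ∫⁻ z in Icc a b ×ˢ univ, ENNReal.ofReal (r ^ 2 *
      (w (pt z.1 r z.2) * spaceDensity Λ m (α r) (β r) (pt z.1 r z.2) (diff ψ (pt z.1 r z.2))))
        ∂cylMeasure := fun r hr => by
    have hn : ∀ z : ℝ × S2, ‖(pt z.1 r z.2).2‖ = r := fun z => norm_pt_snd (h₁.le.trans hr.1) _
    refine lintegral_congr fun z => ?_
    rw [hsp _ (by rw [hn z]; exact hr), hn z]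
  have cB : ∀ τ : ℝ, ∫⁻ z in Icc r₁ r₂ ×ˢ univ, ENNReal.ofReal (z.1 ^ 2 *
      (w (pt τ z.1 z.2) • energyField Λ m α β ψ (pt τ z.1 z.2)).1)
        ∂cylMeasure = ∫⁻ z in Icc r₁ r₂ ×ˢ univ, ENNReal.ofReal (z.1 ^ 2 *
      (w (pt τ z.1 z.2) * nullDensity Λ m (α z.1) (β z.1) (pt τ z.1 z.2) (diff ψ (pt τ z.1 z.2))))
        ∂cylMeasure := fun τ => by
    refine setLIntegral_congr_fun (measurableSet_Icc.prod MeasurableSet.univ) fun z hz => ?_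
    have hn : ‖(pt τ z.1 z.2).2‖ = z.1 := norm_pt_snd (h₁.le.trans hz.1.1) _
    rw [hnl _ (by rw [hn]; exact hz.1), hn]
  rw [cA r₁ ⟨le_rfl, h₁₂⟩, cA r₂ ⟨h₁₂, le_rfl⟩, cB a, cB b] at hmain
  exact hmain

/-! ### Energy estimate away from the horizon -/

/-- Smooth solutions of the wave equation on the region `r > ρ`. -/
def IsExteriorSolution (Λ m ρ : ℝ) (ψ : Pt → ℝ) : Prop :=
  ∀ p : Pt, ρ < ‖p.2‖ → ContDiffAt ℝ ∞ ψ p ∧ box Λ m ψ p = 0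

/-- In coordinates `(t, r)` with `dt = dτ - dr / F` the multiplier is the radial coordinate field,
orthogonal to the level sets of `r`. Hence the density is diagonal in `∂_t ψ` and `F` times that
radial derivative. -/
lemma spaceDensity_normal {Λ m : ℝ} {p : Pt} (hF : 0 < F Λ m ‖p.2‖) (ξ : Vec) :
    spaceDensity Λ m (F Λ m ‖p.2‖)⁻¹ 1 p ξ
      = (ξ.1 ^ 2 + (ξ.1 + F Λ m ‖p.2‖ * ⟪ξ.2, rad p.2⟫) ^ 2) / (2 * F Λ m ‖p.2‖)
        + ‖tang p.2 ξ.2‖ ^ 2 / 2 := by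
  unfold spaceDensity
  field_simp
  ring

/-- The difference of the two sides is a sum of squares. This is finite speed of propagation: it
fixes how fast a cutoff in `τ` must move with `r` for its derivative to have a good sign. -/
lemma nullDensity_normal_le {Λ m : ℝ} {p : Pt} (hF : 0 < F Λ m ‖p.2‖) (ξ : Vec) :
    nullDensity Λ m (F Λ m ‖p.2‖)⁻¹ 1 p ξ
      ≤ 2 / F Λ m ‖p.2‖ * spaceDensity Λ m (F Λ m ‖p.2‖)⁻¹ 1 p ξ := by
  rw [spaceDensity_normal hF]
  unfold nullDensity
  generalize F Λ m ‖p.2‖ = f at *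
  have h : 2 / f * ((ξ.1 ^ 2 + (ξ.1 + f * ⟪ξ.2, rad p.2⟫) ^ 2) / (2 * f) + ‖tang p.2 ξ.2‖ ^ 2 / 2)
      - ((1 - f⁻¹ * f / 2) * ⟪ξ.2, rad p.2⟫ ^ 2 + f⁻¹ / 2 * ‖tang p.2 ξ.2‖ ^ 2)
      = ((2 * ξ.1 + f * ⟪ξ.2, rad p.2⟫) ^ 2 + f * ‖tang p.2 ξ.2‖ ^ 2) / (2 * f ^ 2) := by
    field_simp
    ring
  have h2 : 0 ≤ ((2 * ξ.1 + f * ⟪ξ.2, rad p.2⟫) ^ 2 + f * ‖tang p.2 ξ.2‖ ^ 2) / (2 * f ^ 2) := by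
    positivity
  linarith

lemma nullDensity_normal_nonneg {Λ m : ℝ} {p : Pt} (hF : 0 < F Λ m ‖p.2‖) (ξ : Vec) :
    0 ≤ nullDensity Λ m (F Λ m ‖p.2‖)⁻¹ 1 p ξ := by
  unfold nullDensity
  rw [inv_mul_cancel₀ hF.ne']
  have : (0 : ℝ) ≤ 1 - 1 / 2 := by norm_num
  positivity

/-- Diagonal in the same two squares as `spaceDensity_normal`, with coefficients proportional to `r²
F' - 2 r F` and `r² F' + 2 r F`. The smaller is `2 r - 6 m`, positive beyond the photon sphere. -/
lemma bulkDensity_normal_nonpos {Λ m ρ : ℝ} (h : IsHorizonRadius Λ m ρ) {p : Pt} (hp : ρ < ‖p.2‖)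
    (ξ : Vec) :
    bulkDensity Λ m (-(2 * Λ * ‖p.2‖ / 3 - 2 * m / ‖p.2‖ ^ 2) / F Λ m ‖p.2‖ ^ 2) 1 0 p ξ ≤ 0 := by
  have hF := h.F_pos hp
  have hr : 0 < ‖p.2‖ := h.pos.trans hp
  have hd := h.deriv_pos hp.le
  have hk := IsHorizonRadius.sq_mul_deriv (Λ := Λ) (m := m) hr.ne'
  have hlt := h.photon_lt
  unfold bulkDensity
  set f := F Λ m ‖p.2‖
  set d := 2 * Λ * ‖p.2‖ / 3 - 2 * m / ‖p.2‖ ^ 2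
  set r := ‖p.2‖
  have e : -d / f ^ 2 * ξ.1 ^ 2 + (-d / f ^ 2 * f - 2 * 1 / r) * ⟪ξ.2, rad p.2⟫ * ξ.1
      + (0 * f / 2 - 1 / 2 * d - 1 * f / r) * ⟪ξ.2, rad p.2⟫ ^ 2 + 0 / 2 * ‖tang p.2 ξ.2‖ ^ 2
      = -(((r ^ 2 * d - 2 * r * f) * ξ.1 ^ 2
        + (r ^ 2 * d + 2 * r * f) * (ξ.1 + f * ⟪ξ.2, rad p.2⟫) ^ 2) / (2 * f ^ 2 * r ^ 2)) := by
    field_simp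
    ring
  rw [e]
  have h1 : 0 ≤ r ^ 2 * d - 2 * r * f := by rw [hk]; linarith
  have h2 : 0 ≤ r ^ 2 * d + 2 * r * f := by positivity
  have h3 : 0 ≤ ((r ^ 2 * d - 2 * r * f) * ξ.1 ^ 2
        + (r ^ 2 * d + 2 * r * f) * (ξ.1 + f * ⟪ξ.2, rad p.2⟫) ^ 2) / (2 * f ^ 2 * r ^ 2) := by
    positivity
  linarith

lemma deriv_smoothTransition_nonneg (x : ℝ) : 0 ≤ deriv Real.smoothTransition x :=
  Real.smoothTransition.monotone.deriv_nonneg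

/-- Energy on a level set of `r` is controlled by the energy on its domain of dependence in an earlier
level set. -/
theorem far_energy_le {Λ m ρ : ℝ} (h : IsHorizonRadius Λ m ρ) {ψ : Pt → ℝ}
    (hψ : IsExteriorSolution Λ m ρ ψ) {r₁ R a b : ℝ} (hr₁ : ρ < r₁) (hR : r₁ ≤ R) (hab : a ≤ b) :
    (∫⁻ z in Icc a b ×ˢ univ, (let p := pt z.1 R z.2
      ENNReal.ofReal (R ^ 2 * spaceDensity Λ m (F Λ m R)⁻¹ 1 p (diff ψ p))) ∂cylMeasure) ≤
    ∫⁻ z in Icc (a - (1 + 2 * r₁ / F Λ m r₁)) b ×ˢ univ, (let p := pt z.1 r₁ z.2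
      ENNReal.ofReal (r₁ ^ 2 * spaceDensity Λ m (F Λ m r₁)⁻¹ 1 p (diff ψ p))) ∂cylMeasure := by
  have hr0 : 0 < r₁ := h.pos.trans hr₁
  have hF1 := h.F_pos hr₁
  -- Chosen so that `2 / F r ≤ c / r ^ 2` for all `r ≥ r₁`, by the quadratic growth of `F`.
  set c := 2 * r₁ ^ 2 / F Λ m r₁ with hc
  have hc0 : 0 < c := by positivity
  have hcr : c / r₁ = 2 * r₁ / F Λ m r₁ := by rw [hc]; field_simp
  rw [← hcr]
  set a' := a - (1 + c / r₁) with ha'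
  have ha'a : a' ≤ a := by
    have : 0 < c / r₁ := by positivity
    linarith
  have hpos : ∀ p : Pt, ‖p.2‖ ∈ Icc r₁ R → 0 < ‖p.2‖ ∧ 0 < F Λ m ‖p.2‖ := fun p hp =>
    ⟨hr0.trans_le hp.1, h.F_pos (hr₁.trans_le hp.1)⟩
  -- The cutoff is a function of `τ + c / r`. It equals `1` for `τ ≥ a` at every radius, and
  -- vanishes on `τ = a'` because `c / r ≤ c / r₁` there. In its derivative the radial flux enters
  -- with the factor `-c / r²` and outweighs the null flux.
  set g : Pt → ℝ := fun p => p.1 - a + 1 + c / ‖p.2‖ with hg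
  have hgd : ∀ p : Pt, ‖p.2‖ ∈ Icc r₁ R → ContDiffAt ℝ 1 g p := fun p hp => by
    have hn := contDiffAt_snd_norm (n := 1) (norm_ne_zero_iff.1 (hpos p hp).1.ne')
    exact ((contDiffAt_fst.sub contDiffAt_const).add contDiffAt_const).add
      (contDiffAt_const.div hn (hpos p hp).1.ne')
  have hgf : ∀ p : Pt, ‖p.2‖ ∈ Icc r₁ R → ∀ u : Vec, fderiv ℝ g p u
      = u.1 - c / ‖p.2‖ ^ 2 * ⟪u.2, rad p.2⟫ := fun p hp u => by
    have hne := norm_ne_zero_iff.1 (hpos p hp).1.ne'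
    have h1 := ((hasDerivAt_inv (hpos p hp).1.ne').const_mul c).comp_hasFDerivAt p
      (hasFDerivAt_radius hne)
    have h2 : HasFDerivAt g _ p :=
      (((ContinuousLinearMap.fst ℝ ℝ E3).hasFDerivAt.sub_const a).add_const 1).add h1
    rw [h2.fderiv]
    simp [real_inner_comm]
    ring
  have hmain := weighted_energy_le (Λ := Λ) (m := m) (α := fun r => (F Λ m r)⁻¹) (β := fun _ => 1)
    (α' := fun r => -(2 * Λ * r / 3 - 2 * m / r ^ 2) / F Λ m r ^ 2) (β' := fun _ => 0) (ψ := ψ)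
    (w := fun p => Real.smoothTransition (g p)) (ha'a.trans hab) hr0 hR
    (fun p hp => hψ p (hr₁.trans_le hp.1))
    (fun r hr => ⟨(contDiffAt_F Λ m (hr0.trans_le hr.1).ne').inv (h.F_pos (hr₁.trans_le hr.1)).ne',
      (hasDerivAt_F Λ m (hr0.trans_le hr.1).ne').inv (h.F_pos (hr₁.trans_le hr.1)).ne'⟩)
    (fun r _ => ⟨contDiffAt_const, hasDerivAt_const _ _⟩)
    (fun p _ hp => ContDiffAt.comp p (Real.smoothTransition.contDiffAt (n := 1)) (hgd p hp))
    (fun p => Real.smoothTransition.nonneg _)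
    (fun p hp ξ => by
      have := hpos p hp
      rw [spaceDensity_normal this.2]
      have := this.2
      positivity)
    (fun p hp ξ => nullDensity_normal_nonneg (hpos p hp).2 ξ)
    (fun p _ hp => by
      have hF := (hpos p hp).2
      have hr := (hpos p hp).1
      have hne := norm_ne_zero_iff.1 hr.ne'
      have h1 := mul_nonpos_of_nonneg_of_nonpos (Real.smoothTransition.nonneg (g p))
        (bulkDensity_normal_nonpos h (hr₁.trans_le hp.1) (diff ψ p))
      have hst : HasDerivAt Real.smoothTransition (deriv Real.smoothTransition (g p)) (g p) :=
        ((Real.smoothTransition.contDiffAt (n := 1)).differentiableAt one_ne_zero).hasDerivAt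
      have h2 : fderiv ℝ (fun p => Real.smoothTransition (g p)) p = _ :=
        (hst.comp_hasFDerivAt p ((hgd p hp).differentiableAt one_ne_zero).hasFDerivAt).fderiv
      rw [h2, _root_.smul_apply, hgf p hp, smul_eq_mul, inner_energyField_rad hne,
        energyField_fst hne]
      have h3 := nullDensity_normal_le hF (diff ψ p)
      have h4 : 0 ≤ spaceDensity Λ m (F Λ m ‖p.2‖)⁻¹ 1 p (diff ψ p) := by
        rw [spaceDensity_normal hF]; positivity
      have h5 : 2 / F Λ m ‖p.2‖ ≤ c / ‖p.2‖ ^ 2 := by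
        have := h.le_F hr₁.le hp.1
        rw [hc, div_div, div_le_div_iff₀ hF (by positivity)]
        rw [div_mul_eq_mul_div, div_le_iff₀ (by positivity)] at this
        nlinarith
      have h6 := mul_le_mul_of_nonneg_right h5 h4
      have h7 := mul_nonneg (deriv_smoothTransition_nonneg (g p)) (sub_nonneg.2 (h3.trans h6))
      linarith)
  refine le_trans ?_ (hmain.trans ?_)
  · refine le_trans ?_ le_self_add
    refine le_trans (le_of_eq ?_) (lintegral_mono_set (prod_mono (Icc_subset_Icc_left ha'a) Subset.rfl))
    refine setLIntegral_congr_fun (measurableSet_Icc.prod MeasurableSet.univ) fun z hz => ?_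
    have hone : Real.smoothTransition (g (pt z.1 R z.2)) = 1 := by
      refine Real.smoothTransition.one_of_one_le ?_
      have h1 : 0 ≤ c / ‖(pt z.1 R z.2).2‖ := by positivity
      have h2 : a ≤ (pt z.1 R z.2).1 := hz.1.1
      simp only [hg]
      linarith
    simp only [hone, one_mul]
  · have hzero : ∫⁻ z in Icc r₁ R ×ˢ univ, (let p := pt a' z.1 z.2
        ENNReal.ofReal (z.1 ^ 2 * (Real.smoothTransition (g p)
          * nullDensity Λ m (F Λ m z.1)⁻¹ 1 p (diff ψ p)))) ∂cylMeasure = 0 := by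
      rw [setLIntegral_congr_fun (g := fun _ => 0) (measurableSet_Icc.prod MeasurableSet.univ),
        lintegral_zero]
      intro z hz
      have hz0 : Real.smoothTransition (g (pt a' z.1 z.2)) = 0 := by
        refine Real.smoothTransition.zero_of_nonpos ?_
        simp only [hg]
        rw [norm_pt_snd (hr0.le.trans hz.1.1)]
        have h1 : c / z.1 ≤ c / r₁ := div_le_div_of_nonneg_left hc0.le hr0 hz.1.1
        have h2 : (pt a' z.1 z.2).1 = a' := rfl
        rw [h2, ha']
        linarith
      simp only [hz0, zero_mul, mul_zero, ENNReal.ofReal_zero]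
    rw [hzero, add_zero]
    refine lintegral_mono fun z => ENNReal.ofReal_le_ofReal ?_
    have hn : ‖(pt z.1 r₁ z.2).2‖ = r₁ := norm_pt_snd hr0.le _
    have h4 : 0 ≤ spaceDensity Λ m (F Λ m r₁)⁻¹ 1 (pt z.1 r₁ z.2) (diff ψ (pt z.1 r₁ z.2)) := by
      have := spaceDensity_normal (Λ := Λ) (m := m) (p := pt z.1 r₁ z.2) (by rw [hn]; exact hF1)
        (diff ψ (pt z.1 r₁ z.2))
      rw [hn] at this
      rw [this]
      positivity
    exact mul_le_mul_of_nonneg_left (mul_le_of_le_one_left h4 (Real.smoothTransition.le_one _))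
      (sq_nonneg _)

/-! ### Uniform bounds and convergence along the level sets of `r` -/

lemma measurableSet_cyl (a b : ℝ) : MeasurableSet (Icc a b ×ˢ (univ : Set S2)) :=
  measurableSet_Icc.prod MeasurableSet.univ

/-- Length of the interval of `τ` in `r = r₁` that has to be added for the domain of dependence. -/
noncomputable def lag (Λ m r₁ : ℝ) : ℝ := 1 + 2 * r₁ / F Λ m r₁

lemma lag_nonneg {Λ m ρ r₁ : ℝ} (h : IsHorizonRadius Λ m ρ) (hr₁ : ρ < r₁) : 0 ≤ lag Λ m r₁ := by
  have := h.F_pos hr₁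
  have := h.pos.trans hr₁
  unfold lag
  positivity

/-- The energy density in terms of which the far estimate is uniform in `r`. -/
noncomputable def rescaledDensity (p : Pt) (ξ : Vec) : ℝ :=
  ‖p.2‖ ^ 4 * ⟪ξ.2, rad p.2⟫ ^ 2 + (ξ.1 ^ 2 + ‖p.2‖ ^ 2 * ‖tang p.2 ξ.2‖ ^ 2)

/-- Since `F` is comparable to `r²`, the conserved quantity `R² · spaceDensity` dominates the
rescaled density with a constant independent of `R`. At the fixed radius `r₁` it is bounded by the
full first order energy. -/
theorem exists_far_bound {Λ m ρ r₁ : ℝ} (h : IsHorizonRadius Λ m ρ) (hr₁ : ρ < r₁) :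
    ∃ C : ℝ, 0 ≤ C ∧ ∀ ψ, IsExteriorSolution Λ m ρ ψ → ∀ R a b : ℝ, r₁ ≤ R →
      (∫⁻ z in Icc a b ×ˢ univ, (let p := pt z.1 R z.2
        ENNReal.ofReal (rescaledDensity p (diff ψ p))) ∂cylMeasure) ≤
      ENNReal.ofReal C * ∫⁻ z in Icc (a - lag Λ m r₁) b ×ˢ univ, (let p := pt z.1 r₁ z.2
        let ξ := diff ψ p
        ENNReal.ofReal (ξ.1 ^ 2 + ‖ξ.2‖ ^ 2)) ∂cylMeasure := by
  have hr0 : 0 < r₁ := h.pos.trans hr₁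
  have hF1 := h.F_pos hr₁
  set κ := F Λ m r₁ / r₁ ^ 2 with hκ
  have hκ0 : 0 < κ := by positivity
  have hΛ := h.lambda_pos
  -- The summands serve the radial derivative (through `F ≥ κ R²`), the `τ` derivative (through `F ≤
  -- Λ R² / 3`) and the angular derivatives.
  set C₁ := 4 / κ + (2 * Λ / 3 + 2) with hC₁
  set C₂ := r₁ ^ 2 * ((F Λ m r₁)⁻¹ + F Λ m r₁ / 2 + 1) with hC₂
  have hC₁0 : 0 ≤ C₁ := by positivity
  have hC₂0 : 0 ≤ C₂ := by positivity
  refine ⟨C₁ * C₂, by positivity, fun ψ hψ R a b hR => ?_⟩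
  rcases lt_or_ge b a with hab | hab
  · simp [Icc_eq_empty (not_le.2 hab)]
  have hR0 : 0 < R := hr0.trans_le hR
  have hlow : ∀ z : ℝ × S2, rescaledDensity (pt z.1 R z.2) (diff ψ (pt z.1 R z.2)) ≤
      C₁ * (R ^ 2 * spaceDensity Λ m (F Λ m R)⁻¹ 1 (pt z.1 R z.2) (diff ψ (pt z.1 R z.2))) := by
    intro z
    have hn : ‖(pt z.1 R z.2).2‖ = R := norm_pt_snd hR0.le _
    have hFR := h.F_pos (hr₁.trans_le hR)
    have hsd := spaceDensity_normal (Λ := Λ) (m := m) (p := pt z.1 R z.2) (by rw [hn]; exact hFR)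
      (diff ψ (pt z.1 R z.2))
    rw [rescaledDensity]
    rw [hn] at hsd ⊢
    rw [hsd]
    have hle := h.le_F hr₁.le hR
    have hup := h.F_le (hr₁.le.trans hR)
    rw [← hκ] at hle
    generalize F Λ m R = f at *
    generalize ⟪(diff ψ (pt z.1 R z.2)).2, rad (pt z.1 R z.2).2⟫ = x
    generalize (diff ψ (pt z.1 R z.2)).1 = s
    have hT0 := sq_nonneg ‖tang (pt z.1 R z.2).2 (diff ψ (pt z.1 R z.2)).2‖
    generalize ‖tang (pt z.1 R z.2).2 (diff ψ (pt z.1 R z.2)).2‖ ^ 2 = T at *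
    set E := (s ^ 2 + (s + f * x) ^ 2) / (2 * f) with hE
    have hE0 : 0 ≤ E := by positivity
    have hEf : s ^ 2 + (s + f * x) ^ 2 = 2 * f * E := by rw [hE]; field_simp
    have h1 : R ^ 4 * x ^ 2 ≤ 4 / κ * (R ^ 2 * E) := by
      rw [div_mul_eq_mul_div, le_div_iff₀ hκ0]
      have e1 : f * x ^ 2 ≤ 4 * E := by
        refine le_of_mul_le_mul_left ?_ hFR
        nlinarith [sq_nonneg (2 * s + f * x)]
      have e2 : κ * R ^ 2 * x ^ 2 ≤ f * x ^ 2 := mul_le_mul_of_nonneg_right hle (sq_nonneg x)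
      have e3 := mul_le_mul_of_nonneg_left (e2.trans e1) (sq_nonneg R)
      linarith
    have h2 : s ^ 2 ≤ 2 * Λ / 3 * (R ^ 2 * E) := by
      have e1 := mul_le_mul_of_nonneg_right hup hE0
      nlinarith [sq_nonneg (s + f * x)]
    have h3 : 0 ≤ (4 / κ + 2 * Λ / 3) * (R ^ 2 * (T / 2)) := by positivity
    have h4 : 0 ≤ 2 * (R ^ 2 * E) := by positivity
    rw [hC₁]
    linarith
  have hhigh : ∀ z : ℝ × S2,
      r₁ ^ 2 * spaceDensity Λ m (F Λ m r₁)⁻¹ 1 (pt z.1 r₁ z.2) (diff ψ (pt z.1 r₁ z.2)) ≤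
      C₂ * ((diff ψ (pt z.1 r₁ z.2)).1 ^ 2 + ‖(diff ψ (pt z.1 r₁ z.2)).2‖ ^ 2) := by
    intro z
    have hn : ‖(pt z.1 r₁ z.2).2‖ = r₁ := norm_pt_snd hr0.le _
    have ht := norm_tang_sq (pt_snd_ne_zero (τ := z.1) hr0 z.2) (diff ψ (pt z.1 r₁ z.2)).2
    have ht0 := sq_nonneg ‖tang (pt z.1 r₁ z.2).2 (diff ψ (pt z.1 r₁ z.2)).2‖
    rw [spaceDensity, hn, hC₂, mul_assoc (r₁ ^ 2)]
    refine mul_le_mul_of_nonneg_left ?_ (sq_nonneg _)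
    rw [inv_mul_cancel₀ hF1.ne']
    have hi : 0 < (F Λ m r₁)⁻¹ := by positivity
    generalize (F Λ m r₁)⁻¹ = g at *
    generalize F Λ m r₁ = f at *
    generalize ‖tang (pt z.1 r₁ z.2).2 (diff ψ (pt z.1 r₁ z.2)).2‖ ^ 2 = T at *
    generalize ‖(diff ψ (pt z.1 r₁ z.2)).2‖ ^ 2 = N at *
    generalize ⟪(diff ψ (pt z.1 r₁ z.2)).2, rad (pt z.1 r₁ z.2).2⟫ = x at *
    generalize (diff ψ (pt z.1 r₁ z.2)).1 = s
    obtain rfl : N = T + x ^ 2 := by linarith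
    have h1 : 0 ≤ (x - s) ^ 2 := sq_nonneg _
    have h2 : 0 ≤ g * x ^ 2 := mul_nonneg hi.le (sq_nonneg _)
    have h3 := mul_nonneg hi.le ht0
    have h4 : 0 ≤ f * s ^ 2 := mul_nonneg hF1.le (sq_nonneg _)
    have h5 := mul_nonneg hF1.le ht0
    have h6 : 0 ≤ x ^ 2 := sq_nonneg _
    have h7 : 0 ≤ s ^ 2 := sq_nonneg _
    linarith
  have hb := far_energy_le h hψ hr₁ hR hab
  calc _ ≤ ∫⁻ z in Icc a b ×ˢ univ, ENNReal.ofReal C₁ * ENNReal.ofReal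
        (R ^ 2 * spaceDensity Λ m (F Λ m R)⁻¹ 1 (pt z.1 R z.2) (diff ψ (pt z.1 R z.2)))
          ∂cylMeasure := by
        refine lintegral_mono fun z => ?_
        rw [← ENNReal.ofReal_mul hC₁0]
        exact ENNReal.ofReal_le_ofReal (hlow z)
    _ = ENNReal.ofReal C₁ * ∫⁻ z in Icc a b ×ˢ univ, ENNReal.ofReal
        (R ^ 2 * spaceDensity Λ m (F Λ m R)⁻¹ 1 (pt z.1 R z.2) (diff ψ (pt z.1 R z.2)))
          ∂cylMeasure := lintegral_const_mul' _ _ ENNReal.ofReal_ne_top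
    _ ≤ ENNReal.ofReal C₁ * _ := mul_le_mul_right hb _
    _ ≤ ENNReal.ofReal C₁ * ∫⁻ z in Icc (a - lag Λ m r₁) b ×ˢ univ, ENNReal.ofReal C₂ *
        ENNReal.ofReal ((diff ψ (pt z.1 r₁ z.2)).1 ^ 2 + ‖(diff ψ (pt z.1 r₁ z.2)).2‖ ^ 2)
          ∂cylMeasure := by
        refine mul_le_mul_right (lintegral_mono fun z => ?_) _
        rw [← ENNReal.ofReal_mul hC₂0]
        exact ENNReal.ofReal_le_ofReal (hhigh z)
    _ = _ := by
        rw [lintegral_const_mul' _ _ ENNReal.ofReal_ne_top, ← mul_assoc, ENNReal.ofReal_mul hC₁0]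

/-- A weighted Cauchy–Schwarz inequality. -/
lemma sq_integral_le {g : ℝ → ℝ} {R S : ℝ} (hR : 0 < R) (hRS : R ≤ S)
    (hg : ContinuousOn g (Icc R S)) :
    (∫ r in R..S, g r) ^ 2 ≤ R⁻¹ * ∫ r in R..S, r ^ 2 * g r ^ 2 := by
  set I := ∫ r in R..S, g r
  set K := ∫ r in R..S, r ^ 2 * g r ^ 2
  have hne : ∀ r ∈ Icc R S, r ≠ 0 := fun r hr => (hR.trans_le hr.1).ne'
  have cinv : ContinuousOn (fun r : ℝ => (r ^ 2)⁻¹) (Icc R S) :=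
    ContinuousOn.inv₀ (by fun_prop) fun r hr => pow_ne_zero 2 (hne r hr)
  have hJ : ∫ r in R..S, (r ^ 2)⁻¹ = R⁻¹ - S⁻¹ := by
    rw [intervalIntegral.integral_eq_sub_of_hasDerivAt (f := fun r => -r⁻¹) (fun r hr => ?_)
      (cinv.intervalIntegrable_of_Icc hRS)]
    · ring
    · rw [uIcc_of_le hRS] at hr
      exact (hasDerivAt_inv (hne r hr)).neg.congr_deriv (by simp)
  have i1 : IntervalIntegrable (fun r => r ^ 2 * g r ^ 2) volume R S :=
    ContinuousOn.intervalIntegrable_of_Icc hRS (by fun_prop)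
  have i2 : IntervalIntegrable (fun r => 2 * (I * R) * g r) volume R S :=
    ContinuousOn.intervalIntegrable_of_Icc hRS (by fun_prop)
  have i3 : IntervalIntegrable (fun r : ℝ => (I * R) ^ 2 * (r ^ 2)⁻¹) volume R S :=
    ContinuousOn.intervalIntegrable_of_Icc hRS (by fun_prop)
  -- Expand the square of `r g - I R / r` and use that `r⁻²` has integral at most `R⁻¹`.
  have h0 : 0 ≤ ∫ r in R..S, ((r ^ 2 * g r ^ 2 - 2 * (I * R) * g r) + (I * R) ^ 2 * (r ^ 2)⁻¹) := by
    refine intervalIntegral.integral_nonneg hRS fun r hr => ?_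
    have : (r ^ 2 * g r ^ 2 - 2 * (I * R) * g r) + (I * R) ^ 2 * (r ^ 2)⁻¹
        = (r * g r - I * R / r) ^ 2 := by
      have := hne r hr
      field_simp
      ring
    rw [this]
    positivity
  rw [intervalIntegral.integral_add (i1.sub i2) i3, intervalIntegral.integral_sub i1 i2,
    intervalIntegral.integral_const_mul, intervalIntegral.integral_const_mul, hJ] at h0
  have hS : 0 < S⁻¹ := inv_pos.2 (hR.trans_le hRS)
  have h1 : (I * R) ^ 2 * (R⁻¹ - S⁻¹) ≤ I ^ 2 * R := by
    have : (I * R) ^ 2 * (R⁻¹ - S⁻¹) = I ^ 2 * R - (I * R) ^ 2 * S⁻¹ := by field_simp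
    rw [this]
    have : 0 ≤ (I * R) ^ 2 * S⁻¹ := by positivity
    linarith
  rw [inv_mul_eq_div, le_div_iff₀ hR]
  have h2 : 2 * (I * R) * I = 2 * (I ^ 2 * R) := by ring
  change 0 ≤ K - 2 * (I * R) * I + _ at h0
  linarith

lemma lintegral_inv_sq_le {R S : ℝ} (hR : 0 < R) :
    ∫⁻ r in Icc R S, ENNReal.ofReal (r ^ 2)⁻¹ ≤ ENNReal.ofReal R⁻¹ := by
  rcases lt_or_ge S R with hRS | hRS
  · simp [Icc_eq_empty (not_le.2 hRS)]
  have hne : ∀ r ∈ Icc R S, r ≠ 0 := fun r hr => (hR.trans_le hr.1).ne'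
  have cinv : ContinuousOn (fun r : ℝ => (r ^ 2)⁻¹) (Icc R S) :=
    ContinuousOn.inv₀ (by fun_prop) fun r hr => pow_ne_zero 2 (hne r hr)
  rw [← ofReal_integral_eq_lintegral_ofReal (cinv.integrableOn_compact isCompact_Icc)
    (ae_of_all _ fun r => by positivity), integral_Icc_eq_integral_Ioc,
    ← intervalIntegral.integral_of_le hRS]
  refine ENNReal.ofReal_le_ofReal ?_
  rw [intervalIntegral.integral_eq_sub_of_hasDerivAt (f := fun r => -r⁻¹) (fun r hr => ?_)
      (cinv.intervalIntegrable_of_Icc hRS)]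
  · have hS : 0 < S⁻¹ := inv_pos.2 (hR.trans_le hRS)
    linarith
  · rw [uIcc_of_le hRS] at hr
    exact (hasDerivAt_inv (hne r hr)).neg.congr_deriv (by simp)

lemma hasDerivAt_radial {ψ : Pt → ℝ} {τ r : ℝ} {x : S2} (hr : 0 < r)
    (hψ : DifferentiableAt ℝ ψ (pt τ r x)) :
    HasDerivAt (fun r => ψ (pt τ r x)) ⟪(diff ψ (pt τ r x)).2, rad (pt τ r x).2⟫ r := by
  have h1 : HasDerivAt (fun r : ℝ => pt τ r x) ((0, (x : E3)) : Vec) r := by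
    have h2 : HasDerivAt (fun r : ℝ => r • (x : E3)) (x : E3) r := by
      simpa using (hasDerivAt_id r).smul_const (x : E3)
    exact (hasDerivAt_const r τ).prodMk h2
  refine (hψ.hasFDerivAt.comp_hasDerivAt r h1).congr_deriv ?_
  rw [← pair_diff, pair, rad_pt_snd hr]
  simp

lemma continuousAt_diff {ψ : Pt → ℝ} {p : Pt} (h : ContDiffAt ℝ ∞ ψ p) : ContinuousAt (diff ψ) p :=
  (contDiffAt_diff (n := 1) (k := 0) (h.of_le (WithTop.coe_le_coe.2 le_top)) (by simp)).continuousAt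

/-- Solutions converge along the level sets of `r`. -/
theorem lintegral_sq_sub_le {Λ m ρ r₁ : ℝ} (h : IsHorizonRadius Λ m ρ) (hr₁ : ρ < r₁)
    {ψ : Pt → ℝ} (hψ : IsExteriorSolution Λ m ρ ψ) {a b : ℝ} {M : ℝ≥0∞}
    (hM : ∀ R, r₁ ≤ R → (∫⁻ z in Icc a b ×ˢ univ, (let p := pt z.1 R z.2
        ENNReal.ofReal (rescaledDensity p (diff ψ p))) ∂cylMeasure) ≤ M) {R S : ℝ} (hR : r₁ ≤ R)
    (hRS : R ≤ S) :
    ∫⁻ z in Icc a b ×ˢ univ, ENNReal.ofReal ((ψ (pt z.1 S z.2) - ψ (pt z.1 R z.2)) ^ 2) ∂cylMeasure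
      ≤ ENNReal.ofReal R⁻¹ * (ENNReal.ofReal R⁻¹ * M) := by
  have hr0 : 0 < r₁ := h.pos.trans hr₁
  have hR0 : 0 < R := hr0.trans_le hR
  have hsm : ∀ (τ : ℝ) (x : S2), ∀ r ∈ Icc R S, ContDiffAt ℝ ∞ ψ (pt τ r x) := fun τ x r hr =>
    (hψ _ (by rw [norm_pt_snd (hR0.le.trans hr.1)]; exact hr₁.trans_le (hR.trans hr.1))).1
  set G : ℝ × S2 → ℝ → ℝ := fun z r => ⟪(diff ψ (pt z.1 r z.2)).2, rad (pt z.1 r z.2).2⟫ with hG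
  have hGc : ContinuousOn (Function.uncurry G) (univ ×ˢ Icc R S) := fun q hq => by
    have hne : (pt q.1.1 q.2 q.1.2).2 ≠ 0 := pt_snd_ne_zero (hR0.trans_le hq.2.1) _
    have hpc : ContinuousAt (fun q : (ℝ × S2) × ℝ => pt q.1.1 q.2 q.1.2) q := by
      unfold pt
      fun_prop
    have h1 : ContinuousAt (fun p : Pt => ⟪(diff ψ p).2, rad p.2⟫) (pt q.1.1 q.2 q.1.2) :=
      (continuousAt_diff (hsm _ _ _ hq.2)).snd.inner (contDiffAt_snd_rad (n := 0) hne).continuousAt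
    exact (ContinuousAt.comp' (f := fun q : (ℝ × S2) × ℝ => pt q.1.1 q.2 q.1.2) h1
      hpc).continuousWithinAt
  have hGz : ∀ z, ContinuousOn (G z) (Icc R S) := fun z =>
    hGc.comp (f := fun r : ℝ => (z, r)) (by fun_prop) fun r hr => ⟨mem_univ _, hr⟩
  -- The difference is the integral of the radial derivative, and Cauchy–Schwarz with weight `r²`
  -- yields one factor `R⁻¹`. The second comes later from `r² G² = r⁻² (r⁴ G²)`, where `r⁴ G²` is
  -- part of the rescaled density bounded by `M`.
  have hpt : ∀ z : ℝ × S2, ENNReal.ofReal ((ψ (pt z.1 S z.2) - ψ (pt z.1 R z.2)) ^ 2) ≤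
      ENNReal.ofReal R⁻¹ * ∫⁻ r in Icc R S, ENNReal.ofReal (r ^ 2 * G z r ^ 2) := by
    intro z
    have hcont : ContinuousOn (fun r => r ^ 2 * G z r ^ 2) (Icc R S) := by
      have := hGz z
      fun_prop
    have hftc : ∫ r in R..S, G z r = ψ (pt z.1 S z.2) - ψ (pt z.1 R z.2) := by
      refine intervalIntegral.integral_eq_sub_of_hasDerivAt (f := fun r => ψ (pt z.1 r z.2))
        (fun r hr => ?_) ((hGz z).intervalIntegrable_of_Icc hRS)
      rw [uIcc_of_le hRS] at hr
      exact hasDerivAt_radial (hR0.trans_le hr.1) ((hsm _ _ _ hr).differentiableAt (by simp))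
    rw [← ofReal_integral_eq_lintegral_ofReal (hcont.integrableOn_compact isCompact_Icc)
      (ae_of_all _ fun r => by positivity), integral_Icc_eq_integral_Ioc,
      ← intervalIntegral.integral_of_le hRS, ← ENNReal.ofReal_mul (by positivity), ← hftc]
    exact ENNReal.ofReal_le_ofReal (sq_integral_le hR0 hRS (hGz z))
  have hmeas : AEMeasurable (Function.uncurry fun (z : ℝ × S2) (r : ℝ) =>
      ENNReal.ofReal (r ^ 2 * G z r ^ 2))
      ((cylMeasure.restrict (Icc a b ×ˢ univ)).prod (volume.restrict (Icc R S))) := by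
    rw [Measure.prod_restrict]
    refine ENNReal.measurable_ofReal.comp_aemeasurable (ContinuousOn.aemeasurable (fun q hq => ?_)
      ((measurableSet_cyl a b).prod measurableSet_Icc))
    have h1 : ContinuousWithinAt (Function.uncurry G) ((Icc a b ×ˢ univ) ×ˢ Icc R S) q :=
      (hGc q ⟨mem_univ _, hq.2⟩).mono (prod_mono (subset_univ _) Subset.rfl)
    exact ContinuousWithinAt.mul (by fun_prop) (h1.pow 2)
  have : SFinite cylMeasure := by unfold cylMeasure; infer_instance
  calc _ ≤ ∫⁻ z in Icc a b ×ˢ univ, (ENNReal.ofReal R⁻¹ *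
        ∫⁻ r in Icc R S, ENNReal.ofReal (r ^ 2 * G z r ^ 2)) ∂cylMeasure := lintegral_mono hpt
    _ = ENNReal.ofReal R⁻¹ * ∫⁻ r in Icc R S, ∫⁻ z in Icc a b ×ˢ univ,
        ENNReal.ofReal (r ^ 2 * G z r ^ 2) ∂cylMeasure := by
        rw [lintegral_const_mul' _ _ ENNReal.ofReal_ne_top, lintegral_lintegral_swap hmeas]
    _ ≤ ENNReal.ofReal R⁻¹ * ∫⁻ r in Icc R S, ENNReal.ofReal (r ^ 2)⁻¹ * M := by
        refine mul_le_mul_right (setLIntegral_mono' measurableSet_Icc fun r hr => ?_) _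
        refine le_trans ?_ (mul_le_mul_right (hM r (hR.trans hr.1)) _)
        rw [← lintegral_const_mul' _ _ ENNReal.ofReal_ne_top]
        refine lintegral_mono fun z => ?_
        have hr' : 0 < r := hR0.trans_le hr.1
        rw [← ENNReal.ofReal_mul (by positivity)]
        refine ENNReal.ofReal_le_ofReal ?_
        rw [rescaledDensity, norm_pt_snd hr'.le]
        have e : r ^ 2 * G z r ^ 2 = (r ^ 2)⁻¹ * (r ^ 4 * G z r ^ 2) := by field_simp
        rw [e]
        refine mul_le_mul_of_nonneg_left ?_ (by positivity)
        exact le_add_of_nonneg_right (by positivity)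
    _ ≤ ENNReal.ofReal R⁻¹ * (ENNReal.ofReal R⁻¹ * M) := by
        refine mul_le_mul_right ?_ _
        rw [lintegral_mul_const'' _ (by fun_prop)]
        exact mul_le_mul_left (lintegral_inv_sq_le hR0) _

/-! ### Commutation with the Killing fields -/

/-- The Killing field `c ∂_τ + (J y) · ∂_y`, for `J` antisymmetric. -/
noncomputable def killing (c : ℝ) (J : E3 →L[ℝ] E3) (p : Pt) : Vec := (c, J p.2)

/-- The derivative of a function along a Killing field. -/
noncomputable def alongKilling (c : ℝ) (J : E3 →L[ℝ] E3) (ψ : Pt → ℝ) (p : Pt) : ℝ :=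
  fderiv ℝ ψ p (killing c J p)

/-- The linear part of a Killing field. -/
noncomputable def killingLin (J : E3 →L[ℝ] E3) : Vec →L[ℝ] Vec :=
  (ContinuousLinearMap.inr ℝ ℝ E3).comp (J.comp (ContinuousLinearMap.snd ℝ ℝ E3))

lemma killingLin_apply (J : E3 →L[ℝ] E3) (u : Vec) : killingLin J u = (0, J u.2) := rfl

lemma hasFDerivAt_killing (c : ℝ) (J : E3 →L[ℝ] E3) (p : Pt) :
    HasFDerivAt (killing c J) (killingLin J) p := by
  have h := ((killingLin J).hasFDerivAt (x := p)).const_add ((c, 0) : Vec)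
  refine h.congr_of_eventuallyEq (Eventually.of_forall fun q => ?_)
  simp [killing, killingLin_apply]

lemma contDiff_killing (c : ℝ) (J : E3 →L[ℝ] E3) {n : WithTop ℕ∞} : ContDiff ℝ n (killing c J) :=
  contDiff_const.prodMk (J.contDiff.comp contDiff_snd)

lemma contDiffAt_alongKilling {c : ℝ} {J : E3 →L[ℝ] E3} {ψ : Pt → ℝ} {p : Pt}
    (hψ : ContDiffAt ℝ ∞ ψ p) : ContDiffAt ℝ ∞ (alongKilling c J ψ) p :=
  (hψ.fderiv_right (by simp)).clm_apply (contDiff_killing c J).contDiffAt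

lemma eq_of_pair_eq {ξ η : Vec} (h : ∀ X, pair ξ X = pair η X) : ξ = η := by
  ext1
  · simpa [pair] using h (1, 0)
  · refine ext_inner_right ℝ fun v => ?_
    simpa [pair] using h (0, v)

/-- The product rule: the Hessian term comes from differentiating `dψ`, and the term with `J` from
differentiating the Killing field, transposed by antisymmetry. -/
lemma diff_alongKilling {c : ℝ} {J : E3 →L[ℝ] E3} (hJ : ∀ u v, ⟪J u, v⟫ = -⟪u, J v⟫) {ψ : Pt → ℝ}
    {p : Pt} (hψ : ContDiffAt ℝ 2 ψ p) :
    diff (alongKilling c J ψ) p = covector (fderiv ℝ (fderiv ℝ ψ) p (killing c J p))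
      + (0, -J (diff ψ p).2) := by
  refine eq_of_pair_eq fun X => ?_
  have h1 := ((hψ.fderiv_right (m := 1) (by norm_num)).differentiableAt one_ne_zero).hasFDerivAt
  have h2 : HasFDerivAt (alongKilling c J ψ) _ p := h1.clm_apply (hasFDerivAt_killing c J p)
  rw [pair_diff, h2.fderiv, pair_add_left, pair_covector]
  simp only [_root_.add_apply, ContinuousLinearMap.comp_apply, ContinuousLinearMap.flip_apply]
  rw [hessian_symm hψ, ← pair_diff, add_comm]
  congr 1
  simp [pair, killingLin_apply, hJ]

/-- The flow of a Killing field preserves the gradient operator. -/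
lemma sharp_diff_alongKilling {Λ m c : ℝ} {J : E3 →L[ℝ] E3} (hJ : ∀ u v, ⟪J u, v⟫ = -⟪u, J v⟫)
    {ψ : Pt → ℝ} {p : Pt} (hp : p.2 ≠ 0) (hψ : ContDiffAt ℝ 2 ψ p) :
    sharp Λ m p (diff (alongKilling c J ψ) p)
      = fderiv ℝ (fun q => sharp Λ m q (diff ψ q)) p (killing c J p)
        - killingLin J (sharp Λ m p (diff ψ p)) := by
  have hJ0 : ∀ u, ⟪J u, u⟫ = 0 := fun u => by
    have := hJ u u
    rw [real_inner_comm] at this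
    linarith [real_inner_comm u (J u)]
  have hn : ‖p.2‖ ≠ 0 := norm_ne_zero_iff.2 hp
  have hξ := hasFDerivAt_diff hψ
  have hrad : HasFDerivAt (fun q : Pt => rad q.2) _ p :=
    HasFDerivAt.comp p (g := rad) (hasFDerivAt_rad hp) (ContinuousLinearMap.snd ℝ ℝ E3).hasFDerivAt
  have hF0 := (hasDerivAt_F Λ m hn).comp_hasFDerivAt p (hasFDerivAt_radius hp)
  have hF : HasFDerivAt (fun q : Pt => F Λ m ‖q.2‖) _ p := hF0
  have h1 : HasFDerivAt (fun q => (diff ψ q).1) _ p :=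
    (ContinuousLinearMap.fst ℝ ℝ E3).hasFDerivAt.comp p hξ
  have h2 : HasFDerivAt (fun q => (diff ψ q).2) _ p :=
    (ContinuousLinearMap.snd ℝ ℝ E3).hasFDerivAt.comp p hξ
  have hρ := h2.inner ℝ hrad
  have hS : HasFDerivAt (fun q => sharp Λ m q (diff ψ q)) _ p :=
    hρ.neg.prodMk ((h2.sub (hρ.smul hrad)).add ((h1.neg.sub (hF.mul hρ)).smul hrad))
  -- A rotation moves `y` orthogonally to itself, so it preserves `‖y‖` and hence `F`, and carries
  -- the radial field to itself.
  have hJr : J (rad p.2) = ‖p.2‖⁻¹ • J p.2 := by rw [rad, map_smul]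
  have hrJ : ⟪rad p.2, J p.2⟫ = 0 := by
    rw [rad, real_inner_smul_left, real_inner_comm, hJ0, mul_zero]
  rw [hS.fderiv, diff_alongKilling hJ hψ]
  generalize hη : diff ψ p = η
  simp only [ContinuousLinearMap.prod_apply, _root_.add_apply, _root_.sub_apply,
    _root_.neg_apply, _root_.smul_apply, ContinuousLinearMap.comp_apply,
    fderivInnerCLM_apply, ContinuousLinearMap.coe_fst', ContinuousLinearMap.coe_snd',
    innerSL_apply_apply, ContinuousLinearMap.smulRight_apply, ContinuousLinearMap.id_apply,
    smul_eq_mul, killingLin_apply, Pi.sub_apply, Pi.neg_apply, Pi.mul_apply, hη]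
  generalize covector (fderiv ℝ (fderiv ℝ ψ) p (killing c J p)) = h
  have hk : (killing c J p).2 = J p.2 := rfl
  have hk2 : ⟪J η.2, rad p.2⟫ = -⟪η.2, J (rad p.2)⟫ := hJ _ _
  simp only [sharp, tang, hk, hrJ, zero_smul, sub_zero, ← hJr, Prod.fst_add, Prod.snd_add,
    inner_add_left, inner_neg_left, hk2, map_add, map_sub, map_smul, mul_zero]
  ext1
  · simp
    ring
  · simp only [Prod.snd_sub]
    module

/-- The gradient of the derivative along a Killing field `K` is the Lie bracket of `K` with the
gradient `S` of `ψ`. Its divergence is `K (div S)` plus the trace of a commutator of `J` with the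
derivative of `S`; both vanish. -/
theorem IsExteriorSolution.alongKilling {Λ m ρ : ℝ} (hρ : 0 ≤ ρ) {ψ : Pt → ℝ}
    (hψ : IsExteriorSolution Λ m ρ ψ) (c : ℝ) {J : E3 →L[ℝ] E3}
    (hJ : ∀ u v, ⟪J u, v⟫ = -⟪u, J v⟫) : IsExteriorSolution Λ m ρ (alongKilling c J ψ) := by
  intro p hp
  refine ⟨contDiffAt_alongKilling (hψ p hp).1, ?_⟩
  have hopen : IsOpen {q : Pt | ρ < ‖q.2‖} := isOpen_lt continuous_const (by fun_prop)
  have hev : ∀ᶠ q in 𝓝 p, ρ < ‖q.2‖ := hopen.mem_nhds hp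
  have hne : ∀ q : Pt, ρ < ‖q.2‖ → q.2 ≠ 0 := fun q hq =>
    norm_ne_zero_iff.1 (hρ.trans_lt hq).ne'
  set S : Pt → Vec := fun q => sharp Λ m q (diff ψ q) with hSdef
  have hS2 : ContDiffAt ℝ 2 S p :=
    contDiffAt_sharp (hne p hp) (contDiffAt_diff (n := 3) ((hψ p hp).1.of_le
      (WithTop.coe_le_coe.2 le_top)) (by norm_num))
  have hSd : DifferentiableAt ℝ S p := hS2.differentiableAt (by norm_num)
  have hfS := ((hS2.fderiv_right (m := 1) (by norm_num)).differentiableAt one_ne_zero).hasFDerivAt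
  have hA : HasFDerivAt (fun q => fderiv ℝ S q (killing c J q)) _ p :=
    hfS.clm_apply (hasFDerivAt_killing c J p)
  have hB : HasFDerivAt (fun q => killingLin J (S q)) _ p :=
    (killingLin J).hasFDerivAt.comp p hSd.hasFDerivAt
  have heq : (fun q => sharp Λ m q (diff (SdS.alongKilling c J ψ) q)) =ᶠ[𝓝 p]
      fun q => fderiv ℝ S q (killing c J q) - killingLin J (S q) := by
    filter_upwards [hev] with q hq
    exact sharp_diff_alongKilling hJ (hne q hq) ((hψ q hq).1.of_le (WithTop.coe_le_coe.2 le_top))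
  have hdiv0 : (fun q => traceCLM Vec (fderiv ℝ S q)) =ᶠ[𝓝 p] fun _ => 0 := by
    filter_upwards [hev] with q hq using (hψ q hq).2
  have hD : fderiv ℝ (fun q => traceCLM Vec (fderiv ℝ S q)) p
      = (traceCLM Vec).comp (fderiv ℝ (fderiv ℝ S) p) :=
    ((traceCLM Vec).hasFDerivAt.comp p hfS).fderiv
  rw [hdiv0.fderiv_eq, fderiv_fun_const] at hD
  -- The divergence of `S` vanishes on a neighbourhood, so its derivative along the Killing field is
  -- zero.
  have hD0 : traceCLM Vec (fderiv ℝ (fderiv ℝ S) p (killing c J p)) = 0 :=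
    (congrArg (fun A : Pt →L[ℝ] ℝ => A (killing c J p)) hD).symm
  have hsym : ∀ u w : Pt, fderiv ℝ (fderiv ℝ S) p u w = fderiv ℝ (fderiv ℝ S) p w u := fun u w =>
    (hS2.isSymmSndFDerivAt (by simp)).eq u w
  change divergence _ p = 0
  rw [divergence_congr heq, divergence_sub hA.differentiableAt hB.differentiableAt, divergence_eq,
    divergence_eq, hA.fderiv, hB.fderiv, map_add]
  have e1 : (fderiv ℝ (fderiv ℝ S) p).flip (killing c J p)
      = fderiv ℝ (fderiv ℝ S) p (killing c J p) := by
    refine ContinuousLinearMap.ext fun u => ?_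
    rw [ContinuousLinearMap.flip_apply, hsym]
  have e2 : traceCLM Vec ((fderiv ℝ S p).comp (killingLin J))
      = traceCLM Vec ((killingLin J).comp (fderiv ℝ S p)) :=
    LinearMap.trace_comp_comm' (killingLin J).toLinearMap (fderiv ℝ S p).toLinearMap
  rw [e1, hD0, e2]
  ring

/-- The infinitesimal rotation in the plane of `e_i` and `e_j`. -/
noncomputable def rotation (i j : Fin 3) : E3 →L[ℝ] E3 :=
  (innerSL ℝ (EuclideanSpace.single j (1 : ℝ))).smulRight (EuclideanSpace.single i (1 : ℝ))
    - (innerSL ℝ (EuclideanSpace.single i (1 : ℝ))).smulRight (EuclideanSpace.single j (1 : ℝ))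

lemma inner_rotation (i j : Fin 3) (u v : E3) : ⟪u, rotation i j v⟫ = u i * v j - u j * v i := by
  have h1 : ∀ (k : Fin 3) (w : E3), ⟪w, EuclideanSpace.single k (1 : ℝ)⟫ = w k := fun k w => by
    rw [EuclideanSpace.inner_single_right]
    simp
  simp only [rotation, _root_.sub_apply, ContinuousLinearMap.smulRight_apply, innerSL_apply_apply,
    inner_sub_right, real_inner_smul_right, h1, real_inner_comm v]
  ring

lemma rotation_antisymm (i j : Fin 3) (u v : E3) : ⟪rotation i j u, v⟫ = -⟪u, rotation i j v⟫ := by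
  rw [real_inner_comm, inner_rotation, inner_rotation]
  ring

/-- Lagrange's identity `|x × w|² = |x|² |w|² - ⟪x, w⟫²` on the unit sphere: the three rotation
fields recover the full angular gradient. -/
lemma norm_tang_sq_eq_rotation (x : S2) (w : E3) :
    ‖tang (x : E3) w‖ ^ 2 = ⟪w, rotation 0 1 x⟫ ^ 2 + ⟪w, rotation 1 2 x⟫ ^ 2
      + ⟪w, rotation 0 2 x⟫ ^ 2 := by
  have hx : ‖(x : E3)‖ = 1 := S2.norm_coe x
  have hx0 : (x : E3) ≠ 0 := norm_ne_zero_iff.1 (by rw [hx]; exact one_ne_zero)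
  have hr : rad (x : E3) = x := by rw [rad, hx, inv_one, one_smul]
  have h1 : (x : E3) 0 ^ 2 + (x : E3) 1 ^ 2 + (x : E3) 2 ^ 2 = 1 := by
    have := EuclideanSpace.norm_sq_eq (x : E3)
    rw [hx, Fin.sum_univ_three] at this
    simpa using this.symm
  rw [norm_tang_sq hx0, hr, inner_rotation, inner_rotation, inner_rotation,
    EuclideanSpace.norm_sq_eq, Fin.sum_univ_three, PiLp.inner_apply, Fin.sum_univ_three]
  simp
  linear_combination (w.ofLp 0 ^ 2 + w.ofLp 1 ^ 2 + w.ofLp 2 ^ 2) * (-h1)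

/-! ### The redshift estimate near the horizon -/

/-- Energy through a segment of the outgoing null hypersurface `τ = s`. -/
noncomputable def nullEnergy (r₀ r₁ : ℝ) (ξ : Pt → Vec) (s : ℝ) : ℝ≥0∞ :=
  ∫⁻ z in Icc r₀ r₁ ×ˢ (univ : Set S2), ENNReal.ofReal (‖(ξ (pt s z.1 z.2)).2‖ ^ 2) ∂cylMeasure

/-- Energy of tangential derivatives through a segment of `r = r₀`. -/
noncomputable def tangentialEnergy (r₀ : ℝ) (ξ : Pt → Vec) (a b : ℝ) : ℝ≥0∞ :=
  ∫⁻ z in Icc a b ×ˢ (univ : Set S2), ENNReal.ofReal ((ξ (pt z.1 r₀ z.2)).1 ^ 2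
    + ‖tang (pt z.1 r₀ z.2).2 (ξ (pt z.1 r₀ z.2)).2‖ ^ 2) ∂cylMeasure

/-- Full energy through a segment of `r = r₁`. -/
noncomputable def sliceEnergy (r₁ : ℝ) (ξ : Pt → Vec) (a b : ℝ) : ℝ≥0∞ :=
  ∫⁻ z in Icc a b ×ˢ (univ : Set S2), ENNReal.ofReal ((ξ (pt z.1 r₁ z.2)).1 ^ 2
    + ‖(ξ (pt z.1 r₁ z.2)).2‖ ^ 2) ∂cylMeasure

/-- A multiplier with positive bulk term near the horizon. -/
structure IsRedshiftCollar (Λ m ρ d l r₁ : ℝ) : Prop where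
  horizon : IsHorizonRadius Λ m ρ
  lt : ρ < r₁
  le_add_one : r₁ ≤ ρ + 1
  d_pos : 0 < d
  l_pos : 0 < l
  l_mul : l * d * ρ ^ 2 = 8
  d_le : ∀ r ∈ Icc ρ r₁, d ≤ 2 * Λ * r / 3 - 2 * m / r ^ 2
  F_le : ∀ r ∈ Icc ρ r₁, (1 + l) * F Λ m r ≤ 1

/-- Take `d = F'(ρ)`, which stays a lower bound since `F'` increases with `r`. Fixing `l` by `l d ρ²
= 8` makes it large enough to absorb the mixed term of the bulk, and the collar is then made thin so
that `(1 + l) F ≤ 1`, as `F` vanishes on the horizon. -/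
lemma IsHorizonRadius.exists_collar {Λ m ρ : ℝ} (h : IsHorizonRadius Λ m ρ) :
    ∃ d l r₁, IsRedshiftCollar Λ m ρ d l r₁ := by
  set d := 2 * Λ * ρ / 3 - 2 * m / ρ ^ 2 with hd
  have hd0 : 0 < d := h.deriv_pos le_rfl
  have hρ := h.pos
  set l := 8 / (d * ρ ^ 2) with hl
  have hl0 : 0 < l := by positivity
  have hev : ∀ᶠ r in 𝓝 ρ, (1 + l) * F Λ m r < 1 := by
    have hc : ContinuousAt (fun r => (1 + l) * F Λ m r) ρ :=
      continuousAt_const.mul (continuousAt_F Λ m hρ.ne')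
    refine hc.eventually_lt continuousAt_const ?_
    rw [h.root, mul_zero]
    exact one_pos
  obtain ⟨ε, hε, hball⟩ := Metric.eventually_nhds_iff.1 hev
  refine ⟨d, l, ρ + min (ε / 2) 1, h, ?_, ?_, hd0, hl0, ?_, fun r hr => ?_, fun r hr => ?_⟩
  · have : 0 < min (ε / 2) 1 := lt_min (by positivity) one_pos
    linarith
  · linarith [min_le_right (ε / 2) 1]
  · rw [hl]
    field_simp
  · have h1 : 2 * m / r ^ 2 ≤ 2 * m / ρ ^ 2 := by
      have := h.mass_pos
      have := hr.1
      gcongr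
    have h2 : Λ * ρ ≤ Λ * r := mul_le_mul_of_nonneg_left hr.1 h.lambda_pos.le
    rw [hd]
    linarith
  · refine (hball ?_).le
    rw [Real.dist_eq, abs_of_nonneg (by linarith [hr.1])]
    linarith [hr.2, min_le_left (ε / 2) 1]

namespace IsRedshiftCollar

variable {Λ m ρ d l r₁ : ℝ}

lemma F_bounds (h : IsRedshiftCollar Λ m ρ d l r₁) {r : ℝ} (hr : r ∈ Icc ρ r₁) :
    0 ≤ F Λ m r ∧ F Λ m r ≤ 1 ∧ l * F Λ m r ≤ 1 ∧ (1 + l * (r₁ - r)) * F Λ m r ≤ 1 := by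
  have h0 := h.horizon.F_nonneg hr.1
  have h1 := h.F_le r hr
  have h2 := mul_nonneg h.l_pos.le h0
  have h3 : r₁ - r ≤ 1 := by linarith [hr.1, h.le_add_one]
  have h4 := mul_le_mul_of_nonneg_left h3 h2
  refine ⟨h0, by linarith, by linarith, by linarith⟩

/-- Complete the square in the `τ` derivative. The remaining radial coefficient is `F (2 β - α F) /
4`, and `α F ≤ 1 ≤ β` in the collar. -/
lemma spaceDensity_nonneg (h : IsRedshiftCollar Λ m ρ d l r₁) {p : Pt} (hp : ‖p.2‖ ∈ Icc ρ r₁)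
    (ξ : Vec) :
    0 ≤ spaceDensity Λ m (1 + l * (r₁ - ‖p.2‖)) (1 + (r₁ - ‖p.2‖)) p ξ := by
  obtain ⟨h0, -, -, h3⟩ := h.F_bounds hp
  have hα : 0 ≤ 1 + l * (r₁ - ‖p.2‖) := by
    have := mul_nonneg h.l_pos.le (sub_nonneg.2 hp.2)
    linarith
  have hβ : 1 ≤ 1 + (r₁ - ‖p.2‖) := by linarith [hp.2]
  unfold spaceDensity
  generalize 1 + l * (r₁ - ‖p.2‖) = α at *
  generalize 1 + (r₁ - ‖p.2‖) = β at *
  generalize F Λ m ‖p.2‖ = f at *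
  have e : α * ξ.1 ^ 2 + α * f * ⟪ξ.2, rad p.2⟫ * ξ.1 + β * f / 2 * ⟪ξ.2, rad p.2⟫ ^ 2
      + β / 2 * ‖tang p.2 ξ.2‖ ^ 2 = α * (ξ.1 + f / 2 * ⟪ξ.2, rad p.2⟫) ^ 2
      + (f * (2 * β - α * f) / 4) * ⟪ξ.2, rad p.2⟫ ^ 2 + β / 2 * ‖tang p.2 ξ.2‖ ^ 2 := by ring
  rw [e]
  have h4 : 0 ≤ 2 * β - α * f := by linarith
  positivity

lemma le_nullDensity (h : IsRedshiftCollar Λ m ρ d l r₁) {p : Pt} (hp : ‖p.2‖ ∈ Icc ρ r₁)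
    (ξ : Vec) :
    ‖ξ.2‖ ^ 2 / 2 ≤ nullDensity Λ m (1 + l * (r₁ - ‖p.2‖)) (1 + (r₁ - ‖p.2‖)) p ξ := by
  obtain ⟨-, -, -, h3⟩ := h.F_bounds hp
  have hp0 : p.2 ≠ 0 := norm_ne_zero_iff.1 (h.horizon.pos.trans_le hp.1).ne'
  have hα : 1 ≤ 1 + l * (r₁ - ‖p.2‖) := by
    have := mul_nonneg h.l_pos.le (sub_nonneg.2 hp.2)
    linarith
  have hβ : 1 ≤ 1 + (r₁ - ‖p.2‖) := by linarith [hp.2]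
  have ht := norm_tang_sq hp0 ξ.2
  have h1 := mul_le_mul_of_nonneg_right hα (sq_nonneg ‖tang p.2 ξ.2‖)
  have h2 : 1 / 2 ≤ 1 + (r₁ - ‖p.2‖) - (1 + l * (r₁ - ‖p.2‖)) * F Λ m ‖p.2‖ / 2 := by linarith
  have h4 := mul_le_mul_of_nonneg_right h2 (sq_nonneg ⟪ξ.2, rad p.2⟫)
  unfold nullDensity
  linarith

/-- Radial and angular coefficients are kept apart because the bulk term dominates them with
different constants, which determine the two entries of `rate`. -/
lemma nullDensity_le_aux (h : IsRedshiftCollar Λ m ρ d l r₁) {p : Pt} (hp : ‖p.2‖ ∈ Icc ρ r₁)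
    (ξ : Vec) :
    nullDensity Λ m (1 + l * (r₁ - ‖p.2‖)) (1 + (r₁ - ‖p.2‖)) p ξ
      ≤ 2 * ⟪ξ.2, rad p.2⟫ ^ 2 + (1 + l) / 2 * ‖tang p.2 ξ.2‖ ^ 2 := by
  obtain ⟨h0, -, -, -⟩ := h.F_bounds hp
  have hs : r₁ - ‖p.2‖ ≤ 1 := by linarith [hp.1, h.le_add_one]
  have hls := mul_le_mul_of_nonneg_left hs h.l_pos.le
  have hα : 0 ≤ 1 + l * (r₁ - ‖p.2‖) := by
    have := mul_nonneg h.l_pos.le (sub_nonneg.2 hp.2)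
    linarith
  have h2 : 1 + (r₁ - ‖p.2‖) - (1 + l * (r₁ - ‖p.2‖)) * F Λ m ‖p.2‖ / 2 ≤ 2 := by
    have := mul_nonneg hα h0
    linarith
  have h3 : (1 + l * (r₁ - ‖p.2‖)) / 2 ≤ (1 + l) / 2 := by linarith
  unfold nullDensity
  exact add_le_add (mul_le_mul_of_nonneg_right h2 (sq_nonneg _))
    (mul_le_mul_of_nonneg_right h3 (sq_nonneg _))

lemma nullDensity_le (h : IsRedshiftCollar Λ m ρ d l r₁) {p : Pt} (hp : ‖p.2‖ ∈ Icc ρ r₁)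
    (ξ : Vec) :
    nullDensity Λ m (1 + l * (r₁ - ‖p.2‖)) (1 + (r₁ - ‖p.2‖)) p ξ ≤ (2 + l) * ‖ξ.2‖ ^ 2 := by
  have hp0 : p.2 ≠ 0 := norm_ne_zero_iff.1 (h.horizon.pos.trans_le hp.1).ne'
  have ht := norm_tang_sq hp0 ξ.2
  have h1 := h.nullDensity_le_aux hp ξ
  have h2 := mul_nonneg h.l_pos.le (sq_nonneg ⟪ξ.2, rad p.2⟫)
  have h3 := mul_nonneg h.l_pos.le (sq_nonneg ‖tang p.2 ξ.2‖)
  have h4 := sq_nonneg ‖tang p.2 ξ.2‖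
  obtain e : ‖ξ.2‖ ^ 2 = ‖tang p.2 ξ.2‖ ^ 2 + ⟪ξ.2, rad p.2⟫ ^ 2 := by linarith
  rw [e]
  linarith

/-- The rate of decay of the energy in the collar. -/
noncomputable def rate (d l : ℝ) : ℝ := min (d / 8) (1 / (1 + l))

lemma rate_pos (h : IsRedshiftCollar Λ m ρ d l r₁) : 0 < rate d l := by
  have := h.d_pos
  have := h.l_pos
  exact lt_min (by positivity) (by positivity)

/-- Completing the square in the `τ` derivative costs `β² / (l r²) ≤ β d / 4`, by `l d ρ² = 8` and
`β ≤ 2`, while the redshift term supplies `β F' / 2 ≥ β d / 2`. This leaves `d / 4` on the radial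
square and `1 / 2` on the angular one, which pay for `rate` times the null density. -/
lemma bulkDensity_le (h : IsRedshiftCollar Λ m ρ d l r₁) {p : Pt} (hp : ‖p.2‖ ∈ Icc ρ r₁)
    (ξ : Vec) :
    bulkDensity Λ m (-l) (1 + (r₁ - ‖p.2‖)) (-1) p ξ
      + rate d l * nullDensity Λ m (1 + l * (r₁ - ‖p.2‖)) (1 + (r₁ - ‖p.2‖)) p ξ ≤ 0 := by
  obtain ⟨hF0, -, hlF, -⟩ := h.F_bounds hp
  have hr : 0 < ‖p.2‖ := h.horizon.pos.trans_le hp.1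
  have hd := h.d_le _ hp
  have hl := h.l_pos
  have hd0 := h.d_pos
  have hnull := h.nullDensity_le_aux hp ξ
  have hβ1 : 1 ≤ 1 + (r₁ - ‖p.2‖) := by linarith [hp.2]
  have hβ2 : 1 + (r₁ - ‖p.2‖) ≤ 2 := by linarith [hp.1, h.le_add_one]
  have hlr : 8 ≤ l * d * ‖p.2‖ ^ 2 := by
    rw [← h.l_mul]
    have := h.horizon.pos
    have := hp.1
    gcongr
  have hb1 : rate d l ≤ d / 8 := min_le_left _ _
  have hb2 : rate d l * (1 + l) ≤ 1 := by
    have := min_le_right (d / 8) (1 / (1 + l))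
    rwa [le_div_iff₀ (by positivity)] at this
  have hb0 := h.rate_pos
  unfold bulkDensity
  generalize nullDensity Λ m (1 + l * (r₁ - ‖p.2‖)) (1 + (r₁ - ‖p.2‖)) p ξ = N at *
  generalize 1 + (r₁ - ‖p.2‖) = β at *
  generalize 2 * Λ * ‖p.2‖ / 3 - 2 * m / ‖p.2‖ ^ 2 = D at *
  generalize F Λ m ‖p.2‖ = f at *
  generalize rate d l = k at *
  generalize ‖p.2‖ = r at *
  have hT := sq_nonneg ‖tang p.2 ξ.2‖
  generalize ‖tang p.2 ξ.2‖ ^ 2 = T at *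
  generalize ⟪ξ.2, rad p.2⟫ = x at *
  generalize ξ.1 = s at *
  have e : -l * s ^ 2 + (-l * f - 2 * β / r) * x * s + (-1 * f / 2 - β / 2 * D - β * f / r) * x ^ 2
      + -1 / 2 * T = -(l * (s + (l * f + 2 * β / r) / (2 * l) * x) ^ 2)
      - (f / 2 + β * D / 2 - l * f ^ 2 / 4 - β ^ 2 / (l * r ^ 2)) * x ^ 2 - T / 2 := by
    field_simp
    ring
  rw [e]
  have h1 : 0 ≤ l * (s + (l * f + 2 * β / r) / (2 * l) * x) ^ 2 := by positivity
  have h2 : β ^ 2 / (l * r ^ 2) ≤ β * d / 4 := by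
    rw [div_le_iff₀ (by positivity)]
    have h3 := mul_le_mul_of_nonneg_left hlr (show 0 ≤ β by linarith)
    nlinarith
  have h3 : β * d ≤ β * D := mul_le_mul_of_nonneg_left hd (by linarith)
  have h4 : d ≤ β * d := by nlinarith
  have h5 : l * f ^ 2 / 4 ≤ f / 2 := by nlinarith
  have h6 : d / 4 ≤ f / 2 + β * D / 2 - l * f ^ 2 / 4 - β ^ 2 / (l * r ^ 2) := by linarith
  have h7 := mul_le_mul_of_nonneg_right h6 (sq_nonneg x)
  have h8 := mul_le_mul_of_nonneg_left hnull hb0.le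
  have h9 := mul_le_mul_of_nonneg_right hb1 (sq_nonneg x)
  have h10 := mul_le_mul_of_nonneg_right hb2 hT
  linarith

/-- The redshift estimate for the energy on the collar, with decay rate `k ≤ rate`. -/
theorem energy_le (h : IsRedshiftCollar Λ m ρ d l r₁) {k : ℝ} (hk0 : 0 ≤ k) (hk : k ≤ rate d l)
    {ψ : Pt → ℝ} (hψ : ∀ p : Pt, ρ ≤ ‖p.2‖ → ContDiffAt ℝ ∞ ψ p ∧ box Λ m ψ p = 0) {s t : ℝ}
    (hst : s ≤ t) :
    (∫⁻ z in Icc s t ×ˢ univ, (let p := pt z.1 r₁ z.2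
        ENNReal.ofReal (r₁ ^ 2 * (Real.exp (k * (z.1 - t)) * spaceDensity Λ m 1 1 p (diff ψ p))))
          ∂cylMeasure) + ENNReal.ofReal (ρ ^ 2 / 2) * nullEnergy ρ r₁ (diff ψ) t ≤
    ENNReal.ofReal (ρ ^ 2 * (1 + l)) * tangentialEnergy ρ (diff ψ) s t
      + ENNReal.ofReal (r₁ ^ 2 * (2 + l) * Real.exp (-(k * (t - s))))
        * nullEnergy ρ r₁ (diff ψ) s := by
  have hρ := h.horizon.pos
  have hl := h.l_pos
  have hr₁ : 0 < r₁ := hρ.trans h.lt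
  -- The weight is `1` at `τ = t` and `exp (-k (t - s))` at `τ = s`. Its derivative contributes `k`
  -- times the null density, which the bulk term absorbs for `k ≤ rate`.
  set w : Pt → ℝ := fun p => Real.exp (k * (p.1 - t)) with hw
  have hwd : ∀ p : Pt, HasFDerivAt w (Real.exp (k * (p.1 - t)) •
      (k • ContinuousLinearMap.fst ℝ ℝ E3)) p := fun p =>
    (((ContinuousLinearMap.fst ℝ ℝ E3).hasFDerivAt.sub_const t).const_mul k).exp
  have hmain := weighted_energy_le (Λ := Λ) (m := m) (α := fun r => 1 + l * (r₁ - r))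
    (β := fun r => 1 + (r₁ - r)) (α' := fun _ => -l) (β' := fun _ => -1) (ψ := ψ) (w := w) hst hρ
    h.lt.le (fun p hp => hψ p hp.1)
    (fun r _ => ⟨by fun_prop, by
      simpa using (((hasDerivAt_id r).const_sub r₁).const_mul l).const_add 1⟩)
    (fun r _ => ⟨by fun_prop, by simpa using ((hasDerivAt_id r).const_sub r₁).const_add 1⟩)
    (fun p _ _ => by simp only [hw]; fun_prop) (fun p => (Real.exp_pos _).le)
    (fun p hp ξ => h.spaceDensity_nonneg hp ξ)
    (fun p hp ξ => le_trans (by positivity) (h.le_nullDensity hp ξ))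
    (fun p _ hp => by
      have hp0 : p.2 ≠ 0 := norm_ne_zero_iff.1 (hρ.trans_le hp.1).ne'
      rw [(hwd p).fderiv]
      simp only [_root_.smul_apply, ContinuousLinearMap.coe_fst', smul_eq_mul]
      rw [energyField_fst hp0]
      have h1 := h.bulkDensity_le hp (diff ψ p)
      have h2 : 0 ≤ nullDensity Λ m (1 + l * (r₁ - ‖p.2‖)) (1 + (r₁ - ‖p.2‖)) p (diff ψ p) :=
        le_trans (by positivity) (h.le_nullDensity hp _)
      have h3 := mul_le_mul_of_nonneg_right hk h2
      have h4 := (Real.exp_pos (k * (p.1 - t))).le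
      have h5 := mul_nonpos_of_nonneg_of_nonpos h4 (show bulkDensity Λ m (-l) (1 + (r₁ - ‖p.2‖)) (-1)
        p (diff ψ p) + k * nullDensity Λ m (1 + l * (r₁ - ‖p.2‖)) (1 + (r₁ - ‖p.2‖)) p (diff ψ p) ≤ 0
        by linarith)
      simp only [hw]
      linarith)
  have hmemI : ∀ {r : ℝ} (τ : ℝ) (x : S2), r ∈ Icc ρ r₁ → ‖(pt τ r x).2‖ ∈ Icc ρ r₁ :=
    fun τ x hr => by rwa [norm_pt_snd (hρ.le.trans hr.1)]
  refine le_trans (add_le_add ?_ ?_) (hmain.trans (add_le_add ?_ ?_))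
  · refine lintegral_mono fun z => ?_
    simp only [hw, sub_self, mul_zero, add_zero]
    exact le_rfl
  · rw [nullEnergy, ← lintegral_const_mul' _ _ ENNReal.ofReal_ne_top]
    refine setLIntegral_mono' (measurableSet_cyl _ _) fun z hz => ?_
    rw [← ENNReal.ofReal_mul (by positivity)]
    refine ENNReal.ofReal_le_ofReal ?_
    have h1 := h.le_nullDensity (hmemI t z.2 hz.1) (diff ψ (pt t z.1 z.2))
    rw [norm_pt_snd (hρ.le.trans hz.1.1)] at h1
    have hw1 : w (pt t z.1 z.2) = 1 := by simp [hw, pt]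
    have h2 : ρ ^ 2 ≤ z.1 ^ 2 := by
      have := hz.1.1
      gcongr
    rw [hw1, one_mul]
    calc ρ ^ 2 / 2 * ‖(diff ψ (pt t z.1 z.2)).2‖ ^ 2
        = ρ ^ 2 * (‖(diff ψ (pt t z.1 z.2)).2‖ ^ 2 / 2) := by ring
      _ ≤ _ := mul_le_mul h2 h1 (by positivity) (by positivity)
  · rw [tangentialEnergy, ← lintegral_const_mul' _ _ ENNReal.ofReal_ne_top]
    refine setLIntegral_mono' (measurableSet_cyl _ _) fun z hz => ?_
    rw [← ENNReal.ofReal_mul (by positivity)]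
    refine ENNReal.ofReal_le_ofReal ?_
    have hnn := h.spaceDensity_nonneg (hmemI z.1 z.2 ⟨le_rfl, h.lt.le⟩) (diff ψ (pt z.1 ρ z.2))
    rw [norm_pt_snd hρ.le] at hnn
    have hw1 : w (pt z.1 ρ z.2) ≤ 1 := by
      simp only [hw, Real.exp_le_one_iff]
      exact mul_nonpos_of_nonneg_of_nonpos hk0 (sub_nonpos.2 hz.1.2)
    rw [mul_assoc]
    refine mul_le_mul_of_nonneg_left ((mul_le_of_le_one_left hnn hw1).trans ?_) (sq_nonneg _)
    -- On the horizon `F = 0`, so the transversal derivative disappears and only tangential energy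
    -- remains.
    rw [spaceDensity, norm_pt_snd hρ.le, h.horizon.root]
    have hs : r₁ - ρ ≤ 1 := by linarith [h.le_add_one]
    have hls := mul_le_mul_of_nonneg_left hs hl.le
    have h1 : 1 + l * (r₁ - ρ) ≤ 1 + l := by linarith
    have h2 : (1 + (r₁ - ρ)) / 2 ≤ 1 + l := by linarith
    have h3 := mul_le_mul_of_nonneg_right h1 (sq_nonneg (diff ψ (pt z.1 ρ z.2)).1)
    have h4 := mul_le_mul_of_nonneg_right h2
      (sq_nonneg ‖tang (pt z.1 ρ z.2).2 (diff ψ (pt z.1 ρ z.2)).2‖)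
    simp only [mul_zero, zero_mul, zero_div, add_zero]
    linarith
  · rw [nullEnergy, ← lintegral_const_mul' _ _ ENNReal.ofReal_ne_top]
    refine setLIntegral_mono' (measurableSet_cyl _ _) fun z hz => ?_
    rw [← ENNReal.ofReal_mul (by positivity)]
    refine ENNReal.ofReal_le_ofReal ?_
    have h1 := h.nullDensity_le (hmemI s z.2 hz.1) (diff ψ (pt s z.1 z.2))
    have h0 := h.le_nullDensity (hmemI s z.2 hz.1) (diff ψ (pt s z.1 z.2))
    rw [norm_pt_snd (hρ.le.trans hz.1.1)] at h1 h0
    have hw1 : w (pt s z.1 z.2) = Real.exp (-(k * (t - s))) := by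
      simp only [hw, pt]
      congr 1
      ring
    have h2 : z.1 ^ 2 ≤ r₁ ^ 2 := by
      have := hz.1.2
      have := hρ.le.trans hz.1.1
      gcongr
    rw [hw1]
    have hE := (Real.exp_pos (-(k * (t - s)))).le
    calc _ ≤ r₁ ^ 2 * (Real.exp (-(k * (t - s))) * ((2 + l) * ‖(diff ψ (pt s z.1 z.2)).2‖ ^ 2)) :=
          mul_le_mul h2 (mul_le_mul_of_nonneg_left h1 hE)
            (mul_nonneg hE (le_trans (by positivity) h0)) (by positivity)
      _ = _ := by ring

end IsRedshiftCollar

lemma le_ofReal_inv_mul {c : ℝ} (hc : 0 < c) {x y : ℝ≥0∞} (h : ENNReal.ofReal c * x ≤ y) :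
    x ≤ ENNReal.ofReal c⁻¹ * y := by
  refine le_trans (le_of_eq ?_) (mul_le_mul_right h _)
  rw [← mul_assoc, ← ENNReal.ofReal_mul (by positivity), inv_mul_cancel₀ hc.ne', ENNReal.ofReal_one,
    one_mul]

/-- Two instances of the collar inequality: the full rate gives decay of the null energy, and rate
zero, where the weight is constant, gives the energy on `r = r₁`. -/
theorem IsHorizonRadius.exists_near_bound {Λ m ρ : ℝ} (h : IsHorizonRadius Λ m ρ) :
    ∃ r₁ b₀ C : ℝ, ρ < r₁ ∧ 0 < b₀ ∧ 0 < C ∧ ∀ ψ : Pt → ℝ,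
      (∀ p : Pt, ρ ≤ ‖p.2‖ → ContDiffAt ℝ ∞ ψ p ∧ box Λ m ψ p = 0) → ∀ s t : ℝ, s ≤ t →
      nullEnergy ρ r₁ (diff ψ) t ≤ ENNReal.ofReal C * (tangentialEnergy ρ (diff ψ) s t
        + ENNReal.ofReal (Real.exp (-(b₀ * (t - s)))) * nullEnergy ρ r₁ (diff ψ) s) ∧
      sliceEnergy r₁ (diff ψ) s t ≤ ENNReal.ofReal C * (tangentialEnergy ρ (diff ψ) s t
        + nullEnergy ρ r₁ (diff ψ) s) := by
  obtain ⟨d, l, r₁, hc⟩ := h.exists_collar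
  have hρ := h.pos
  have hl := hc.l_pos
  have hr₁ : 0 < r₁ := hρ.trans hc.lt
  have hF := h.F_pos hc.lt
  have hF1 := (hc.F_bounds ⟨hc.lt.le, le_rfl⟩).2.1
  set D := ρ ^ 2 * (1 + l) + r₁ ^ 2 * (2 + l) with hD
  set c₁ := r₁ ^ 2 * (F Λ m r₁ / 8) with hc₁
  have hc₁0 : 0 < c₁ := by positivity
  have hD0 : 0 < D := by positivity
  have hD1 : ρ ^ 2 * (1 + l) ≤ D := le_add_of_nonneg_right (by positivity)
  have hD2 : r₁ ^ 2 * (2 + l) ≤ D := le_add_of_nonneg_left (by positivity)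
  set C := ((ρ ^ 2 / 2)⁻¹ + c₁⁻¹) * D with hC
  refine ⟨r₁, IsRedshiftCollar.rate d l, C, hc.lt, hc.rate_pos, by positivity,
    fun ψ hψ s t hst => ⟨?_, ?_⟩⟩
  · have h1 := le_trans le_add_self (hc.energy_le hc.rate_pos.le le_rfl hψ hst)
    refine (le_ofReal_inv_mul (by positivity) h1).trans ?_
    rw [mul_add (ENNReal.ofReal _), mul_add (ENNReal.ofReal C), ← mul_assoc, ← mul_assoc, ← mul_assoc,
      ← ENNReal.ofReal_mul (by positivity), ← ENNReal.ofReal_mul (by positivity),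
      ← ENNReal.ofReal_mul (by positivity)]
    refine add_le_add (mul_le_mul_left (ENNReal.ofReal_le_ofReal ?_) _)
      (mul_le_mul_left (ENNReal.ofReal_le_ofReal ?_) _)
    · exact mul_le_mul (le_add_of_nonneg_right (by positivity)) hD1 (by positivity) (by positivity)
    · rw [← mul_assoc]
      exact mul_le_mul_of_nonneg_right (mul_le_mul (le_add_of_nonneg_right (by positivity)) hD2
        (by positivity) (by positivity)) (Real.exp_pos _).le
  · have h1 := le_trans le_self_add (hc.energy_le le_rfl hc.rate_pos.le hψ hst)
    have h2 : ENNReal.ofReal c₁ * sliceEnergy r₁ (diff ψ) s t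
        ≤ ENNReal.ofReal (ρ ^ 2 * (1 + l)) * tangentialEnergy ρ (diff ψ) s t
          + ENNReal.ofReal (r₁ ^ 2 * (2 + l) * Real.exp (-(0 * (t - s))))
            * nullEnergy ρ r₁ (diff ψ) s := by
      refine le_trans ?_ h1
      rw [sliceEnergy, ← lintegral_const_mul' _ _ ENNReal.ofReal_ne_top]
      refine lintegral_mono fun z => ?_
      rw [← ENNReal.ofReal_mul hc₁0.le]
      refine ENNReal.ofReal_le_ofReal ?_
      rw [zero_mul, Real.exp_zero, one_mul, hc₁, mul_assoc (r₁ ^ 2)]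
      refine mul_le_mul_of_nonneg_left ?_ (sq_nonneg _)
      have hn : ‖(pt z.1 r₁ z.2).2‖ = r₁ := norm_pt_snd hr₁.le _
      have ht := norm_tang_sq (pt_snd_ne_zero (τ := z.1) hr₁ z.2) (diff ψ (pt z.1 r₁ z.2)).2
      have ht0 := sq_nonneg ‖tang (pt z.1 r₁ z.2).2 (diff ψ (pt z.1 r₁ z.2)).2‖
      rw [spaceDensity, hn]
      generalize F Λ m r₁ = f at *
      generalize ‖tang (pt z.1 r₁ z.2).2 (diff ψ (pt z.1 r₁ z.2)).2‖ ^ 2 = T at *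
      generalize ‖(diff ψ (pt z.1 r₁ z.2)).2‖ ^ 2 = N at *
      generalize ⟪(diff ψ (pt z.1 r₁ z.2)).2, rad (pt z.1 r₁ z.2).2⟫ = x at *
      generalize (diff ψ (pt z.1 r₁ z.2)).1 = σ
      obtain rfl : N = T + x ^ 2 := by linarith
      -- At `r₁` the multiplier is `∂_τ + ∂_r`, and `0 < F ≤ 1` there makes its density coercive
      -- with constant `F / 8`.
      have e : 1 * σ ^ 2 + 1 * f * x * σ + 1 * f / 2 * x ^ 2 + 1 / 2 * T
          - f / 8 * (σ ^ 2 + (T + x ^ 2)) = 3 * f / 8 * (x + 4 / 3 * σ) ^ 2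
            + (1 - 19 / 24 * f) * σ ^ 2 + (1 / 2 - f / 8) * T := by ring
      have h3 : 0 ≤ 1 - 19 / 24 * f := by linarith
      have h4 : 0 ≤ 1 / 2 - f / 8 := by linarith
      have h5 : 0 ≤ 3 * f / 8 * (x + 4 / 3 * σ) ^ 2 + (1 - 19 / 24 * f) * σ ^ 2
        + (1 / 2 - f / 8) * T := by positivity
      linarith
    refine (le_ofReal_inv_mul hc₁0 h2).trans ?_
    rw [zero_mul, neg_zero, Real.exp_zero, mul_one, mul_add (ENNReal.ofReal _),
      mul_add (ENNReal.ofReal C), ← mul_assoc, ← mul_assoc,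
      ← ENNReal.ofReal_mul (by positivity), ← ENNReal.ofReal_mul (by positivity)]
    refine add_le_add (mul_le_mul_left (ENNReal.ofReal_le_ofReal ?_) _)
      (mul_le_mul_left (ENNReal.ofReal_le_ofReal ?_) _)
    · exact mul_le_mul (le_add_of_nonneg_left (by positivity)) hD1 (by positivity) (by positivity)
    · exact mul_le_mul (le_add_of_nonneg_left (by positivity)) hD2 (by positivity) (by positivity)

/-! ### Linearity and measurability -/

section Linear

variable {Λ m : ℝ} {φ χ : Pt → ℝ}

lemma sharp_sub (p : Pt) (ξ η : Vec) : sharp Λ m p (ξ - η) = sharp Λ m p ξ - sharp Λ m p η := by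
  ext1
  · simp only [sharp, Prod.fst_sub, Prod.snd_sub, inner_sub_left]
    ring
  · simp only [sharp, tang, Prod.fst_sub, Prod.snd_sub, inner_sub_left]
    module

lemma diff_sub {p : Pt} (hφ : DifferentiableAt ℝ φ p) (hχ : DifferentiableAt ℝ χ p) :
    diff (fun q => φ q - χ q) p = diff φ p - diff χ p := by
  rw [diff_eq_covector, fderiv_fun_sub hφ hχ, map_sub]
  rfl

lemma IsSmoothSolution.differentiableAt (hφ : IsSmoothSolution Λ m φ) {p : Pt}
    (hp : p ∈ region Λ m) : DifferentiableAt ℝ φ p :=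
  (hφ p hp).1.differentiableAt (by simp)

lemma IsSmoothSolution.diff_sub (hφ : IsSmoothSolution Λ m φ) (hχ : IsSmoothSolution Λ m χ) {p : Pt}
    (hp : p ∈ region Λ m) : diff (fun q => φ q - χ q) p = diff φ p - diff χ p :=
  SdS.diff_sub (hφ.differentiableAt hp) (hχ.differentiableAt hp)

lemma IsSmoothSolution.sub (h : 0 < rc Λ m) (hφ : IsSmoothSolution Λ m φ)
    (hχ : IsSmoothSolution Λ m χ) : IsSmoothSolution Λ m (fun q => φ q - χ q) := by
  intro p hp
  refine ⟨(hφ p hp).1.sub (hχ p hp).1, ?_⟩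
  have hp0 : p.2 ≠ 0 := norm_ne_zero_iff.1 (h.trans_le hp).ne'
  have c1 : ∀ {u : Pt → ℝ}, ContDiffAt ℝ ∞ u p → ContDiffAt ℝ 2 u p := fun hu =>
    hu.of_le (WithTop.coe_le_coe.2 le_top)
  have hd : ∀ {u : Pt → ℝ}, ContDiffAt ℝ ∞ u p →
      DifferentiableAt ℝ (fun q => sharp Λ m q (diff u q)) p := fun hu =>
    (contDiffAt_sharp hp0 (contDiffAt_diff (k := 1) (c1 hu)
      (by norm_num))).differentiableAt one_ne_zero
  have hev : ∀ {u : Pt → ℝ}, ContDiffAt ℝ ∞ u p → ∀ᶠ q in 𝓝 p, DifferentiableAt ℝ u q := fun hu => by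
    filter_upwards [(c1 hu).eventually (by simp)] with q hq using hq.differentiableAt (by norm_num)
  have heq : (fun q => sharp Λ m q (diff (fun q => φ q - χ q) q)) =ᶠ[𝓝 p]
      fun q => sharp Λ m q (diff φ q) - sharp Λ m q (diff χ q) := by
    filter_upwards [hev (hφ p hp).1, hev (hχ p hp).1] with q h1 h2
    rw [SdS.diff_sub h1 h2, sharp_sub]
  change divergence _ p = 0
  rw [divergence_congr heq, divergence_sub (hd (hφ p hp).1) (hd (hχ p hp).1)]
  have h1 : divergence (fun q => sharp Λ m q (diff φ q)) p = 0 := (hφ p hp).2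
  have h2 : divergence (fun q => sharp Λ m q (diff χ q)) p = 0 := (hχ p hp).2
  rw [h1, h2, sub_zero]

lemma IsSmoothSolution.isExteriorSolution (hφ : IsSmoothSolution Λ m φ) :
    IsExteriorSolution Λ m (rc Λ m) φ := fun p hp => hφ p hp.le

lemma IsSmoothSolution.measurable (hφ : IsSmoothSolution Λ m φ) :
    Measurable ((region Λ m).domRestrict φ) := hφ.isFiniteEnergySolution.1

lemma IsSmoothSolution.measurable_diff (hφ : IsSmoothSolution Λ m φ) :
    Measurable ((region Λ m).domRestrict (diff φ)) := hφ.isFiniteEnergySolution.2.1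

end Linear

section Measurability

variable {Λ m : ℝ} {E : Type*} [MeasurableSpace E] {ξ : Pt → E}

lemma pt_mem_region (h : 0 ≤ rc Λ m) {τ r : ℝ} (hr : rc Λ m ≤ r) (x : S2) :
    pt τ r x ∈ region Λ m := by
  change rc Λ m ≤ ‖(pt τ r x).2‖
  rwa [norm_pt_snd (h.trans hr)]

lemma measurable_slice (h : 0 ≤ rc Λ m) (hξ : Measurable ((region Λ m).domRestrict ξ)) {r : ℝ}
    (hr : rc Λ m ≤ r) : Measurable fun z : ℝ × S2 => ξ (pt z.1 r z.2) := by
  have hc : Continuous fun z : ℝ × S2 => pt z.1 r z.2 := by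
    unfold pt
    fun_prop
  exact hξ.comp (hc.measurable.subtype_mk (h := fun z => pt_mem_region h hr z.2))

/-- Replacing `r` by its maximum with the horizon radius keeps the point in the region, where alone
measurability is assumed; on the range of integration nothing changes. -/
lemma measurable_null (h : 0 ≤ rc Λ m) (hξ : Measurable ((region Λ m).domRestrict ξ)) (s : ℝ) :
    Measurable fun z : ℝ × S2 => ξ (pt s (max z.1 (rc Λ m)) z.2) := by
  have hc : Continuous fun z : ℝ × S2 => pt s (max z.1 (rc Λ m)) z.2 := by
    unfold pt
    fun_prop
  exact hξ.comp (hc.measurable.subtype_mk (h := fun z => pt_mem_region h (le_max_right _ _) z.2))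

end Measurability

/-- Stands in for the triangle inequality of squared norms. Additivity of the lower integral needs
measurability of one summand only. -/
lemma lintegral_ofReal_le_two {X : Type*} [MeasurableSpace X] {μ : Measure X} {A B C : X → ℝ}
    (hA : ∀ x, A x ≤ 2 * B x + 2 * C x) (hB : ∀ x, 0 ≤ B x) (hC : ∀ x, 0 ≤ C x)
    (hm : AEMeasurable B μ) :
    ∫⁻ x, ENNReal.ofReal (A x) ∂μ
      ≤ 2 * ∫⁻ x, ENNReal.ofReal (B x) ∂μ + 2 * ∫⁻ x, ENNReal.ofReal (C x) ∂μ := by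
  have h2 : ENNReal.ofReal 2 = 2 := by simp
  calc _ ≤ ∫⁻ x, (2 * ENNReal.ofReal (B x) + 2 * ENNReal.ofReal (C x)) ∂μ := by
        refine lintegral_mono fun x => (ENNReal.ofReal_le_ofReal (hA x)).trans (le_of_eq ?_)
        rw [ENNReal.ofReal_add (by have := hB x; positivity) (by have := hC x; positivity),
          ENNReal.ofReal_mul zero_le_two, ENNReal.ofReal_mul zero_le_two, h2]
    _ = _ := by
        rw [lintegral_add_left' (by fun_prop), lintegral_const_mul' _ _ (by simp),
          lintegral_const_mul' _ _ (by simp)]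

lemma sq_le_two_mul_sq_add (x y : ℝ) : x ^ 2 ≤ 2 * y ^ 2 + 2 * (x - y) ^ 2 := by
  nlinarith [sq_nonneg (x - 2 * y)]

lemma norm_sq_le_two_mul {E : Type*} [SeminormedAddCommGroup E] (x y : E) :
    ‖x‖ ^ 2 ≤ 2 * ‖y‖ ^ 2 + 2 * ‖x - y‖ ^ 2 := by
  have h : ‖x‖ ≤ ‖y‖ + ‖x - y‖ := by
    have := norm_add_le y (x - y)
    rwa [add_sub_cancel] at this
  have h0 := norm_nonneg x
  nlinarith [sq_nonneg (‖y‖ - ‖x - y‖)]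

lemma tang_sub (y u v : E3) : tang y (u - v) = tang y u - tang y v := by
  simp only [tang, inner_sub_left]
  module

lemma measurable_tang_pt {g : ℝ × S2 → E3} (hg : Measurable g) (r : ℝ) :
    Measurable fun z : ℝ × S2 => tang (r • (z.2 : E3)) (g z) := by
  have h1 : Measurable fun z : ℝ × S2 => rad (r • (z.2 : E3)) := by
    unfold rad
    fun_prop
  unfold tang
  exact hg.fun_sub ((hg.inner (𝕜 := ℝ) h1).fun_smul h1)

section Triangle

variable {Λ m : ℝ} {ξ η : Pt → Vec}

lemma nullEnergy_le_two (h : 0 ≤ rc Λ m)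
    (hη : Measurable ((region Λ m).domRestrict η)) (r₁ s : ℝ) :
    nullEnergy (rc Λ m) r₁ ξ s ≤ 2 * nullEnergy (rc Λ m) r₁ η s
      + 2 * nullEnergy (rc Λ m) r₁ (fun p => ξ p - η p) s := by
  refine lintegral_ofReal_le_two (fun z => norm_sq_le_two_mul _ _) (fun z => sq_nonneg _)
    (fun z => sq_nonneg _) ?_
  have h1 := (measurable_null h hη s).snd.norm.pow_const 2
  refine h1.aemeasurable.congr ?_
  refine (ae_restrict_iff' (measurableSet_cyl _ _)).2 (ae_of_all _ fun z hz => ?_)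
  simp only [max_eq_left hz.1.1]

lemma tangentialEnergy_le_two (h : 0 ≤ rc Λ m)
    (hη : Measurable ((region Λ m).domRestrict η)) (a b : ℝ) :
    tangentialEnergy (rc Λ m) ξ a b ≤ 2 * tangentialEnergy (rc Λ m) η a b
      + 2 * tangentialEnergy (rc Λ m) (fun p => ξ p - η p) a b := by
  have hm := measurable_slice h hη le_rfl
  refine lintegral_ofReal_le_two (fun z => ?_) (fun z => by positivity) (fun z => by positivity)
    (Measurable.aemeasurable ?_)
  · have h1 := sq_le_two_mul_sq_add (ξ (pt z.1 (rc Λ m) z.2)).1 (η (pt z.1 (rc Λ m) z.2)).1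
    have h2 := norm_sq_le_two_mul (tang (pt z.1 (rc Λ m) z.2).2 (ξ (pt z.1 (rc Λ m) z.2)).2)
      (tang (pt z.1 (rc Λ m) z.2).2 (η (pt z.1 (rc Λ m) z.2)).2)
    rw [← tang_sub] at h2
    simp only [Prod.fst_sub, Prod.snd_sub]
    linarith
  · exact (hm.fst.pow_const 2).add ((measurable_tang_pt hm.snd _).norm.pow_const 2)

lemma sliceEnergy_le_two (h : 0 ≤ rc Λ m)
    (hη : Measurable ((region Λ m).domRestrict η)) {r : ℝ} (hr : rc Λ m ≤ r) (a b : ℝ) :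
    sliceEnergy r ξ a b ≤ 2 * sliceEnergy r η a b
      + 2 * sliceEnergy r (fun p => ξ p - η p) a b := by
  have hm := measurable_slice h hη hr
  refine lintegral_ofReal_le_two (fun z => ?_) (fun z => by positivity) (fun z => by positivity)
    (Measurable.aemeasurable ?_)
  · have h1 := sq_le_two_mul_sq_add (ξ (pt z.1 r z.2)).1 (η (pt z.1 r z.2)).1
    have h2 := norm_sq_le_two_mul (ξ (pt z.1 r z.2)).2 (η (pt z.1 r z.2)).2
    simp only [Prod.fst_sub, Prod.snd_sub]
    linarith
  · exact (hm.fst.pow_const 2).add (hm.snd.norm.pow_const 2)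

end Triangle

/-! ### First order Sobolev norms on the cylinder -/

/-- The squared length of a value and a gradient on the cylinder. -/
noncomputable def jetSq (v : ℝ × ℝ × E3) : ℝ := v.1 ^ 2 + v.2.1 ^ 2 + ‖v.2.2‖ ^ 2

lemma jetSq_nonneg (v : ℝ × ℝ × E3) : 0 ≤ jetSq v := by
  unfold jetSq
  positivity

lemma continuous_jetSq : Continuous jetSq := by
  unfold jetSq
  fun_prop

lemma jetSq_le_two_mul (v w : ℝ × ℝ × E3) : jetSq v ≤ 2 * jetSq w + 2 * jetSq (v - w) := by
  have h1 := sq_le_two_mul_sq_add v.1 w.1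
  have h2 := sq_le_two_mul_sq_add v.2.1 w.2.1
  have h3 := norm_sq_le_two_mul v.2.2 w.2.2
  simp only [jetSq, Prod.fst_sub, Prod.snd_sub]
  linarith

lemma norm_sq_le_jetSq (v : ℝ × ℝ × E3) : ‖v‖ ^ 2 ≤ jetSq v := by
  have h : ‖v‖ = max ‖v.1‖ (max ‖v.2.1‖ ‖v.2.2‖) := rfl
  have h1 : 0 ≤ v.1 ^ 2 := sq_nonneg _
  have h2 : 0 ≤ v.2.1 ^ 2 := sq_nonneg _
  have h3 : 0 ≤ ‖v.2.2‖ ^ 2 := sq_nonneg _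
  unfold jetSq
  rcases max_choice ‖v.1‖ (max ‖v.2.1‖ ‖v.2.2‖) with hx | hx
  · rw [h, hx, Real.norm_eq_abs, sq_abs]
    linarith
  · rw [h, hx]
    rcases max_choice ‖v.2.1‖ ‖v.2.2‖ with hx | hx
    · rw [hx, Real.norm_eq_abs, sq_abs]
      linarith
    · rw [hx]
      linarith

/-- The squared first order Sobolev norm on `[a, b] × 𝕊²`. -/
noncomputable def cylNorm (a b : ℝ) (u : ℝ × S2 → ℝ × ℝ × E3) : ℝ≥0∞ :=
  ∫⁻ z in Icc a b ×ˢ (univ : Set S2), ENNReal.ofReal (jetSq (u z)) ∂cylMeasure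

lemma cylNorm_mono {a b a' b' : ℝ} (ha : a' ≤ a) (hb : b ≤ b') (u : ℝ × S2 → ℝ × ℝ × E3) :
    cylNorm a b u ≤ cylNorm a' b' u :=
  lintegral_mono_set (prod_mono (Icc_subset_Icc ha hb) le_rfl)

lemma cylNorm_le_two {a b : ℝ} (u : ℝ × S2 → ℝ × ℝ × E3) {w : ℝ × S2 → ℝ × ℝ × E3}
    (hw : Measurable w) :
    cylNorm a b u ≤ 2 * cylNorm a b w + 2 * cylNorm a b (fun z => u z - w z) :=
  lintegral_ofReal_le_two (fun _ => jetSq_le_two_mul _ _) (fun _ => jetSq_nonneg _)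
    (fun _ => jetSq_nonneg _) (continuous_jetSq.measurable.comp hw).aemeasurable

lemma cylNorm_sub_comm (a b : ℝ) (u w : ℝ × S2 → ℝ × ℝ × E3) :
    cylNorm a b (fun z => u z - w z) = cylNorm a b (fun z => w z - u z) := by
  unfold cylNorm
  congr 1 with z
  simp only [jetSq, Prod.fst_sub, Prod.snd_sub]
  rw [norm_sub_rev, sub_sq_comm (u z).1, sub_sq_comm (u z).2.1]

lemma cylNorm_sub_le {a b : ℝ} {u v w : ℝ × S2 → ℝ × ℝ × E3} (hu : Measurable u)
    (hv : Measurable v) :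
    cylNorm a b (fun z => u z - w z)
      ≤ 2 * cylNorm a b (fun z => u z - v z) + 2 * cylNorm a b (fun z => v z - w z) := by
  have := cylNorm_le_two (a := a) (b := b) (fun z => u z - w z) (hu.fun_sub hv)
  simpa using this

lemma eLpNorm_le_of_cylNorm_le {a b : ℝ} {u : ℝ × S2 → ℝ × ℝ × E3} {c : ℝ≥0∞}
    (h : cylNorm a b u ≤ c ^ 2) :
    eLpNorm u 2 (cylMeasure.restrict (Icc a b ×ˢ univ)) ≤ c := by
  have h1 : ∫⁻ z in Icc a b ×ˢ (univ : Set S2), ‖u z‖ₑ ^ (2 : ℝ) ∂cylMeasure ≤ c ^ (2 : ℝ) := by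
    rw [ENNReal.rpow_two]
    refine le_trans (lintegral_mono fun z => ?_) h
    rw [ENNReal.rpow_two, ← ofReal_norm, ← ENNReal.ofReal_pow (norm_nonneg _)]
    exact ENNReal.ofReal_le_ofReal (norm_sq_le_jetSq _)
  rw [eLpNorm_eq_lintegral_rpow_enorm_toReal two_ne_zero ENNReal.ofNat_ne_top,
    ENNReal.toReal_ofNat]
  refine (ENNReal.rpow_le_rpow h1 (by norm_num)).trans (le_of_eq ?_)
  rw [← ENNReal.rpow_mul]
  norm_num

lemma iUnion_cyl : ⋃ n : ℕ, Icc (-(n : ℝ)) n ×ˢ (univ : Set S2) = univ := by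
  refine eq_univ_of_forall fun z => mem_iUnion.2 ?_
  obtain ⟨n, hn⟩ := exists_nat_ge |z.1|
  exact ⟨n, abs_le.1 hn, mem_univ _⟩

/-- Completeness of the local first order Sobolev spaces. -/
theorem exists_cylNorm_limit {u : ℝ → ℝ × S2 → ℝ × ℝ × E3} {r₁ : ℝ}
    (hu : ∀ r, r₁ ≤ r → Measurable (u r))
    (hc : ∀ a b : ℝ, ∀ ε : ℝ≥0∞, 0 < ε → ∃ R, ∀ r s, R ≤ r → R ≤ s →
      cylNorm a b (fun z => u r z - u s z) ≤ ε) :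
    ∃ w : ℝ × S2 → ℝ × ℝ × E3, Measurable w ∧
      ∀ a b : ℝ, Tendsto (fun r => cylNorm a b (fun z => u r z - w z)) atTop (𝓝 0) := by
  -- Summable tolerances: a subsequence with Cauchy differences below them converges almost
  -- everywhere.
  obtain ⟨B, hB0, hB⟩ := ENNReal.exists_pos_sum_of_countable' (one_ne_zero : (1 : ℝ≥0∞) ≠ 0) ℕ
  choose c hc0 hcB using fun n => exists_between (hB0 n)
  choose R hR using fun n : ℕ => hc (-(n : ℝ)) n (c n ^ 2) (pos_iff_ne_zero.2 (pow_ne_zero 2 (hc0 n).ne'))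
  -- The running maximum of these thresholds gives radii that lie beyond every earlier `R N` and
  -- tend to infinity.
  set R' : ℕ → ℝ := fun n => max (R n) n with hR'
  set rs : ℕ → ℝ := fun n => max r₁ (partialSups R' n) with hrs
  have hRs : ∀ N n, N ≤ n → R N ≤ rs n := fun N n hn =>
    (le_max_left (R N) N).trans ((le_partialSups_of_le R' hn).trans (le_max_right _ _))
  have hsT : Tendsto rs atTop atTop :=
    tendsto_atTop_mono (fun n => (le_max_right (R n) n).trans
      ((le_partialSups_of_le R' le_rfl).trans (le_max_right _ _))) tendsto_natCast_atTop_atTop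
  have hum : ∀ n, Measurable (u (rs n)) := fun n => hu _ (le_max_left _ _)
  have hae : ∀ᵐ z ∂cylMeasure, ∃ l, Tendsto (fun n => u (rs n) z) atTop (𝓝 l) := by
    rw [← Measure.restrict_univ (μ := cylMeasure), ← iUnion_cyl, ae_restrict_iUnion_iff]
    intro M
    have h1 : ∑' i, B (i + M) ≠ ⊤ :=
      ((ENNReal.tsum_comp_le_tsum_of_injective (add_left_injective M) B).trans_lt
        (hB.trans ENNReal.one_lt_top)).ne
    -- On `[-M, M]` the Cauchy bounds hold only from index `M` on, hence the shift.
    have h2 := Lp.ae_tendsto_of_cauchy_eLpNorm (p := 2)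
      (μ := cylMeasure.restrict (Icc (-(M : ℝ)) M ×ˢ (univ : Set S2)))
      (f := fun n => u (rs (n + M))) (fun n => (hum _).aestronglyMeasurable) (by norm_num) h1
      fun N n k hn hk => by
        refine (eLpNorm_le_of_cylNorm_le ?_).trans_lt (hcB (N + M))
        have h3 : ((M : ℕ) : ℝ) ≤ ((N + M : ℕ) : ℝ) := by exact_mod_cast Nat.le_add_left _ _
        exact (cylNorm_mono (neg_le_neg h3) h3 _).trans
          (hR _ _ _ (hRs _ _ (by omega)) (hRs _ _ (by omega)))
    filter_upwards [h2] with z hz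
    obtain ⟨l, hl⟩ := hz
    exact ⟨l, (tendsto_add_atTop_iff_nat M).1 hl⟩
  obtain ⟨w, hw, hwl⟩ := measurable_limit_of_tendsto_metrizable_ae
    (fun n => (hum n).aemeasurable) hae
  refine ⟨w, hw, fun a b => ENNReal.tendsto_nhds_zero.2 fun ε hε => ?_⟩
  obtain ⟨R₀, hR₀⟩ := hc a b ε hε
  filter_upwards [eventually_ge_atTop (max r₁ R₀)] with r hr
  -- The almost everywhere limit is inserted as a `liminf`, so that Fatou's lemma carries the Cauchy
  -- bound over to all large `r`.
  have h1 : cylNorm a b (fun z => u r z - w z) = ∫⁻ z in Icc a b ×ˢ (univ : Set S2),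
      liminf (fun n => ENNReal.ofReal (jetSq (u r z - u (rs n) z))) atTop ∂cylMeasure := by
    refine lintegral_congr_ae ?_
    filter_upwards [ae_restrict_of_ae hwl] with z hz
    exact ((ENNReal.continuous_ofReal.comp continuous_jetSq).continuousAt.tendsto.comp
      (tendsto_const_nhds.sub hz)).liminf_eq.symm
  rw [h1]
  refine (lintegral_liminf_le fun n => ENNReal.measurable_ofReal.comp
    (continuous_jetSq.measurable.comp
      ((hu r ((le_max_left _ _).trans hr)).sub (hum n)))).trans ?_
  refine liminf_le_of_frequently_le' (Eventually.frequently ?_)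
  filter_upwards [hsT.eventually_ge_atTop R₀] with n hn
  exact hR₀ _ _ ((le_max_right _ _).trans hr) hn

/-- Value and gradient on the cylinder of the restriction to a level set of `r`. -/
noncomputable def jet (ψ : Pt → ℝ) (dψ : Pt → Vec) (r : ℝ) (z : ℝ × S2) : ℝ × ℝ × E3 :=
  (ψ (pt z.1 r z.2), cylGrad dψ r z)

lemma tang_pt {r : ℝ} (hr : 0 < r) (τ : ℝ) (x : S2) (w : E3) :
    tang (pt τ r x).2 w = tang (x : E3) w := by
  have h : rad (x : E3) = x := by simp [rad]
  rw [tang, rad_pt_snd hr, tang, h]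

lemma norm_tang_le (x : S2) (w : E3) : ‖tang (x : E3) w‖ ^ 2 ≤ ‖w‖ ^ 2 := by
  have hx0 : (x : E3) ≠ 0 := norm_ne_zero_iff.1 (by simp)
  rw [norm_tang_sq hx0]
  linarith [sq_nonneg ⟪w, rad (x : E3)⟫]

lemma jet_sub (ψ χ : Pt → ℝ) (dψ dχ : Pt → Vec) (r : ℝ) (z : ℝ × S2) :
    jet ψ dψ r z - jet χ dχ r z = jet (fun p => ψ p - χ p) (fun p => dψ p - dχ p) r z := by
  simp only [jet, cylGrad, Prod.mk_sub_mk, Prod.fst_sub, Prod.snd_sub, tang_sub, smul_sub]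

lemma measurable_jet {Λ m : ℝ} (h : 0 ≤ rc Λ m) {ψ : Pt → ℝ} {dψ : Pt → Vec}
    (hψ : Measurable ((region Λ m).domRestrict ψ)) (hdψ : Measurable ((region Λ m).domRestrict dψ))
    {r : ℝ} (hr : rc Λ m ≤ r) : Measurable (jet ψ dψ r) := by
  have h1 := measurable_slice h hdψ hr
  have h2 := (measurable_tang_pt h1.snd 1).const_smul r
  simp only [one_smul] at h2
  exact (measurable_slice h hψ hr).prodMk (h1.fst.prodMk h2)

/-- The first order energy, including the function itself, on a segment of a level set of `r`. -/
noncomputable def sobolevEnergy (r : ℝ) (ψ : Pt → ℝ) (ξ : Pt → Vec) (a b : ℝ) : ℝ≥0∞ :=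
  ∫⁻ z in Icc a b ×ˢ (univ : Set S2), ENNReal.ofReal (ψ (pt z.1 r z.2) ^ 2
    + (ξ (pt z.1 r z.2)).1 ^ 2 + ‖(ξ (pt z.1 r z.2)).2‖ ^ 2) ∂cylMeasure

lemma sliceEnergy_le_sobolevEnergy (r : ℝ) (ψ : Pt → ℝ) (ξ : Pt → Vec) (a b : ℝ) :
    sliceEnergy r ξ a b ≤ sobolevEnergy r ψ ξ a b := by
  refine lintegral_mono fun z => ENNReal.ofReal_le_ofReal ?_
  linarith [sq_nonneg (ψ (pt z.1 r z.2))]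

lemma cylNorm_jet_le {r : ℝ} (ψ : Pt → ℝ) (ξ : Pt → Vec) (a b : ℝ) :
    cylNorm a b (jet ψ ξ r) ≤ ENNReal.ofReal (1 + r ^ 2) * sobolevEnergy r ψ ξ a b := by
  rw [sobolevEnergy, ← lintegral_const_mul' _ _ ENNReal.ofReal_ne_top]
  refine lintegral_mono fun z => ?_
  rw [← ENNReal.ofReal_mul (by positivity)]
  refine ENNReal.ofReal_le_ofReal ?_
  have h1 := mul_le_mul_of_nonneg_left (norm_tang_le z.2 (ξ (pt z.1 r z.2)).2) (sq_nonneg r)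
  have h2 : 0 ≤ r ^ 2 * ψ (pt z.1 r z.2) ^ 2 := by positivity
  have h3 : 0 ≤ r ^ 2 * (ξ (pt z.1 r z.2)).1 ^ 2 := by positivity
  have h4 := sq_nonneg ‖(ξ (pt z.1 r z.2)).2‖
  simp only [jetSq, jet, cylGrad, norm_smul, mul_pow, Real.norm_eq_abs, sq_abs]
  linarith

lemma sobolevEnergy_le_two {Λ m : ℝ} (h : 0 ≤ rc Λ m) {ψ χ : Pt → ℝ} {ξ η : Pt → Vec}
    (hχ : Measurable ((region Λ m).domRestrict χ)) (hη : Measurable ((region Λ m).domRestrict η))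
    {r : ℝ} (hr : rc Λ m ≤ r) (a b : ℝ) :
    sobolevEnergy r ψ ξ a b ≤ 2 * sobolevEnergy r χ η a b
      + 2 * sobolevEnergy r (fun p => ψ p - χ p) (fun p => ξ p - η p) a b := by
  have hm := measurable_slice h hη hr
  refine lintegral_ofReal_le_two (fun z => ?_) (fun z => by positivity) (fun z => by positivity)
    (Measurable.aemeasurable ?_)
  · have h0 := sq_le_two_mul_sq_add (ψ (pt z.1 r z.2)) (χ (pt z.1 r z.2))
    have h1 := sq_le_two_mul_sq_add (ξ (pt z.1 r z.2)).1 (η (pt z.1 r z.2)).1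
    have h2 := norm_sq_le_two_mul (ξ (pt z.1 r z.2)).2 (η (pt z.1 r z.2)).2
    simp only [Prod.fst_sub, Prod.snd_sub]
    linarith
  · exact (((measurable_slice h hχ hr).pow_const 2).add (hm.fst.pow_const 2)).add
      (hm.snd.norm.pow_const 2)

lemma sobolevEnergy_sub_le {Λ m : ℝ} (h : 0 ≤ rc Λ m) {ψ χ υ : Pt → ℝ} {ξ η ζ : Pt → Vec}
    (hψ : Measurable ((region Λ m).domRestrict fun p => ψ p - χ p))
    (hξ : Measurable ((region Λ m).domRestrict fun p => ξ p - η p))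
    {r : ℝ} (hr : rc Λ m ≤ r) (a b : ℝ) :
    sobolevEnergy r (fun p => ψ p - υ p) (fun p => ξ p - ζ p) a b
      ≤ 2 * sobolevEnergy r (fun p => ψ p - χ p) (fun p => ξ p - η p) a b
        + 2 * sobolevEnergy r (fun p => χ p - υ p) (fun p => η p - ζ p) a b := by
  have := sobolevEnergy_le_two h (ψ := fun p => ψ p - υ p) (ξ := fun p => ξ p - ζ p) hψ hξ hr a b
  simpa using this

lemma sobolevEnergy_sub_comm (r : ℝ) (ψ χ : Pt → ℝ) (ξ η : Pt → Vec) (a b : ℝ) :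
    sobolevEnergy r (fun p => ψ p - χ p) (fun p => ξ p - η p) a b
      = sobolevEnergy r (fun p => χ p - ψ p) (fun p => η p - ξ p) a b := by
  unfold sobolevEnergy
  congr 1 with z
  simp only [Prod.fst_sub, Prod.snd_sub]
  rw [norm_sub_rev, sub_sq_comm, sub_sq_comm (ξ _).1]

/-! ### Smooth solutions near infinity -/

lemma rescaledDensity_pt {r : ℝ} (hr : 0 < r) (τ : ℝ) (x : S2) (ξ : Vec) :
    ξ.1 ^ 2 + ‖r • tang (x : E3) ξ.2‖ ^ 2 ≤ rescaledDensity (pt τ r x) ξ := by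
  rw [rescaledDensity, tang_pt hr, norm_pt_snd hr.le, norm_smul, mul_pow, Real.norm_eq_abs, sq_abs]
  exact le_add_of_nonneg_left (by positivity)

/-- The first order norms on the level sets of `r` are controlled by those on one of them. -/
theorem exists_cylNorm_le {Λ m r₁ : ℝ} (h : IsHorizonRadius Λ m (rc Λ m)) (hr₁ : rc Λ m < r₁) :
    ∃ C : ℝ, 0 ≤ C ∧ ∀ φ, IsSmoothSolution Λ m φ → ∀ r a b : ℝ, r₁ ≤ r →
      cylNorm a b (jet 0 (diff φ) r)
        ≤ ENNReal.ofReal C * sliceEnergy r₁ (diff φ) (a - lag Λ m r₁) b ∧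
      cylNorm a b (jet φ (diff φ) r)
        ≤ ENNReal.ofReal C * sobolevEnergy r₁ φ (diff φ) (a - lag Λ m r₁) b := by
  obtain ⟨C, hC0, hC⟩ := exists_far_bound h hr₁
  have hr0 : 0 < r₁ := h.pos.trans hr₁
  -- `C` bounds the gradient; the rest bounds the function itself, by twice its square at `r₁` plus
  -- twice its change between `r₁` and `r`.
  refine ⟨C + (2 + 2 * (r₁⁻¹ * (r₁⁻¹ * C))), by positivity, fun φ hφ r a b hr => ?_⟩
  have hg : cylNorm a b (jet 0 (diff φ) r)
      ≤ ENNReal.ofReal C * sliceEnergy r₁ (diff φ) (a - lag Λ m r₁) b := by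
    refine le_trans (lintegral_mono fun z => ENNReal.ofReal_le_ofReal ?_)
      (hC φ hφ.isExteriorSolution r a b hr)
    refine le_trans (le_of_eq ?_) (rescaledDensity_pt (hr0.trans_le hr) z.1 z.2 _)
    simp [jetSq, jet, cylGrad]
  refine ⟨hg.trans (mul_le_mul_left (ENNReal.ofReal_le_ofReal
    (le_add_of_nonneg_right (by positivity))) _), ?_⟩
  have hD := lintegral_sq_sub_le h hr₁ hφ.isExteriorSolution (a := a) (b := b)
    (fun R hR => hC φ hφ.isExteriorSolution R a b hR) le_rfl hr
  have hsl := measurable_slice h.pos.le hφ.measurable hr₁.le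
  have hslr := measurable_slice h.pos.le hφ.measurable (hr₁.le.trans hr)
  have hv : ∫⁻ z in Icc a b ×ˢ (univ : Set S2), ENNReal.ofReal (φ (pt z.1 r z.2) ^ 2) ∂cylMeasure
      ≤ 2 * ∫⁻ z in Icc a b ×ˢ (univ : Set S2), ENNReal.ofReal (φ (pt z.1 r₁ z.2) ^ 2) ∂cylMeasure
        + 2 * ∫⁻ z in Icc a b ×ˢ (univ : Set S2),
          ENNReal.ofReal ((φ (pt z.1 r z.2) - φ (pt z.1 r₁ z.2)) ^ 2) ∂cylMeasure :=
    lintegral_ofReal_le_two (fun z => sq_le_two_mul_sq_add _ _) (fun z => sq_nonneg _)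
      (fun z => sq_nonneg _) (hsl.pow_const 2).aemeasurable
  have hs : ∫⁻ z in Icc a b ×ˢ (univ : Set S2), ENNReal.ofReal (φ (pt z.1 r₁ z.2) ^ 2) ∂cylMeasure
      ≤ sobolevEnergy r₁ φ (diff φ) (a - lag Λ m r₁) b := by
    refine (lintegral_mono_set (prod_mono (Icc_subset_Icc_left (sub_le_self _ (lag_nonneg h hr₁)))
      le_rfl)).trans (lintegral_mono fun z => ENNReal.ofReal_le_ofReal ?_)
    have h1 := sq_nonneg (diff φ (pt z.1 r₁ z.2)).1
    have h2 := sq_nonneg ‖(diff φ (pt z.1 r₁ z.2)).2‖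
    linarith
  have he := sliceEnergy_le_sobolevEnergy r₁ φ (diff φ) (a - lag Λ m r₁) b
  have hsplit : cylNorm a b (jet φ (diff φ) r) = cylNorm a b (jet 0 (diff φ) r)
      + ∫⁻ z in Icc a b ×ˢ (univ : Set S2), ENNReal.ofReal (φ (pt z.1 r z.2) ^ 2) ∂cylMeasure := by
    rw [cylNorm, cylNorm, ← lintegral_add_right _ (hslr.pow_const 2).ennreal_ofReal]
    congr 1 with z
    rw [← ENNReal.ofReal_add (jetSq_nonneg _) (sq_nonneg _)]
    congr 1
    simp only [jetSq, jet, Pi.zero_apply]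
    ring
  have h2 : (2 : ℝ≥0∞) = ENNReal.ofReal 2 := by simp
  have hri : 0 ≤ r₁⁻¹ := (inv_pos.2 hr0).le
  rw [hsplit, ENNReal.ofReal_add hC0 (by positivity), ENNReal.ofReal_add (by positivity)
    (by positivity), ENNReal.ofReal_mul (by positivity), ENNReal.ofReal_mul (by positivity),
    ENNReal.ofReal_mul (by positivity), add_mul, add_mul, ← h2]
  refine add_le_add (hg.trans (by gcongr)) (hv.trans (add_le_add (by gcongr) ?_))
  rw [mul_assoc, mul_assoc, mul_assoc]
  refine mul_le_mul_right (hD.trans ?_) _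
  gcongr
  exact he

lemma alongKilling_pt (c : ℝ) (J : E3 →L[ℝ] E3) (φ : Pt → ℝ) (τ r : ℝ) (x : S2) :
    alongKilling c J φ (pt τ r x)
      = (diff φ (pt τ r x)).1 * c + r * ⟪(diff φ (pt τ r x)).2, J x⟫ := by
  rw [alongKilling, ← pair_diff, pair, killing, pt]
  simp [real_inner_smul_right]

/-- The constant is finite since a smooth solution has finite energy on a compact piece of `r = r₁`.
Exterior solutions are the right class because derivatives along Killing fields stay in it. -/
lemma IsExteriorSolution.exists_lintegral_sq_sub_le {Λ m ρ r₁ : ℝ} (h : IsHorizonRadius Λ m ρ)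
    (hr₁ : ρ < r₁) {χ : Pt → ℝ} (hχ : IsExteriorSolution Λ m ρ χ) (a b : ℝ) :
    ∃ M : ℝ≥0∞, M ≠ ⊤ ∧ ∀ R S, r₁ ≤ R → R ≤ S →
      ∫⁻ z in Icc a b ×ˢ (univ : Set S2),
        ENNReal.ofReal ((χ (pt z.1 S z.2) - χ (pt z.1 R z.2)) ^ 2) ∂cylMeasure
      ≤ ENNReal.ofReal R⁻¹ * (ENNReal.ofReal R⁻¹ * M) := by
  obtain ⟨C, hC0, hC⟩ := exists_far_bound h hr₁
  have hr0 : 0 < r₁ := h.pos.trans hr₁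
  refine ⟨_, ?_, fun R S hR hRS => lintegral_sq_sub_le h hr₁ hχ
    (fun R hR => hC χ hχ R a b hR) hR hRS⟩
  refine ENNReal.mul_ne_top ENNReal.ofReal_ne_top ?_
  rw [lintegral_cyl_eq_ofReal (fun z hz => ?_) (fun z hz => by positivity)]
  · exact ENNReal.ofReal_ne_top
  · have hp : ContinuousAt (fun z : ℝ × S2 => pt z.1 r₁ z.2) z := by
      unfold pt
      fun_prop
    have hd : ContinuousAt (fun z : ℝ × S2 => diff χ (pt z.1 r₁ z.2)) z :=
      ContinuousAt.comp' (f := fun z : ℝ × S2 => pt z.1 r₁ z.2) (continuousAt_diff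
        (hχ _ (by rwa [norm_pt_snd hr0.le])).1) hp
    exact ((hd.fst.pow 2).add (hd.snd.norm.pow 2)).continuousWithinAt

/-- Smooth solutions converge in the first order norms along the level sets of `r`. -/
theorem IsSmoothSolution.exists_cylNorm_sub_le {Λ m r₁ : ℝ} (h : IsHorizonRadius Λ m (rc Λ m))
    (hr₁ : rc Λ m < r₁) {φ : Pt → ℝ} (hφ : IsSmoothSolution Λ m φ) (a b : ℝ) :
    ∃ M : ℝ≥0∞, M ≠ ⊤ ∧ ∀ R S, r₁ ≤ R → R ≤ S →
      cylNorm a b (fun z => jet φ (diff φ) S z - jet φ (diff φ) R z)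
      ≤ ENNReal.ofReal R⁻¹ * (ENNReal.ofReal R⁻¹ * M) := by
  have hE := hφ.isExteriorSolution
  have hr0 : 0 < r₁ := h.pos.trans hr₁
  have hT : IsExteriorSolution Λ m (rc Λ m) (SdS.alongKilling 1 0 φ) :=
    hE.alongKilling h.pos.le 1 (J := 0) (by simp)
  have hΩ := fun i j => hE.alongKilling h.pos.le 0 (rotation_antisymm i j)
  obtain ⟨M₁, h₁, H₁⟩ := hE.exists_lintegral_sq_sub_le h hr₁ a b
  obtain ⟨M₂, h₂, H₂⟩ := hT.exists_lintegral_sq_sub_le h hr₁ a b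
  obtain ⟨M₃, h₃, H₃⟩ := (hΩ 0 1).exists_lintegral_sq_sub_le h hr₁ a b
  obtain ⟨M₄, h₄, H₄⟩ := (hΩ 1 2).exists_lintegral_sq_sub_le h hr₁ a b
  obtain ⟨M₅, h₅, H₅⟩ := (hΩ 0 2).exists_lintegral_sq_sub_le h hr₁ a b
  refine ⟨M₁ + (M₂ + (M₃ + (M₄ + M₅))), by simp [h₁, h₂, h₃, h₄, h₅], fun R S hR hRS => ?_⟩
  have hm : ∀ {χ : Pt → ℝ}, IsExteriorSolution Λ m (rc Λ m) χ →
      Measurable fun z : ℝ × S2 => ENNReal.ofReal ((χ (pt z.1 S z.2) - χ (pt z.1 R z.2)) ^ 2) := by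
    intro χ hχ
    have hc : ∀ r, r₁ ≤ r → Continuous fun z : ℝ × S2 => χ (pt z.1 r z.2) := fun r hr =>
      continuous_iff_continuousAt.2 fun z => by
        have hp : ContinuousAt (fun z : ℝ × S2 => pt z.1 r z.2) z := by
          unfold pt
          fun_prop
        exact ContinuousAt.comp' (f := fun z : ℝ × S2 => pt z.1 r z.2) (hχ _ (by
          rw [norm_pt_snd (hr0.le.trans hr)]
          exact hr₁.trans_le hr)).1.continuousAt hp
    exact (ENNReal.continuous_ofReal.comp
      (((hc S (hR.trans hRS)).sub (hc R hR)).pow 2)).measurable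
  -- The components of the cylinder gradient at radius `r` are the values of the derivatives along
  -- `∂_τ` and the three rotations; the factor `r` in the angular part is the length of the rotation
  -- fields. Convergence of gradients thus reduces to convergence of functions.
  have key : cylNorm a b (fun z => jet φ (diff φ) S z - jet φ (diff φ) R z)
      = ∫⁻ z in Icc a b ×ˢ (univ : Set S2),
        (ENNReal.ofReal ((φ (pt z.1 S z.2) - φ (pt z.1 R z.2)) ^ 2)
        + (ENNReal.ofReal ((SdS.alongKilling 1 0 φ (pt z.1 S z.2)
            - SdS.alongKilling 1 0 φ (pt z.1 R z.2)) ^ 2)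
        + (ENNReal.ofReal ((SdS.alongKilling 0 (rotation 0 1) φ (pt z.1 S z.2)
            - SdS.alongKilling 0 (rotation 0 1) φ (pt z.1 R z.2)) ^ 2)
        + (ENNReal.ofReal ((SdS.alongKilling 0 (rotation 1 2) φ (pt z.1 S z.2)
            - SdS.alongKilling 0 (rotation 1 2) φ (pt z.1 R z.2)) ^ 2)
        + ENNReal.ofReal ((SdS.alongKilling 0 (rotation 0 2) φ (pt z.1 S z.2)
            - SdS.alongKilling 0 (rotation 0 2) φ (pt z.1 R z.2)) ^ 2))))) ∂cylMeasure := by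
    refine lintegral_congr fun z => ?_
    rw [← ENNReal.ofReal_add (by positivity) (by positivity),
      ← ENNReal.ofReal_add (by positivity) (by positivity),
      ← ENNReal.ofReal_add (by positivity) (by positivity),
      ← ENNReal.ofReal_add (by positivity) (by positivity)]
    congr 1
    have ht : S • tang (z.2 : E3) (diff φ (pt z.1 S z.2)).2 - R • tang (z.2 : E3)
        (diff φ (pt z.1 R z.2)).2 = tang (z.2 : E3) (S • (diff φ (pt z.1 S z.2)).2
          - R • (diff φ (pt z.1 R z.2)).2) := by
      simp only [tang, inner_sub_left, real_inner_smul_left]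
      module
    simp only [jetSq, jet, cylGrad, Prod.mk_sub_mk, ht, norm_tang_sq_eq_rotation, inner_sub_left,
      real_inner_smul_left, alongKilling_pt]
    simp
    ring
  rw [key, lintegral_add_left (hm hE), lintegral_add_left (hm hT), lintegral_add_left (hm (hΩ 0 1)),
    lintegral_add_left (hm (hΩ 1 2))]
  simp only [mul_add]
  exact add_le_add (H₁ R S hR hRS) (add_le_add (H₂ R S hR hRS) (add_le_add (H₃ R S hR hRS)
    (add_le_add (H₄ R S hR hRS) (H₅ R S hR hRS))))

/-! ### Finite energy solutions -/

lemma IsSmoothSolution.continuous_diff_slice {Λ m : ℝ} (h : 0 ≤ rc Λ m) {φ : Pt → ℝ}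
    (hφ : IsSmoothSolution Λ m φ) {r : ℝ} (hr : rc Λ m ≤ r) :
    Continuous fun z : ℝ × S2 => diff φ (pt z.1 r z.2) :=
  continuous_iff_continuousAt.2 fun z => by
    have hp : ContinuousAt (fun z : ℝ × S2 => pt z.1 r z.2) z := by
      unfold pt
      fun_prop
    exact ContinuousAt.comp' (f := fun z : ℝ × S2 => pt z.1 r z.2)
      (continuousAt_diff (hφ _ (pt_mem_region h hr _)).1) hp

lemma IsSmoothSolution.nullEnergy_ne_top {Λ m : ℝ} (h : 0 ≤ rc Λ m) {φ : Pt → ℝ}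
    (hφ : IsSmoothSolution Λ m φ) (r₁ s : ℝ) : nullEnergy (rc Λ m) r₁ (diff φ) s ≠ ⊤ := by
  rw [nullEnergy, lintegral_cyl_eq_ofReal (fun z hz => ?_) (fun z hz => by positivity)]
  · exact ENNReal.ofReal_ne_top
  · have hp : ContinuousAt (fun z : ℝ × S2 => pt s z.1 z.2) z := by
      unfold pt
      fun_prop
    have hd : ContinuousAt (fun z : ℝ × S2 => diff φ (pt s z.1 z.2)) z :=
      ContinuousAt.comp' (f := fun z : ℝ × S2 => pt s z.1 z.2)
        (continuousAt_diff (hφ _ (pt_mem_region h hz.1.1 _)).1) hp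
    exact (hd.snd.norm.pow 2).continuousWithinAt

lemma IsSmoothSolution.sliceEnergy_ne_top {Λ m : ℝ} (h : 0 ≤ rc Λ m) {φ : Pt → ℝ}
    (hφ : IsSmoothSolution Λ m φ) {r : ℝ} (hr : rc Λ m ≤ r) (a b : ℝ) :
    sliceEnergy r (diff φ) a b ≠ ⊤ := by
  have hc := hφ.continuous_diff_slice h hr
  rw [sliceEnergy, lintegral_cyl_eq_ofReal ?_ (fun z hz => by positivity)]
  · exact ENNReal.ofReal_ne_top
  · exact ((hc.fst.pow 2).add (hc.snd.norm.pow 2)).continuousOn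

lemma tangentialEnergy_le_sliceEnergy {r : ℝ} (hr : 0 < r) (ξ : Pt → Vec) (a b : ℝ) :
    tangentialEnergy r ξ a b ≤ sliceEnergy r ξ a b := by
  refine lintegral_mono fun z => ENNReal.ofReal_le_ofReal ?_
  rw [tang_pt hr]
  linarith [norm_tang_le z.2 (ξ (pt z.1 r z.2)).2]

lemma nullEnergy_sub_comm (r₀ r₁ : ℝ) (ξ η : Pt → Vec) (s : ℝ) :
    nullEnergy r₀ r₁ (fun p => ξ p - η p) s = nullEnergy r₀ r₁ (fun p => η p - ξ p) s := by
  unfold nullEnergy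
  congr 1 with z
  simp only [Prod.snd_sub]
  rw [norm_sub_rev]

lemma tangentialEnergy_sub_comm (r : ℝ) (ξ η : Pt → Vec) (a b : ℝ) :
    tangentialEnergy r (fun p => ξ p - η p) a b = tangentialEnergy r (fun p => η p - ξ p) a b := by
  unfold tangentialEnergy
  congr 1 with z
  simp only [Prod.snd_sub, Prod.fst_sub, tang_sub]
  rw [norm_sub_rev, sub_sq_comm]

lemma sliceEnergy_sub_comm (r : ℝ) (ξ η : Pt → Vec) (a b : ℝ) :
    sliceEnergy r (fun p => ξ p - η p) a b = sliceEnergy r (fun p => η p - ξ p) a b := by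
  unfold sliceEnergy
  congr 1 with z
  simp only [Prod.snd_sub, Prod.fst_sub]
  rw [norm_sub_rev, sub_sq_comm]

/-- A sequence of smooth solutions that approximates `(ψ, dψ)` in the local first order energies. -/
structure IsApproximation (Λ m : ℝ) (φ : ℕ → Pt → ℝ) (ψ : Pt → ℝ) (dψ : Pt → Vec) : Prop where
  measurable : Measurable ((region Λ m).domRestrict ψ)
  measurable_diff : Measurable ((region Λ m).domRestrict dψ)
  smooth : ∀ n, IsSmoothSolution Λ m (φ n)
  horizon : ∀ a b, Tendsto (fun n => tangentialEnergy (rc Λ m) (fun p => diff (φ n) p - dψ p) a b)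
    atTop (𝓝 0)
  null : ∀ R s, Tendsto (fun n => nullEnergy (rc Λ m) R (fun p => diff (φ n) p - dψ p) s)
    atTop (𝓝 0)
  slice : ∀ r a b, rc Λ m < r → Tendsto (fun n => sobolevEnergy r (fun p => φ n p - ψ p)
    (fun p => diff (φ n) p - dψ p) a b) atTop (𝓝 0)

lemma IsFiniteEnergySolution.exists_approximation {Λ m : ℝ} {ψ : Pt → ℝ} {dψ : Pt → Vec}
    (h : IsFiniteEnergySolution Λ m ψ dψ) : ∃ φ, IsApproximation Λ m φ ψ dψ := by
  obtain ⟨h1, h2, φ, hφ, hH, hN, hS⟩ := h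
  refine ⟨φ, h1, h2, hφ, fun a b => ?_, fun R s => ?_, fun r a b hr => hS r a b hr⟩
  · refine tendsto_of_tendsto_of_tendsto_of_le_of_le tendsto_const_nhds (hH a b)
      (fun n => zero_le) fun n => lintegral_mono fun z => ENNReal.ofReal_le_ofReal ?_
    linarith [sq_nonneg (φ n (pt z.1 (rc Λ m) z.2) - ψ (pt z.1 (rc Λ m) z.2))]
  · refine tendsto_of_tendsto_of_tendsto_of_le_of_le tendsto_const_nhds (hN s R)
      (fun n => zero_le) fun n => lintegral_mono fun z => ENNReal.ofReal_le_ofReal ?_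
    linarith [sq_nonneg (φ n (pt s z.1 z.2) - ψ (pt s z.1 z.2))]

namespace IsApproximation

variable {Λ m : ℝ} {φ : ℕ → Pt → ℝ} {ψ : Pt → ℝ} {dψ : Pt → Vec}

lemma sliceEnergy_tendsto (hA : IsApproximation Λ m φ ψ dψ) {r : ℝ} (hr : rc Λ m < r) (a b : ℝ) :
    Tendsto (fun n => sliceEnergy r (fun p => diff (φ n) p - dψ p) a b) atTop (𝓝 0) :=
  tendsto_of_tendsto_of_tendsto_of_le_of_le tendsto_const_nhds (hA.slice r a b hr)
    (fun _ => zero_le) fun _ => sliceEnergy_le_sobolevEnergy _ _ _ _ _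

lemma nullEnergy_ne_top (h : 0 ≤ rc Λ m) (hA : IsApproximation Λ m φ ψ dψ) (r₁ s : ℝ) :
    nullEnergy (rc Λ m) r₁ dψ s ≠ ⊤ := by
  obtain ⟨n, hn⟩ := ((hA.null r₁ s).eventually_lt_const ENNReal.zero_lt_top).exists
  have h1 := nullEnergy_le_two (ξ := dψ) h (hA.smooth n).measurable_diff r₁ s
  rw [nullEnergy_sub_comm] at h1
  exact ne_top_of_le_ne_top (ENNReal.add_ne_top.2 ⟨ENNReal.mul_ne_top (by simp)
    ((hA.smooth n).nullEnergy_ne_top h r₁ s), ENNReal.mul_ne_top (by simp) hn.ne⟩) h1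

lemma tangentialEnergy_ne_top (h : 0 < rc Λ m) (hA : IsApproximation Λ m φ ψ dψ) (a b : ℝ) :
    tangentialEnergy (rc Λ m) dψ a b ≠ ⊤ := by
  obtain ⟨n, hn⟩ := ((hA.horizon a b).eventually_lt_const ENNReal.zero_lt_top).exists
  have h1 := tangentialEnergy_le_two (ξ := dψ) h.le (hA.smooth n).measurable_diff a b
  rw [tangentialEnergy_sub_comm _ dψ] at h1
  exact ne_top_of_le_ne_top (ENNReal.add_ne_top.2 ⟨ENNReal.mul_ne_top (by simp)
    (ne_top_of_le_ne_top ((hA.smooth n).sliceEnergy_ne_top h.le le_rfl a b)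
      (tangentialEnergy_le_sliceEnergy h _ a b)), ENNReal.mul_ne_top (by simp) hn.ne⟩) h1

/-- Estimates for the energies of smooth solutions pass to finite energy solutions. -/
lemma energy_le (h : 0 ≤ rc Λ m) (hA : IsApproximation Λ m φ ψ dψ) {r₁ s t : ℝ} {K e : ℝ≥0∞}
    (hK : K ≠ ⊤) (he : e ≠ ⊤) {E : (Pt → Vec) → ℝ≥0∞}
    (hE : ∀ n, E dψ ≤ 2 * E (diff (φ n)) + 2 * E fun p => dψ p - diff (φ n) p)
    (hE0 : Tendsto (fun n => E fun p => dψ p - diff (φ n) p) atTop (𝓝 0))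
    (hle : ∀ n, E (diff (φ n)) ≤ K * (tangentialEnergy (rc Λ m) (diff (φ n)) s t
      + e * nullEnergy (rc Λ m) r₁ (diff (φ n)) s)) :
    E dψ ≤ 4 * K * (tangentialEnergy (rc Λ m) dψ s t + e * nullEnergy (rc Λ m) r₁ dψ s) := by
  have h2 : (2 : ℝ≥0∞) ≠ ⊤ := by simp
  set T := tangentialEnergy (rc Λ m) dψ s t
  set N := nullEnergy (rc Λ m) r₁ dψ s
  -- Each passage between the solution and its approximants costs a factor `2`; two of them survive
  -- the limit and give the `4`.
  have hT : Tendsto (fun n => 2 * (K * ((2 * T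
      + 2 * tangentialEnergy (rc Λ m) (fun p => diff (φ n) p - dψ p) s t)
      + e * (2 * N + 2 * nullEnergy (rc Λ m) r₁ (fun p => diff (φ n) p - dψ p) s)))
      + 2 * E fun p => dψ p - diff (φ n) p) atTop
      (𝓝 (2 * (K * ((2 * T + 2 * 0) + e * (2 * N + 2 * 0))) + 2 * 0)) := by
    have t1 := (tendsto_const_nhds (x := 2 * T)).add
      (ENNReal.Tendsto.const_mul (hA.horizon s t) (Or.inr h2))
    have t2 := (tendsto_const_nhds (x := 2 * N)).add
      (ENNReal.Tendsto.const_mul (hA.null r₁ s) (Or.inr h2))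
    exact (ENNReal.Tendsto.const_mul (ENNReal.Tendsto.const_mul
      (t1.add (ENNReal.Tendsto.const_mul t2 (Or.inr he))) (Or.inr hK)) (Or.inr h2)).add
      (ENNReal.Tendsto.const_mul hE0 (Or.inr h2))
  have hfin := ge_of_tendsto' hT (b := E dψ) fun n => by
    refine (hE n).trans ?_
    gcongr
    refine (hle n).trans ?_
    gcongr
    · exact tangentialEnergy_le_two h hA.measurable_diff s t
    · exact nullEnergy_le_two h hA.measurable_diff r₁ s
  refine hfin.trans (le_of_eq ?_)
  ring

lemma cylNorm_tendsto (hA : IsApproximation Λ m φ ψ dψ) {r : ℝ} (hr : rc Λ m < r) (a b : ℝ) :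
    Tendsto (fun n => cylNorm a b (fun z => jet (φ n) (diff (φ n)) r z - jet ψ dψ r z))
      atTop (𝓝 0) := by
  have h1 := ENNReal.Tendsto.const_mul (a := ENNReal.ofReal (1 + r ^ 2)) (hA.slice r a b hr)
    (Or.inr ENNReal.ofReal_ne_top)
  rw [mul_zero] at h1
  refine tendsto_of_tendsto_of_tendsto_of_le_of_le tendsto_const_nhds h1 (fun _ => zero_le)
    fun n => ?_
  simp only [jet_sub]
  exact cylNorm_jet_le _ _ _ _

/-- The approximation is uniform on the level sets of `r`. -/
lemma cylNorm_le (h : IsHorizonRadius Λ m (rc Λ m)) (hA : IsApproximation Λ m φ ψ dψ)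
    {r₁ C : ℝ} (hr₁ : rc Λ m < r₁)
    (hC : ∀ φ, IsSmoothSolution Λ m φ → ∀ r a b : ℝ, r₁ ≤ r → cylNorm a b (jet φ (diff φ) r)
        ≤ ENNReal.ofReal C * sobolevEnergy r₁ φ (diff φ) (a - lag Λ m r₁) b)
    (n : ℕ) {r : ℝ} (hr : r₁ ≤ r) (a b : ℝ) :
    cylNorm a b (fun z => jet (φ n) (diff (φ n)) r z - jet ψ dψ r z)
      ≤ 4 * ENNReal.ofReal C * sobolevEnergy r₁ (fun p => φ n p - ψ p)
        (fun p => diff (φ n) p - dψ p) (a - lag Λ m r₁) b := by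
  have h2 : (2 : ℝ≥0∞) ≠ ⊤ := by simp
  have hr' : rc Λ m < r := hr₁.trans_le hr
  set N := fun k => sobolevEnergy r₁ (fun p => φ k p - ψ p) (fun p => diff (φ k) p - dψ p)
    (a - lag Λ m r₁) b with hN
  have hlim : Tendsto (fun k => 2 * (ENNReal.ofReal C * (2 * N n + 2 * N k))
      + 2 * cylNorm a b (fun z => jet (φ k) (diff (φ k)) r z - jet ψ dψ r z)) atTop
      (𝓝 (2 * (ENNReal.ofReal C * (2 * N n + 2 * 0)) + 2 * 0)) :=
    (ENNReal.Tendsto.const_mul (ENNReal.Tendsto.const_mul (tendsto_const_nhds.add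
      (ENNReal.Tendsto.const_mul (hA.slice r₁ _ _ hr₁) (Or.inr h2)))
      (Or.inr ENNReal.ofReal_ne_top)) (Or.inr h2)).add
      (ENNReal.Tendsto.const_mul (hA.cylNorm_tendsto hr' a b) (Or.inr h2))
  -- The estimate is available only for smooth solutions, so it is applied to `φ n - φ k`, and `k →
  -- ∞` at fixed `r` replaces `φ k` by `ψ`.
  have hfin := ge_of_tendsto' hlim
    (b := cylNorm a b (fun z => jet (φ n) (diff (φ n)) r z - jet ψ dψ r z)) fun k => by
    have mj := fun k => measurable_jet h.pos.le (hA.smooth k).measurable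
      (hA.smooth k).measurable_diff hr'.le
    refine (cylNorm_sub_le (mj n) (mj k)).trans ?_
    gcongr
    have e1 : cylNorm a b (fun z => jet (φ n) (diff (φ n)) r z - jet (φ k) (diff (φ k)) r z)
        = cylNorm a b (jet (fun p => φ n p - φ k p) (diff fun p => φ n p - φ k p) r) := by
      refine lintegral_congr fun z => ?_
      simp only [jet, cylGrad, (hA.smooth n).diff_sub (hA.smooth k)
        (pt_mem_region h.pos.le hr'.le z.2), Prod.mk_sub_mk, Prod.fst_sub, Prod.snd_sub, tang_sub,
        smul_sub]
    have e2 : sobolevEnergy r₁ (fun p => φ n p - φ k p) (diff fun p => φ n p - φ k p)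
        (a - lag Λ m r₁) b = sobolevEnergy r₁ (fun p => φ n p - φ k p)
          (fun p => diff (φ n) p - diff (φ k) p) (a - lag Λ m r₁) b := by
      refine lintegral_congr fun z => ?_
      simp only [(hA.smooth n).diff_sub (hA.smooth k) (pt_mem_region h.pos.le hr₁.le z.2)]
    rw [e1]
    refine (hC _ ((hA.smooth n).sub h.pos (hA.smooth k)) r a b hr).trans ?_
    rw [e2]
    gcongr
    refine (sobolevEnergy_sub_le h.pos.le ((hA.smooth n).measurable.fun_sub hA.measurable)
      ((hA.smooth n).measurable_diff.fun_sub hA.measurable_diff) hr₁.le _ _).trans ?_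
    rw [sobolevEnergy_sub_comm r₁ ψ]
  refine hfin.trans (le_of_eq ?_)
  ring

/-- One approximant is close to `ψ` uniformly in `r ≥ r₁`, and that approximant converges as `r →
∞`. The two nested inequalities with factor `2` add up to `10` times the tolerance. -/
lemma cylNorm_cauchy (h : IsHorizonRadius Λ m (rc Λ m)) (hA : IsApproximation Λ m φ ψ dψ)
    {r₁ C : ℝ} (hr₁ : rc Λ m < r₁)
    (hC : ∀ φ, IsSmoothSolution Λ m φ → ∀ r a b : ℝ, r₁ ≤ r → cylNorm a b (jet φ (diff φ) r)
        ≤ ENNReal.ofReal C * sobolevEnergy r₁ φ (diff φ) (a - lag Λ m r₁) b)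
    (a b : ℝ) {ε : ℝ≥0∞} (hε : 0 < ε) :
    ∃ R, ∀ r s, R ≤ r → R ≤ s → cylNorm a b (fun z => jet ψ dψ r z - jet ψ dψ s z) ≤ ε := by
  have hε' : 0 < ε / 10 := ENNReal.div_pos hε.ne' (by simp)
  have hK : 4 * ENNReal.ofReal C ≠ ⊤ := ENNReal.mul_ne_top (by simp) ENNReal.ofReal_ne_top
  have hlim := ENNReal.Tendsto.const_mul (hA.slice r₁ (a - lag Λ m r₁) b hr₁) (Or.inr hK)
  rw [mul_zero] at hlim
  obtain ⟨n, hn⟩ := (hlim.eventually_le_const hε').exists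
  have hD : ∀ r, r₁ ≤ r →
      cylNorm a b (fun z => jet (φ n) (diff (φ n)) r z - jet ψ dψ r z) ≤ ε / 10 := fun r hr =>
    (hA.cylNorm_le h hr₁ hC n hr a b).trans hn
  obtain ⟨M, hM, hMle⟩ := (hA.smooth n).exists_cylNorm_sub_le h hr₁ a b
  have hinv : Tendsto (fun R : ℝ => ENNReal.ofReal R⁻¹) atTop (𝓝 0) := by
    simpa using ENNReal.tendsto_ofReal tendsto_inv_atTop_zero
  have hl1 := ENNReal.Tendsto.mul_const (b := M) hinv (Or.inr hM)
  rw [zero_mul] at hl1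
  have hl2 := ENNReal.Tendsto.mul hinv (Or.inr ENNReal.zero_ne_top) hl1
    (Or.inr (by simp))
  rw [zero_mul] at hl2
  obtain ⟨R, hR, hRr⟩ := ((hl2.eventually_le_const hε').and (eventually_ge_atTop r₁)).exists
  have hdec : ∀ R', R ≤ R' → ENNReal.ofReal R'⁻¹ * (ENNReal.ofReal R'⁻¹ * M) ≤ ε / 10 := by
    intro R' hR'
    have hR0 : 0 < R := (h.pos.trans hr₁).trans_le hRr
    have hle : R'⁻¹ ≤ R⁻¹ := inv_anti₀ hR0 hR'
    refine le_trans ?_ hR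
    gcongr
  have hS : ∀ r s, R ≤ r → R ≤ s → cylNorm a b (fun z => jet (φ n) (diff (φ n)) r z
      - jet (φ n) (diff (φ n)) s z) ≤ ε / 10 := by
    intro r s hr hs
    rcases le_total r s with hrs | hrs
    · rw [cylNorm_sub_comm]
      exact (hMle r s (hRr.trans hr) hrs).trans (hdec r hr)
    · exact (hMle s r (hRr.trans hs) hrs).trans (hdec s hs)
  refine ⟨R, fun r s hr hs => ?_⟩
  have mψ := measurable_jet h.pos.le hA.measurable hA.measurable_diff
    (hr₁.le.trans (hRr.trans hr))
  have mφ := fun r (hr : R ≤ r) => measurable_jet h.pos.le (hA.smooth n).measurable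
    (hA.smooth n).measurable_diff (hr₁.le.trans (hRr.trans hr))
  calc cylNorm a b (fun z => jet ψ dψ r z - jet ψ dψ s z)
      ≤ 2 * cylNorm a b (fun z => jet ψ dψ r z - jet (φ n) (diff (φ n)) r z)
        + 2 * (2 * cylNorm a b (fun z => jet (φ n) (diff (φ n)) r z - jet (φ n) (diff (φ n)) s z)
          + 2 * cylNorm a b (fun z => jet (φ n) (diff (φ n)) s z - jet ψ dψ s z)) :=
        (cylNorm_sub_le mψ (mφ r hr)).trans (by
          gcongr
          exact cylNorm_sub_le (mφ r hr) (mφ s hs))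
    _ ≤ 2 * (ε / 10) + 2 * (2 * (ε / 10) + 2 * (ε / 10)) := by
        rw [cylNorm_sub_comm a b (jet ψ dψ r)]
        gcongr
        · exact hD r (hRr.trans hr)
        · exact hS r s hr hs
        · exact hD s (hRr.trans hs)
    _ = 10 * (ε / 10) := by ring
    _ = ε := ENNReal.mul_div_cancel (by simp) (by simp)

end IsApproximation

lemma jetSq_zero_le (x : ℝ) (v : ℝ × E3) : jetSq (0, v) ≤ jetSq (x, v) := by
  unfold jetSq
  linarith [sq_nonneg x]

/-- Finite energy solutions have a limit on the future boundary whose energy is bounded by the energy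
on a level set of `r`. -/
theorem exists_isFutureBoundaryLimit {Λ m r₁ : ℝ} (h : IsHorizonRadius Λ m (rc Λ m))
    (hr₁ : rc Λ m < r₁) :
    ∃ C : ℝ, 0 ≤ C ∧ ∀ ψ dψ, IsFiniteEnergySolution Λ m ψ dψ → ∃ f G,
      IsFutureBoundaryLimit ψ dψ f G ∧ ∀ a b : ℝ,
        ∫⁻ z in Icc a b ×ˢ (univ : Set S2), ENNReal.ofReal ((G z).1 ^ 2 + ‖(G z).2‖ ^ 2) ∂cylMeasure
          ≤ ENNReal.ofReal C * sliceEnergy r₁ dψ (a - lag Λ m r₁) b := by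
  obtain ⟨C, hC0, hC⟩ := exists_cylNorm_le h hr₁
  -- Three comparisons at a factor `2` each: limit with level set, solution with approximant, and
  -- approximant back to solution on `r = r₁`.
  refine ⟨8 * C, by positivity, fun ψ dψ hψ => ?_⟩
  obtain ⟨φ, hA⟩ := hψ.exists_approximation
  have hC2 : ∀ φ, IsSmoothSolution Λ m φ → ∀ r a b : ℝ, r₁ ≤ r → cylNorm a b (jet φ (diff φ) r)
      ≤ ENNReal.ofReal C * sobolevEnergy r₁ φ (diff φ) (a - lag Λ m r₁) b :=
    fun φ hφ r a b hr => (hC φ hφ r a b hr).2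
  obtain ⟨w, hw, hlim⟩ := exists_cylNorm_limit (r₁ := r₁) (u := jet ψ dψ)
    (fun r hr => measurable_jet h.pos.le hA.measurable hA.measurable_diff (hr₁.le.trans hr))
    fun a b ε hε => hA.cylNorm_cauchy h hr₁ hC2 a b hε
  refine ⟨fun z => (w z).1, fun z => (w z).2, ⟨hw.fst, hw.snd, hlim⟩, fun a b => ?_⟩
  have h2 : (2 : ℝ≥0∞) ≠ ⊤ := by simp
  have hK : 4 * ENNReal.ofReal C ≠ ⊤ := ENNReal.mul_ne_top (by simp) ENNReal.ofReal_ne_top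
  have m0 : Measurable ((region Λ m).domRestrict (0 : Pt → ℝ)) := measurable_const
  set A := sliceEnergy r₁ dψ (a - lag Λ m r₁) b
  set D := fun n => sliceEnergy r₁ (fun p => diff (φ n) p - dψ p) (a - lag Λ m r₁) b
  set N := fun n => sobolevEnergy r₁ (fun p => φ n p - ψ p) (fun p => diff (φ n) p - dψ p)
    (a - lag Λ m r₁) b
  have e0 : ∫⁻ z in Icc a b ×ˢ (univ : Set S2),
      ENNReal.ofReal (((w z).2).1 ^ 2 + ‖((w z).2).2‖ ^ 2) ∂cylMeasure
      = cylNorm a b (fun z => (0, (w z).2)) := by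
    simp [cylNorm, jetSq]
  -- The zero function in the first slot isolates the gradient, so the main term is the energy of
  -- derivatives alone. The error involves the function as well, but vanishes in the limit.
  have hslice : ∀ n r, r₁ ≤ r → cylNorm a b (jet 0 dψ r)
      ≤ 2 * (ENNReal.ofReal C * (2 * A + 2 * D n)) + 2 * (4 * ENNReal.ofReal C * N n) := by
    intro n r hr
    have mφ := measurable_jet h.pos.le m0 (hA.smooth n).measurable_diff (hr₁.le.trans hr)
    refine (cylNorm_le_two _ mφ).trans ?_
    gcongr
    · refine ((hC _ (hA.smooth n) r a b hr).1).trans ?_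
      gcongr
      exact sliceEnergy_le_two h.pos.le hA.measurable_diff hr₁.le _ _
    · rw [cylNorm_sub_comm]
      refine le_trans (lintegral_mono fun z => ENNReal.ofReal_le_ofReal ?_)
        (hA.cylNorm_le h hr₁ hC2 n hr a b)
      simp only [jet, Prod.mk_sub_mk, Pi.zero_apply, sub_zero]
      exact jetSq_zero_le _ _
  have hslice' : ∀ r, r₁ ≤ r → cylNorm a b (jet 0 dψ r)
      ≤ 2 * (ENNReal.ofReal C * (2 * A + 2 * 0)) + 2 * (4 * ENNReal.ofReal C * 0) := fun r hr =>
    ge_of_tendsto' ((ENNReal.Tendsto.const_mul (ENNReal.Tendsto.const_mul (tendsto_const_nhds.add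
      (ENNReal.Tendsto.const_mul (hA.sliceEnergy_tendsto hr₁ _ _) (Or.inr h2)))
      (Or.inr ENNReal.ofReal_ne_top)) (Or.inr h2)).add
      (ENNReal.Tendsto.const_mul (ENNReal.Tendsto.const_mul (hA.slice r₁ _ _ hr₁) (Or.inr hK))
        (Or.inr h2))) fun n => hslice n r hr
  have hbd : ∀ r, r₁ ≤ r → cylNorm a b (fun z => (0, (w z).2))
      ≤ 2 * (2 * (ENNReal.ofReal C * (2 * A + 2 * 0)) + 2 * (4 * ENNReal.ofReal C * 0))
        + 2 * cylNorm a b (fun z => jet ψ dψ r z - w z) := by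
    intro r hr
    have mψ := measurable_jet h.pos.le m0 hA.measurable_diff (hr₁.le.trans hr)
    refine (cylNorm_le_two _ mψ).trans ?_
    gcongr
    · exact hslice' r hr
    · rw [cylNorm_sub_comm]
      refine lintegral_mono fun z => ENNReal.ofReal_le_ofReal ?_
      simp only [jet, Prod.mk_sub_mk, Pi.zero_apply, sub_zero]
      exact jetSq_zero_le _ _
  have hfin := ge_of_tendsto (tendsto_const_nhds.add (ENNReal.Tendsto.const_mul (hlim a b)
    (Or.inr h2))) ((eventually_ge_atTop r₁).mono hbd)
  rw [e0]
  refine hfin.trans (le_of_eq ?_)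
  rw [ENNReal.ofReal_mul (by norm_num), show ENNReal.ofReal 8 = 8 by simp]
  ring

/-- The near horizon estimate for finite energy solutions. -/
theorem exists_near_bound_finite {Λ m : ℝ} (h : IsHorizonRadius Λ m (rc Λ m)) :
    ∃ r₁ b₀ C : ℝ, rc Λ m < r₁ ∧ 0 < b₀ ∧ 0 < C ∧ ∀ ψ dψ, IsFiniteEnergySolution Λ m ψ dψ →
      ∀ s t : ℝ, s ≤ t →
      nullEnergy (rc Λ m) r₁ dψ t ≤ ENNReal.ofReal C * (tangentialEnergy (rc Λ m) dψ s t
        + ENNReal.ofReal (Real.exp (-(b₀ * (t - s)))) * nullEnergy (rc Λ m) r₁ dψ s) ∧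
      sliceEnergy r₁ dψ s t ≤ ENNReal.ofReal C * (tangentialEnergy (rc Λ m) dψ s t
        + nullEnergy (rc Λ m) r₁ dψ s) := by
  obtain ⟨r₁, b₀, C, hr₁, hb₀, hC, hle⟩ := h.exists_near_bound
  refine ⟨r₁, b₀, 4 * C, hr₁, hb₀, by positivity, fun ψ dψ hψ s t hst => ?_⟩
  obtain ⟨φ, hA⟩ := hψ.exists_approximation
  rw [ENNReal.ofReal_mul (by norm_num), show ENNReal.ofReal 4 = 4 by simp]
  constructor
  · refine hA.energy_le h.pos.le ENNReal.ofReal_ne_top ENNReal.ofReal_ne_top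
      (E := fun ξ => nullEnergy (rc Λ m) r₁ ξ t)
      (fun n => nullEnergy_le_two h.pos.le (hA.smooth n).measurable_diff r₁ t) ?_
      (fun n => (hle _ (hA.smooth n) s t hst).1)
    simp only [nullEnergy_sub_comm (rc Λ m) r₁ dψ]
    exact hA.null r₁ t
  · have := hA.energy_le h.pos.le ENNReal.ofReal_ne_top (e := 1) (K := ENNReal.ofReal C) (by simp)
      (E := fun ξ => sliceEnergy r₁ ξ s t) (s := s) (t := t) (r₁ := r₁)
      (fun n => sliceEnergy_le_two h.pos.le (hA.smooth n).measurable_diff hr₁.le s t) (by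
        simp only [sliceEnergy_sub_comm r₁ dψ]
        exact hA.sliceEnergy_tendsto hr₁ s t)
      (fun n => by
        rw [one_mul]
        exact (hle _ (hA.smooth n) s t hst).2)
    rwa [one_mul] at this

/-! ### Decay -/

lemma tangentialEnergy_le_horizonFlux {Λ m : ℝ} (h : IsHorizonRadius Λ m (rc Λ m)) (dψ : Pt → Vec)
    (s t : ℝ) :
    tangentialEnergy (rc Λ m) dψ s t
      ≤ ENNReal.ofReal (rc Λ m ^ 2)⁻¹ * horizonFlux Λ m dψ s := by
  have hρ := h.pos
  refine le_ofReal_inv_mul (by positivity) ?_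
  rw [tangentialEnergy, ← lintegral_const_mul' _ _ ENNReal.ofReal_ne_top, horizonFlux]
  refine (lintegral_mono_set (Set.prod_mono Icc_subset_Ici_self le_rfl)).trans
    (lintegral_mono fun z => ?_)
  have hn : ‖(pt z.1 (rc Λ m) z.2).2‖ = rc Λ m := norm_pt_snd hρ.le _
  rw [← ENNReal.ofReal_mul (by positivity), horizonDensity_eq Λ m _ (pt_snd_ne_zero hρ _)
    (by rw [hn, h.root]), hn]

/-- Monotone convergence along an exhaustion of the half cylinder by compact pieces, on which the
limit at infinity is controlled. -/
lemma boundaryEnergy_le_of_forall {G : ℝ × S2 → ℝ × E3} {τ : ℝ} {B : ℝ≥0∞}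
    (h : ∀ n : ℕ, ∫⁻ z in Icc τ (τ + n) ×ˢ (univ : Set S2),
      ENNReal.ofReal ((G z).1 ^ 2 + ‖(G z).2‖ ^ 2) ∂cylMeasure ≤ B) :
    boundaryEnergy G τ ≤ B := by
  have hU : Ici τ ×ˢ (univ : Set S2) = ⋃ n : ℕ, Icc τ (τ + n) ×ˢ (univ : Set S2) := by
    ext z
    simp only [mem_prod, mem_Ici, mem_univ, and_true, mem_iUnion, mem_Icc]
    refine ⟨fun hz => ?_, fun ⟨_, hz⟩ => hz.1⟩
    obtain ⟨n, hn⟩ := exists_nat_ge (z.1 - τ)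
    exact ⟨n, hz, by linarith⟩
  have hd : Directed (· ⊆ ·) fun n : ℕ => Icc τ (τ + n) ×ˢ (univ : Set S2) :=
    directed_of_isDirected_le fun i j hij => prod_mono (Icc_subset_Icc_right (by gcongr)) le_rfl
  rw [boundaryEnergy, hU, setLIntegral_iUnion_of_directed _ hd]
  exact iSup_le h

lemma boundaryEnergy_le_add (G : ℝ × S2 → ℝ × E3) {a τ T : ℝ} (ha : a ≤ τ) :
    boundaryEnergy G τ ≤ ∫⁻ z in Icc a T ×ˢ (univ : Set S2),
      ENNReal.ofReal ((G z).1 ^ 2 + ‖(G z).2‖ ^ 2) ∂cylMeasure + boundaryEnergy G T := by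
  refine le_trans (lintegral_mono_set fun z hz => ?_) (lintegral_union_le _ _ _)
  rcases le_total z.1 T with hT | hT
  · exact Or.inl ⟨⟨ha.trans hz.1, hT⟩, mem_univ _⟩
  · exact Or.inr ⟨hT, mem_univ _⟩

/-- Iteration of an exponential decay estimate with an inhomogeneity. -/
lemma exists_le_mul_profile {g h : ℝ → ℝ} {K b₀ s₀ L q : ℝ} (hL : 0 < L) (hK : 0 ≤ K) (hq : 0 ≤ q)
    (hb₀ : 0 ≤ b₀) (hg : 0 ≤ g s₀) (hh : ∀ s, s₀ ≤ s → 0 < h s)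
    (hrec : ∀ s t, s₀ ≤ s → s ≤ t → g t ≤ K * (h s + Real.exp (-(b₀ * (t - s))) * g s))
    (hprof : ∀ s t, s₀ ≤ s → s ≤ t → t ≤ s + L → h s ≤ q * h t)
    (hsmall : K * q * Real.exp (-(b₀ * L)) ≤ 1 / 2) :
    ∃ M : ℝ, 0 ≤ M ∧ ∀ s, s₀ ≤ s → g s ≤ M * h s := by
  have h0 := hh s₀ le_rfl
  -- The first summand makes `K q + M / 2 ≤ M`, which closes the induction; the second covers the
  -- initial window of length `L`, where `g` is bounded through its value at `s₀`.
  set M := 2 * K * q + K * (1 + g s₀ / h s₀) * q with hM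
  have hM0 : 0 ≤ M := by positivity
  -- Induction over windows of length `L`. Going back by `L` costs `q` in the profile, and by
  -- `hsmall` the exponential factor still reduces the old constant by half.
  have key : ∀ n : ℕ, ∀ s, s₀ ≤ s → s ≤ s₀ + (n + 1) * L → g s ≤ M * h s := by
    intro n
    induction n with
    | zero =>
      intro s hs hsL
      have h1 := hrec s₀ s le_rfl hs
      have h2 : Real.exp (-(b₀ * (s - s₀))) ≤ 1 :=
        Real.exp_le_one_iff.2 (neg_nonpos.2 (mul_nonneg hb₀ (sub_nonneg.2 hs)))
      have h3 := hprof s₀ s le_rfl hs (by simpa using hsL)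
      have h4 := hh s hs
      calc g s ≤ K * (h s₀ + 1 * g s₀) := h1.trans (by gcongr)
        _ = K * (1 + g s₀ / h s₀) * h s₀ := by field_simp
        _ ≤ K * (1 + g s₀ / h s₀) * (q * h s) := by gcongr
        _ ≤ M * h s := by
          rw [hM, ← mul_assoc]
          gcongr
          exact le_add_of_nonneg_left (by positivity)
    | succ n ih =>
      intro t ht htL
      rcases le_total t (s₀ + (n + 1) * L) with hc | hc
      · exact ih t ht hc
      have hn : 0 ≤ (n : ℝ) * L := by positivity
      have hs : s₀ ≤ t - L := by linarith
      have h1 := hrec (t - L) t hs (by linarith)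
      have h2 := ih (t - L) hs (by push_cast at htL; linarith)
      have h3 := hprof (t - L) t hs (by linarith) (by linarith)
      have h4 := hh t ht
      have e1 : t - (t - L) = L := by ring
      rw [e1] at h1
      have hle : 2 * K * q ≤ M := le_add_of_nonneg_right (by positivity)
      calc g t ≤ K * (h (t - L) + Real.exp (-(b₀ * L)) * (M * h (t - L))) := h1.trans (by gcongr)
        _ = K * (1 + Real.exp (-(b₀ * L)) * M) * h (t - L) := by ring
        _ ≤ K * (1 + Real.exp (-(b₀ * L)) * M) * (q * h t) := by gcongr
        _ = (K * q + (K * q * Real.exp (-(b₀ * L))) * M) * h t := by ring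
        _ ≤ (K * q + 1 / 2 * M) * h t := by gcongr
        _ ≤ M * h t := by
          gcongr
          linarith
  refine ⟨M, hM0, fun s hs => ?_⟩
  obtain ⟨n, hn⟩ := exists_nat_ge ((s - s₀) / L)
  rw [div_le_iff₀ hL] at hn
  exact key n s hs (by linarith)

/-- Decay of the horizon flux along a slowly varying profile `h` passes to the future boundary. -/
theorem exists_boundary_decay {Λ m : ℝ} (hR : IsHorizonRadius Λ m (rc Λ m)) :
    ∃ b₀ K ℓ : ℝ, 0 < b₀ ∧ 0 ≤ K ∧ ∀ ψ dψ, IsFiniteEnergySolution Λ m ψ dψ →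
      ∃ f G, IsFutureBoundaryLimit ψ dψ f G ∧
        ∀ (h : ℝ → ℝ) (τ₀ s₀ L q : ℝ), AntitoneOn h (Ioi τ₀) → (∀ s, τ₀ < s → 0 < h s) → τ₀ < s₀ →
          ℓ ≤ L → 0 < L → 0 ≤ q → (∀ s t, s₀ ≤ s → s ≤ t → t ≤ s + L → h s ≤ q * h t) →
          K * q * Real.exp (-(b₀ * L)) ≤ 1 / 2 →
          (∀ τ, τ₀ < τ → horizonFlux Λ m dψ τ ≤ ENNReal.ofReal (h τ)) →
          ∃ C : ℝ, ∀ τ, τ₀ < τ → boundaryEnergy G τ ≤ ENNReal.ofReal (C * h τ) := by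
  obtain ⟨r₁, b₀, C₁, hr₁, hb₀, hC₁, hnear⟩ := exists_near_bound_finite hR
  obtain ⟨C₂, hC₂, hfar⟩ := exists_isFutureBoundaryLimit hR hr₁
  have hρ := hR.pos
  set A := (rc Λ m ^ 2)⁻¹ with hA
  have hA0 : 0 ≤ A := by positivity
  have hℓ := lag_nonneg hR hr₁
  set ℓ := lag Λ m r₁
  refine ⟨b₀, C₁ * (A + 1), ℓ, hb₀, by positivity, fun ψ dψ hψ => ?_⟩
  obtain ⟨f, G, hfG, hG⟩ := hfar ψ dψ hψ
  refine ⟨f, G, hfG, fun h τ₀ s₀ L q hanti hpos hs₀ hℓL hL hq hprof hsmall hflux => ?_⟩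
  obtain ⟨φ, hφ⟩ := hψ.exists_approximation
  have hN : ∀ s, nullEnergy (rc Λ m) r₁ dψ s ≠ ⊤ := hφ.nullEnergy_ne_top hρ.le r₁
  set g : ℝ → ℝ := fun s => (nullEnergy (rc Λ m) r₁ dψ s).toReal with hg
  have hgN : ∀ s, nullEnergy (rc Λ m) r₁ dψ s = ENNReal.ofReal (g s) := fun s =>
    (ENNReal.ofReal_toReal (hN s)).symm
  have hg0 : ∀ s, 0 ≤ g s := fun s => ENNReal.toReal_nonneg
  have htang : ∀ s t, s₀ ≤ s →
      tangentialEnergy (rc Λ m) dψ s t ≤ ENNReal.ofReal (A * h s) := fun s t hs => by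
    rw [ENNReal.ofReal_mul hA0]
    exact (tangentialEnergy_le_horizonFlux hR dψ s t).trans
      (mul_le_mul_right (hflux s (hs₀.trans_le hs)) _)
  obtain ⟨M, hM0, hM⟩ := exists_le_mul_profile (g := g) hL (by positivity : 0 ≤ C₁ * (A + 1)) hq
    hb₀.le (hg0 s₀) (fun s hs => hpos s (hs₀.trans_le hs)) (fun s t hs hst => by
      have hhs := (hpos s (hs₀.trans_le hs)).le
      have h1 : nullEnergy (rc Λ m) r₁ dψ t
          ≤ ENNReal.ofReal (C₁ * (A * h s + Real.exp (-(b₀ * (t - s))) * g s)) := by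
        refine (hnear ψ dψ hψ s t hst).1.trans ?_
        rw [ENNReal.ofReal_mul hC₁.le, ENNReal.ofReal_add (by positivity)
          (mul_nonneg (Real.exp_pos _).le (hg0 s)), ENNReal.ofReal_mul (Real.exp_pos _).le, hgN s]
        gcongr
        exact htang s t hs
      have he : 0 ≤ Real.exp (-(b₀ * (t - s))) * g s := mul_nonneg (Real.exp_pos _).le (hg0 s)
      refine (ENNReal.toReal_le_of_le_ofReal (by positivity) h1).trans ?_
      rw [mul_assoc]
      refine mul_le_mul_of_nonneg_left ?_ hC₁.le
      nlinarith [mul_nonneg hA0 he]) hprof hsmall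
  -- Far estimate followed by collar estimate, both started at `τ - ℓ` to make room for the lag.
  have hfin : ∀ τ b, τ ≤ b → ∫⁻ z in Icc τ b ×ˢ (univ : Set S2),
      ENNReal.ofReal ((G z).1 ^ 2 + ‖(G z).2‖ ^ 2) ∂cylMeasure ≤ ENNReal.ofReal C₂ *
        (ENNReal.ofReal C₁ * (tangentialEnergy (rc Λ m) dψ (τ - ℓ) b
          + nullEnergy (rc Λ m) r₁ dψ (τ - ℓ))) := fun τ b hb =>
    (hG τ b).trans (mul_le_mul_right (hnear ψ dψ hψ _ _ (by linarith)).2 _)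
  set C₃ := C₂ * (C₁ * ((A + M) * q)) with hC₃
  have hC₃0 : 0 ≤ C₃ := by positivity
  have hlate : ∀ τ, s₀ + ℓ ≤ τ → boundaryEnergy G τ ≤ ENNReal.ofReal (C₃ * h τ) := by
    intro τ hτ
    have hs : s₀ ≤ τ - ℓ := by linarith
    have hhs := (hpos _ (hs₀.trans_le hs)).le
    have hsum : A * h (τ - ℓ) + g (τ - ℓ) ≤ (A + M) * (q * h τ) := by
      have h1 := hM (τ - ℓ) hs
      have h2 := mul_le_mul_of_nonneg_left (hprof (τ - ℓ) τ hs (by linarith) (by linarith))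
        (add_nonneg hA0 hM0)
      linarith
    refine boundaryEnergy_le_of_forall fun n => (hfin τ (τ + n) (by simp)).trans ?_
    calc _ ≤ ENNReal.ofReal C₂ * (ENNReal.ofReal C₁ * (ENNReal.ofReal (A * h (τ - ℓ))
          + ENNReal.ofReal (g (τ - ℓ)))) := by
          rw [hgN (τ - ℓ)]
          gcongr
          exact htang _ _ hs
      _ = ENNReal.ofReal (C₂ * (C₁ * (A * h (τ - ℓ) + g (τ - ℓ)))) := by
          rw [← ENNReal.ofReal_add (by positivity) (hg0 _), ← ENNReal.ofReal_mul hC₁.le,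
            ← ENNReal.ofReal_mul hC₂]
      _ ≤ ENNReal.ofReal (C₂ * (C₁ * ((A + M) * (q * h τ)))) := by gcongr
      _ = ENNReal.ofReal (C₃ * h τ) := by
          rw [hC₃]
          congr 1
          ring
  -- Times before `T` lie outside the range of the iteration. There the boundary energy up to `T` is
  -- at most the finite local energy `P`, and since `h` is antitone with `h T > 0` this is absorbed
  -- into the constant.
  set T := s₀ + ℓ with hT
  have hτT : τ₀ < T := by linarith
  have hhT := hpos T hτT
  set P := ENNReal.ofReal C₂ * (ENNReal.ofReal C₁ * (tangentialEnergy (rc Λ m) dψ (τ₀ - ℓ) T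
    + nullEnergy (rc Λ m) r₁ dψ (τ₀ - ℓ))) with hP
  have hPtop : P ≠ ⊤ := ENNReal.mul_ne_top ENNReal.ofReal_ne_top
    (ENNReal.mul_ne_top ENNReal.ofReal_ne_top
      (ENNReal.add_ne_top.2 ⟨hφ.tangentialEnergy_ne_top hρ _ _, hN _⟩))
  have hP0 : 0 ≤ P.toReal := ENNReal.toReal_nonneg
  refine ⟨P.toReal / h T + C₃, fun τ hτ => ?_⟩
  have hhτ := hpos τ hτ
  rcases le_total T τ with hc | hc
  · refine (hlate τ hc).trans (ENNReal.ofReal_le_ofReal ?_)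
    gcongr
    exact le_add_of_nonneg_left (by positivity)
  · refine (boundaryEnergy_le_add G hτ.le).trans
      ((add_le_add (hfin τ₀ T hτT.le) (hlate T le_rfl)).trans ?_)
    have e : P + ENNReal.ofReal (C₃ * h T) = ENNReal.ofReal (P.toReal + C₃ * h T) := by
      rw [ENNReal.ofReal_add hP0 (by positivity), ENNReal.ofReal_toReal hPtop]
    rw [← hP, e]
    refine ENNReal.ofReal_le_ofReal ?_
    have h1 : h T ≤ h τ := hanti hτ hτT hc
    calc P.toReal + C₃ * h T = (P.toReal / h T + C₃) * h T := by field_simp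
      _ ≤ (P.toReal / h T + C₃) * h τ := by gcongr

lemma exists_mul_exp_le_half {c : ℝ} (hc : 0 < c) (K ℓ : ℝ) :
    ∃ L, ℓ ≤ L ∧ 0 < L ∧ K * Real.exp (-(c * L)) ≤ 1 / 2 := by
  have h1 : Tendsto (fun L : ℝ => K * Real.exp (-(c * L))) atTop (𝓝 (K * 0)) :=
    (Real.tendsto_exp_neg_atTop_nhds_zero.comp (tendsto_id.const_mul_atTop hc)).const_mul K
  rw [mul_zero] at h1
  obtain ⟨L, hL, hL1, hL2⟩ := ((h1.eventually_le_const (by norm_num : (0 : ℝ) < 1 / 2)).and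
    ((eventually_ge_atTop ℓ).and (eventually_gt_atTop 0))).exists
  exact ⟨L, hL1, hL2, hL⟩

end SdS

/-! ### Polynomial and exponential profiles -/

theorem mainTheorem4 (Λ m : ℝ) (hΛ : 0 < Λ) (hm : 0 < m) (hsub : 3 * m * Real.sqrt Λ < 1) :
    ∃ b : ℝ, 0 < b ∧
      ∀ τ₀ : ℝ, 0 < τ₀ →
      ∀ (ψ : SdS.Pt → ℝ) (dψ : SdS.Pt → SdS.Vec), SdS.IsFiniteEnergySolution Λ m ψ dψ →
      ∃ (f : ℝ × SdS.S2 → ℝ) (G : ℝ × SdS.S2 → ℝ × SdS.E3),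
        SdS.IsFutureBoundaryLimit ψ dψ f G ∧
        (∀ (k : ℕ) (Ck : ℝ), 0 < Ck →
          (∀ τ : ℝ, τ₀ < τ → SdS.horizonFlux Λ m dψ τ ≤ ENNReal.ofReal (Ck / τ ^ k)) →
          ∃ C : ℝ, Ck ≤ C ∧
            ∀ τ : ℝ, τ₀ < τ → SdS.boundaryEnergy G τ ≤ ENNReal.ofReal (C / τ ^ k)) ∧
        (∀ β Cβ : ℝ, 0 < β → β ≠ b → 0 < Cβ →
          (∀ τ : ℝ, τ₀ < τ →
            SdS.horizonFlux Λ m dψ τ ≤ ENNReal.ofReal (Cβ * Real.exp (-(β * τ)))) →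
          ∃ C : ℝ, Cβ < C ∧
            ∀ τ : ℝ, τ₀ < τ →
              SdS.boundaryEnergy G τ ≤ ENNReal.ofReal (C * Real.exp (-(min b β * τ)))) := by
  obtain ⟨b₀, K, ℓ, hb₀, hK, hdecay⟩ :=
    SdS.exists_boundary_decay (SdS.isHorizonRadius_rc hΛ hm hsub)
  -- Half of the collar rate is given away, so that every profile used decays strictly slower than
  -- `exp (-b₀ τ)`.
  refine ⟨b₀ / 2, by positivity, fun τ₀ hτ₀ ψ dψ hψ => ?_⟩
  obtain ⟨f, G, hfG, hG⟩ := hdecay ψ dψ hψ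
  refine ⟨f, G, hfG, fun k Ck hCk hflux => ?_, fun β Cβ hβ _ hCβ hflux => ?_⟩
  · obtain ⟨L, hℓL, hL, hsmall⟩ := SdS.exists_mul_exp_le_half hb₀ (K * 2 ^ k) ℓ
    -- For `s ≥ L` a step of length `L` at most doubles the time, so the profile changes by a factor
    -- at most `q = 2 ^ k`, which does not depend on `L`.
    obtain ⟨C, hC⟩ := hG (fun τ => Ck / τ ^ k) τ₀ (max (τ₀ + 1) L) L (2 ^ k)
      (fun s hs t _ hst => by
        have hs0 : 0 < s := hτ₀.trans hs
        change Ck / t ^ k ≤ Ck / s ^ k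
        gcongr)
      (fun s hs => by
        have hs0 : 0 < s := hτ₀.trans hs
        positivity)
      ((lt_add_one τ₀).trans_le (le_max_left _ _)) hℓL hL (by positivity)
      (fun s t hs hst htL => by
        have hs0 : 0 < s := hL.trans_le ((le_max_right _ _).trans hs)
        have ht0 : 0 < t := hs0.trans_le hst
        have hts : t ≤ 2 * s := by linarith [(le_max_right (τ₀ + 1) L).trans hs]
        change Ck / s ^ k ≤ 2 ^ k * (Ck / t ^ k)
        rw [← mul_div_assoc, div_le_div_iff₀ (by positivity) (by positivity)]
        calc Ck * t ^ k ≤ Ck * (2 * s) ^ k := by gcongr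
          _ = 2 ^ k * Ck * s ^ k := by rw [mul_pow]; ring)
      hsmall hflux
    refine ⟨max Ck (C * Ck), le_max_left _ _, fun τ hτ => (hC τ hτ).trans
      (ENNReal.ofReal_le_ofReal ?_)⟩
    have hτ0 : 0 < τ := hτ₀.trans hτ
    rw [← mul_div_assoc]
    gcongr
    exact le_max_right _ _
  · set c := min (b₀ / 2) β with hc
    have hc0 : 0 < c := lt_min (by positivity) hβ
    obtain ⟨L, hℓL, hL, hsmall⟩ := SdS.exists_mul_exp_le_half (half_pos hb₀) K ℓ
    -- Here `q = exp (c L)` grows with `L`, but `c ≤ b₀ / 2` gives `q exp (-b₀ L) ≤ exp (-b₀ L /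
    -- 2)`; hence `L` was chosen for the halved rate.
    obtain ⟨C, hC⟩ := hG (fun τ => Cβ * Real.exp (-(c * τ))) τ₀ (τ₀ + 1) L (Real.exp (c * L))
      (fun s _ t _ hst => by
        change Cβ * Real.exp (-(c * t)) ≤ Cβ * Real.exp (-(c * s))
        gcongr)
      (fun s _ => by positivity) (lt_add_one τ₀) hℓL hL (Real.exp_pos _).le
      (fun s t _ _ htL => by
        rw [mul_left_comm, ← Real.exp_add]
        gcongr
        nlinarith)
      (by
        refine le_trans ?_ hsmall
        rw [mul_assoc, ← Real.exp_add]
        gcongr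
        nlinarith [min_le_left (b₀ / 2) β])
      (fun τ hτ => (hflux τ hτ).trans (ENNReal.ofReal_le_ofReal (by
        have hτ0 : 0 < τ := hτ₀.trans hτ
        change Cβ * Real.exp (-(β * τ)) ≤ Cβ * Real.exp (-(c * τ))
        gcongr
        exact min_le_right _ _)))
    -- The `+ 1` makes the comparison with `Cβ` strict.
    refine ⟨max (Cβ + 1) (C * Cβ), (lt_add_one Cβ).trans_le (le_max_left _ _), fun τ hτ =>
      (hC τ hτ).trans (ENNReal.ofReal_le_ofReal ?_)⟩
    rw [← mul_assoc]
    gcongr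
    exact le_max_right _ _
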